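/- **Setting.** Write $[x]_\times$ for the skew matrix of $x\in\mathbb R^3$, $\psi(M)$ for the vector with $[\psi(M)]_\times=(M-M^\top)/2$, $|X|_I^2=\frac18\|I-X\|_F^2$, and $\mathcal R_a(\theta,u)=I+\sin\theta\,[u]_\times+(1-\cos\theta)[u]_\times^2$. A rigid body attitude $R(t)\in SO(3)$ satisfies $\dot R=R[\omega]_\times$. The measurements are $b_i=R^\top a_i$, $i=1,\dots,n$, for known $a_i\in\mathbb R^3$, three of which are linearly independent, and $\omega_y=\omega+b_\omega$ with an unknown constant bias $b_\omega$. Let $A=\sum_i\rho_ia_ia_i^\top$ with $\rho_i>0$ chosen such that $A$ has distinct eigenvalues $\lambda_1<\lambda_2<\lambda_3$, with unit eigenvectors $v_1,v_2,v_3$. Put $\bar A=\frac12(\mathrm{tr}(A)I-A)$, $\xi=\lambda_{\min}^{\bar A}/\lambda_{\max}^{\bar A}$, $0<k<1/\sqrt{6-\max\{1,4\xi^2\}}$, $$U_A(X)=\frac{\mathrm{tr}(A(I-X))}{4\lambda_{\max}^{\bar A}},\quad V_A=2\bigl(1-\sqrt{1-U_A}\bigr),\quad \Gamma_A(X,q)=X\,\mathcal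 R_a\bigl(2\arcsin(kU_A(X)),\nu(q)\bigr),$$ $\Phi_{U_A}=U_A\circ\Gamma_A$, $\Phi_{V_A}=V_A\circ\Gamma_A$, $\mathcal Q=\{1,2\}$, $\nu(1)=u$, $\nu(2)=-u$. Let $\sigma=\sum_{l\ne m}\lambda_l\lambda_m$ (ordered pairs). The unit vector $u$ satisfies, if $\lambda_2\lambda_3-\lambda_1\lambda_2-\lambda_1\lambda_3\ge0$, $u^\top v_1=0$ and $(u^\top v_i)^2=\lambda_i/(\lambda_2+\lambda_3)$ for $i\in\{2,3\}$; otherwise $(u^\top v_i)^2=1-4\prod_{j\ne i}\lambda_j/\sigma$ for $i\in\{1,2,3\}$. In these two cases respectively $\Lambda=\lambda_1/(\lambda_2+\lambda_3)$ and $\Lambda=4\lambda_1\lambda_2\lambda_3/((\lambda_2+\lambda_3)\sigma)$. Let $\bar V=(-1+\sqrt{1+4k^2\xi\Lambda})/(2k^2\Lambda)$, $\Delta_{III}=4k^2\bar V^2(1-k^2\bar V^2)\Lambda$, $\Delta_{IV}=2(-\sqrt{1-\xi}+\sqrt{1-\xi+\Delta_{III}})$. Design D3 is $\Phi=\Phi_{U_A}$,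 $0<\delta<\Delta_{III}$; design D4 is $\Phi=\Phi_{V_A}$, $0<\delta<\Delta_{IV}$. **Observer.** With gains $\gamma_P,\gamma_I>0$, $\tilde R=R\hat R^\top$, $\tilde b_\omega=b_\omega-\hat b_\omega$: $$\dot{\hat R}=\hat R[\omega_y-\hat b_\omega+\gamma_P\beta]_\times,\qquad \dot{\hat b}_\omega=-\gamma_I\beta,\qquad \beta=\beta(\Phi(\tilde R,q))=\hat R^\top\psi\bigl(\tilde R^\top\nabla\Phi(\tilde R,q)\bigr),$$ where $\nabla$ is the gradient in $\tilde R$ for the metric $\langle X\Omega_1,X\Omega_2\rangle_X=\mathrm{tr}(\Omega_1^\top\Omega_2)$ on $SO(3)$; $\dot q=0$ on the flow set $\mathcal F=\{(\tilde R,q):\Phi(\tilde R,q)-\min_p\Phi(\tilde R,p)\le\delta\}$, and jumps $q^+\in\arg\min_p\Phi(\tilde R,p)$ occur where $\Phi(\tilde R,q)-\min_p\Phi(\tilde R,p)\ge\delta$. Solutions are locally absolutely continuous hybrid arcs on hybrid time domains starting at $(t_0,0)$, $t_0\ge0$. Define from the measurements $$\vartheta=\frac{\sum_i\rho_i\|b_i-\hat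 R^\top a_i\|^2}{8\lambda_{\max}^{\bar A}},\quad \bar{\mathfrak R}=\mathcal R_a(2\arcsin(k\vartheta),\nu(q)),\quad \bar\Theta=I+\frac{k\hat R\sum_i\rho_i(b_i\times\hat R^\top a_i)\nu(q)^\top}{2\lambda_{\max}^{\bar A}\sqrt{1-k^2\vartheta^2}},$$ $$\bar\Phi=\frac{1}{8\lambda_{\max}^{\bar A}}\sum_i\rho_i\|b_i-\hat R^\top\bar{\mathfrak R}a_i\|^2,\qquad \bar\beta=\frac1{8\lambda_{\max}^{\bar A}}\hat R^\top\bar\Theta\hat R\sum_i\rho_i(b_i\times\hat R^\top\bar{\mathfrak R}a_i).$$ **Theorem.** (1) Observer III (design D3): for all $R,\hat R\in SO(3)$, $q\in\mathcal Q$, $\Phi_{U_A}(\cdot,q)$ is differentiable at $\tilde R$, $\Phi_{U_A}(\tilde R,q)=\bar\Phi$ and $\beta(\Phi_{U_A}(\tilde R,q))=\bar\beta$. (2) Observer IV (design D4): for all $R,\hat R\in SO(3)$, $q\in\mathcal Q$, $\Phi_{V_A}(\tilde R,q)=2(1-\sqrt{1-\bar\Phi})$; wherever $\Phi_{U_A}(\tilde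 R,q)\ne1$, and this holds on all of $\mathcal F$, one has $\bar\Phi<1$, $\Phi_{V_A}(\cdot,q)$ is differentiable at $\tilde R$, and $\beta(\Phi_{V_A}(\tilde R,q))=\bar\beta/\sqrt{1-\bar\Phi}$. (3) For both observers, implemented with these measurement-based expressions and coupled with $\dot R=R[\omega]_\times$, $\omega$ uniformly bounded: every maximal solution is complete, the number of jumps is finite, and $e=(|\tilde R|_I,\|\tilde b_\omega\|)$ converges to $0$ exponentially from every initial condition, in the following uniform sense. There is $K>0$ such that for all $r,c>0$ there are $N\in\mathbb N$ and $\mu>0$ such that for every $t_0\ge0$, every $b_\omega$, every attitude trajectory with $\sup_{t\ge t_0}\|\omega(t)\|\le c$ and every solution with $\|e(t_0,0)\|\le r$, all $(t,j)$ in its domain satisfy $j\le N$ and $$\|e(t,j)\|\le K e^{-\mu(t-t_0+j)}\|e(t_0,0)\|.$$ -/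

import Mathlib

open Matrix Filter Topology MeasureTheory Set
open scoped BigOperators

noncomputable section

namespace AttitudeObserver

/-! ### Vectors, matrices and rotations -/

/-- Vectors of three-dimensional space. The Euclidean norm is `vnorm` below; the (sup) norm that
Mathlib puts on this type is never used for lengths. -/
abbrev Vec3 := Fin 3 → ℝ

/-- Real three-by-three matrices. -/
abbrev Mat3 := Matrix (Fin 3) (Fin 3) ℝ

/-- Squared Euclidean norm of a vector. -/
def sqNorm (x : Vec3) : ℝ := x ⬝ᵥ x

/-- Euclidean norm of a vector. -/
def vnorm (x : Vec3) : ℝ := √(sqNorm x)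

/-- The rotation group `SO(3)` as a set of matrices. -/
def SO3 : Set Mat3 := {X | X ∈ Matrix.specialOrthogonalGroup (Fin 3) ℝ}

/-- The skew-symmetric matrix `[x]_×` with `[x]_× y = x × y`. -/
def skew (x : Vec3) : Mat3 :=
  !![0, -x 2, x 1; x 2, 0, -x 0; -x 1, x 0, 0]

theorem skew_mulVec (x y : Vec3) : skew x *ᵥ y = crossProduct x y := by
  ext i
  fin_cases i <;>
    simp [skew, Matrix.mulVec, dotProduct, Fin.sum_univ_three, crossProduct] <;> ring

/-- The map `ψ(M)`: the vector of the skew-symmetric part `(M - Mᵀ)/2`. On skew-symmetric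
matrices it is the inverse `[·]_⊗` of `[·]_×`. -/
def psi (M : Mat3) : Vec3 :=
  (1 / 2 : ℝ) • ![M 2 1 - M 1 2, M 0 2 - M 2 0, M 1 0 - M 0 1]

/-- The inner product `tr(Mᵀ N)`. -/
def frobInner (M N : Mat3) : ℝ := (Mᵀ * N).trace

/-- The Frobenius norm. -/
def frobNorm (M : Mat3) : ℝ := √(frobInner M M)

/-- The normalized distance `|X|_I` of a rotation to the identity,
`|X|_I² = ‖I - X‖_F² / 8`. -/
def attDist (X : Mat3) : ℝ := √((1 / 8) * frobNorm (1 - X) ^ 2)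

/-- Rotation by the angle `θ` about the unit vector `u`. -/
def rodrigues (θ : ℝ) (u : Vec3) : Mat3 :=
  1 + Real.sin θ • skew u + (1 - Real.cos θ) • (skew u * skew u)

/-! ### Gradients on `SO(3)` -/

/-- `G` is the gradient at `X ∈ SO(3)` of the function `f` on `SO(3)`: `G` lies in the tangent
space `{X Ω | Ωᵀ = -Ω}` and `f (Y) = f (X) + ⟪G, Y - X⟫ + o(‖Y - X‖)` as `Y → X` in `SO(3)`.
The Riemannian metric `⟪X Ω₁, X Ω₂⟫_X = tr(Ω₁ᵀ Ω₂)` is the restriction of the Frobenius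
inner product to the tangent space. -/
def IsGradSO3 (f : Mat3 → ℝ) (X G : Mat3) : Prop :=
  (∃ Ω : Mat3, Ωᵀ = -Ω ∧ G = X * Ω) ∧
    (fun Y => f Y - f X - frobInner G (Y - X)) =o[𝓝[SO3] X] (fun Y => frobNorm (Y - X))

/-- `f` is differentiable at `X` as a function on `SO(3)`. -/
def DiffAtSO3 (f : Mat3 → ℝ) (X : Mat3) : Prop := ∃ G, IsGradSO3 f X G

open Classical in
/-- The gradient of `f` at `X` (and `0` where `f` is not differentiable). -/
def gradSO3 (f : Mat3 → ℝ) (X : Mat3) : Mat3 :=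
  if h : DiffAtSO3 f X then h.choose else 0

/-! ### Potential functions -/

/-- `Ā = (tr(A) I - A) / 2`. -/
def barMat (A : Mat3) : Mat3 := (1 / 2 : ℝ) • (A.trace • (1 : Mat3) - A)

/-- Largest eigenvalue of a symmetric matrix. -/
def eigMax (M : Mat3) : ℝ := sSup (spectrum ℝ M)

/-- Smallest eigenvalue of a symmetric matrix. -/
def eigMin (M : Mat3) : ℝ := sInf (spectrum ℝ M)

/-- `ξ = λ_min(Ā) / λ_max(Ā)`. -/
def xi (A : Mat3) : ℝ := eigMin (barMat A) / eigMax (barMat A)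

/-- `U_A(X) = tr(A (I - X)) / (4 λ_max(Ā))`. -/
def UA (A X : Mat3) : ℝ := (A * (1 - X)).trace / (4 * eigMax (barMat A))

/-- `V_A(X) = 2 (1 - √(1 - U_A(X)))`. -/
def VA (A X : Mat3) : ℝ := 2 * (1 - √(1 - UA A X))

/-- The angular warping `Γ_A(X, q) = X R_a(2 arcsin(k U_A(X)), ν(q))`. -/
def Gam (A : Mat3) (k : ℝ) (ν : ℕ → Vec3) (X : Mat3) (q : ℕ) : Mat3 :=
  X * rodrigues (2 * Real.arcsin (k * UA A X)) (ν q)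

/-- `Φ_{U_A} = U_A ∘ Γ_A`. -/
def PhiU (A : Mat3) (k : ℝ) (ν : ℕ → Vec3) (X : Mat3) (q : ℕ) : ℝ := UA A (Gam A k ν X q)

/-- `Φ_{V_A} = V_A ∘ Γ_A`. -/
def PhiV (A : Mat3) (k : ℝ) (ν : ℕ → Vec3) (X : Mat3) (q : ℕ) : ℝ := VA A (Gam A k ν X q)

/-- The injection term `β(Φ(R̃, q)) = R̂ᵀ [R̃ᵀ ∇Φ(R̃, q)]_⊗`. -/
def beta (Φ : Mat3 → ℕ → ℝ) (Rhat Rtilde : Mat3) (q : ℕ) : Vec3 :=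
  Rhatᵀ *ᵥ psi (Rtildeᵀ * gradSO3 (fun Y => Φ Y q) Rtilde)

/-- The flow set: all `(X, q)` in `SO(3) × Q` with `Φ(X, q) - min_{p ∈ Q} Φ(X, p) ≤ δ`. -/
def flowSet (Φ : Mat3 → ℕ → ℝ) (Q : Finset ℕ) (δ : ℝ) : Set (Mat3 × ℕ) :=
  {z | z.1 ∈ SO3 ∧ z.2 ∈ Q ∧ Φ z.1 z.2 - sInf (Φ z.1 '' Q) ≤ δ}

/-! ### Design parameters -/

/-- The index set `{1, 2}`. -/
def indexSet : Finset ℕ := {1, 2}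

/-- `ν(1) = u`, `ν(2) = -u`. -/
def nuMap (u : Vec3) (q : ℕ) : Vec3 := if q = 1 then u else -u

/-- The upper bound `k̄ = 1 / √(6 - max {1, 4 ξ²})` for the warping gain. -/
def kBar (A : Mat3) : ℝ := 1 / √(6 - max 1 (4 * xi A ^ 2))

/-- The sum of `λ_l λ_m` over ordered pairs `l ≠ m`. -/
def pairSum (lam : Fin 3 → ℝ) : ℝ := ∑ l, ∑ m ∈ Finset.univ.erase l, lam l * lam m

/-- The common part of the designs for `Φ_{U_A}` and `Φ_{V_A}` with two configurations: `A` has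
the eigenvalues `lam 0 < lam 1 < lam 2` with unit eigenvectors `v 0, v 1, v 2`, the unit vector
`u` is placed relative to the eigenvectors as prescribed, and the gain `k` is admissible. -/
structure IsDesign (A : Mat3) (lam : Fin 3 → ℝ) (v : Fin 3 → Vec3) (u : Vec3) (k : ℝ) :
    Prop where
  lam_strictMono : StrictMono lam
  eigen : ∀ i, A *ᵥ v i = lam i • v i
  unit_v : ∀ i, sqNorm (v i) = 1
  unit_u : sqNorm u = 1
  u_case_nonneg : 0 ≤ lam 1 * lam 2 - lam 0 * lam 1 - lam 0 * lam 2 →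
    u ⬝ᵥ v 0 = 0 ∧ (u ⬝ᵥ v 1) ^ 2 = lam 1 / (lam 1 + lam 2) ∧
      (u ⬝ᵥ v 2) ^ 2 = lam 2 / (lam 1 + lam 2)
  u_case_neg : lam 1 * lam 2 - lam 0 * lam 1 - lam 0 * lam 2 < 0 →
    ∀ i, (u ⬝ᵥ v i) ^ 2 = 1 - 4 * (∏ j ∈ Finset.univ.erase i, lam j) / pairSum lam
  k_pos : 0 < k
  k_lt : k < kBar A

/-- The constant `Λ`. -/
def capLambda (lam : Fin 3 → ℝ) : ℝ :=
  if 0 ≤ lam 1 * lam 2 - lam 0 * lam 1 - lam 0 * lam 2 then lam 0 / (lam 1 + lam 2)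
  else 4 * (∏ j, lam j) / ((lam 1 + lam 2) * pairSum lam)

/-- The constant `V̄ = (-1 + √(1 + 4 k² ξ Λ)) / (2 k² Λ)`. -/
def barV (A : Mat3) (lam : Fin 3 → ℝ) (k : ℝ) : ℝ :=
  (-1 + √(1 + 4 * k ^ 2 * xi A * capLambda lam)) / (2 * k ^ 2 * capLambda lam)

/-- The bound `Δ_III = 4 k² V̄² (1 - k² V̄²) Λ` for the hysteresis gap of `Φ_{U_A}`. -/
def DeltaIII (A : Mat3) (lam : Fin 3 → ℝ) (k : ℝ) : ℝ :=
  4 * k ^ 2 * barV A lam k ^ 2 * (1 - k ^ 2 * barV A lam k ^ 2) * capLambda lam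

/-- The bound `Δ_IV = 2 (-√(1 - ξ) + √(1 - ξ + Δ_III))` for the hysteresis gap of `Φ_{V_A}`. -/
def DeltaIV (A : Mat3) (lam : Fin 3 → ℝ) (k : ℝ) : ℝ :=
  2 * (-√(1 - xi A) + √(1 - xi A + DeltaIII A lam k))

/-! ### Terms computed from the vector measurements

`a i` are the known inertial vectors, `b i` the measured body-frame vectors, `ρ i` the weights,
`Rhat` the attitude estimate. -/

/-- `A = ∑ ρ_i a_i a_iᵀ`. -/
def weightMat {n : ℕ} (ρ : Fin n → ℝ) (a : Fin n → Vec3) : Mat3 :=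
  ∑ i, ρ i • vecMulVec (a i) (a i)

/-- `λ_max(Ā)` for `A = ∑ ρ_i a_i a_iᵀ`. -/
def lmax {n : ℕ} (ρ : Fin n → ℝ) (a : Fin n → Vec3) : ℝ := eigMax (barMat (weightMat ρ a))

/-- `ϑ = ∑ ρ_i ‖b_i - R̂ᵀ a_i‖² / (8 λ_max(Ā))`. -/
def varth {n : ℕ} (ρ : Fin n → ℝ) (a b : Fin n → Vec3) (Rhat : Mat3) : ℝ :=
  (∑ i, ρ i * sqNorm (b i - Rhatᵀ *ᵥ a i)) / (8 * lmax ρ a)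

/-- `𝔯 = R_a(2 arcsin(k ϑ), ν(q))`. -/
def RBar {n : ℕ} (ρ : Fin n → ℝ) (a : Fin n → Vec3) (k : ℝ) (ν : ℕ → Vec3)
    (b : Fin n → Vec3) (Rhat : Mat3) (q : ℕ) : Mat3 :=
  rodrigues (2 * Real.arcsin (k * varth ρ a b Rhat)) (ν q)

/-- `Φ̄ = ∑ ρ_i ‖b_i - R̂ᵀ 𝔯 a_i‖² / (8 λ_max(Ā))`. -/
def PhiBar {n : ℕ} (ρ : Fin n → ℝ) (a : Fin n → Vec3) (k : ℝ) (ν : ℕ → Vec3)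
    (b : Fin n → Vec3) (Rhat : Mat3) (q : ℕ) : ℝ :=
  1 / (8 * lmax ρ a) *
    ∑ i, ρ i * sqNorm (b i - Rhatᵀ *ᵥ (RBar ρ a k ν b Rhat q *ᵥ a i))

/-- `Θ̄ = I + k R̂ (∑ ρ_i b_i × R̂ᵀ a_i) ν(q)ᵀ / (2 λ_max(Ā) √(1 - k² ϑ²))`. -/
def ThetaBar {n : ℕ} (ρ : Fin n → ℝ) (a : Fin n → Vec3) (k : ℝ) (ν : ℕ → Vec3)
    (b : Fin n → Vec3) (Rhat : Mat3) (q : ℕ) : Mat3 :=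
  1 + (k / (2 * lmax ρ a * √(1 - k ^ 2 * varth ρ a b Rhat ^ 2))) •
    vecMulVec (Rhat *ᵥ ∑ i, ρ i • crossProduct (b i) (Rhatᵀ *ᵥ a i)) (ν q)

/-- `β̄ = R̂ᵀ Θ̄ R̂ (∑ ρ_i b_i × R̂ᵀ 𝔯 a_i) / (8 λ_max(Ā))`. -/
def betaBar {n : ℕ} (ρ : Fin n → ℝ) (a : Fin n → Vec3) (k : ℝ) (ν : ℕ → Vec3)
    (b : Fin n → Vec3) (Rhat : Mat3) (q : ℕ) : Vec3 :=
  (1 / (8 * lmax ρ a)) • (Rhatᵀ *ᵥ (ThetaBar ρ a k ν b Rhat q *ᵥ (Rhat *ᵥ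
    ∑ i, ρ i • crossProduct (b i) (Rhatᵀ *ᵥ (RBar ρ a k ν b Rhat q *ᵥ a i)))))

/-! ### Hybrid time domains and the closed-loop hybrid system -/

/-- Hybrid time domains starting at time `t0`: unions of finitely or infinitely many intervals
`[τ_j, τ_{j+1}] × {j}`, `t0 = τ_0 ≤ τ_1 ≤ …`, where a last interval, if there is one, has the form
`[τ_N, T] × {N}`, `[τ_N, T) × {N}` or `[τ_N, ∞) × {N}`. -/
def IsHybridTimeDomain (t0 : ℝ) (E : Set (ℝ × ℕ)) : Prop :=
  ∃ τ : ℕ → ℝ, τ 0 = t0 ∧ Monotone τ ∧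
    (E = {z | z.1 ∈ Icc (τ z.2) (τ (z.2 + 1))} ∨
      ∃ (N : ℕ) (L : Set ℝ),
        (L = Icc (τ N) (τ (N + 1)) ∨ (τ N < τ (N + 1) ∧ L = Ico (τ N) (τ (N + 1))) ∨
          L = Ici (τ N)) ∧
        E = {z | (z.2 < N ∧ z.1 ∈ Icc (τ z.2) (τ (z.2 + 1))) ∨ (z.2 = N ∧ z.1 ∈ L)})

/-- The slice `I_j = {t | (t, j) ∈ E}`. -/
def slice (E : Set (ℝ × ℕ)) (j : ℕ) : Set ℝ := {t | (t, j) ∈ E}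

/-- Local absolute continuity of a real function on an interval `I`. -/
def LocAbsCont (f : ℝ → ℝ) (I : Set ℝ) : Prop :=
  ∀ a b : ℝ, a ≤ b → Icc a b ⊆ I → AbsolutelyContinuousOnInterval f a b

/-- `R` is an attitude trajectory in `SO(3)` on `[t0, ∞)` with body-frame angular velocity `ω`:
`R' = R [ω]_×`. -/
def IsAttitudeTrajectory (t0 : ℝ) (R : ℝ → Mat3) (ω : ℝ → Vec3) : Prop :=
  (∀ t, t0 ≤ t → R t ∈ SO3) ∧
  (∀ i l, LocAbsCont (fun t => R t i l) (Ici t0)) ∧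
  ∀ᵐ t : ℝ, t0 ≤ t → ∀ i l, HasDerivAt (fun s => R s i l) ((R t * skew (ω t)) i l) t

/-- A hybrid attitude and gyro-bias observer fed by a measurement with values in `Y`: its index
set, hysteresis gap and gains, the potential value `pot y R̂ q` and the injection term
`inj y R̂ q`. -/
structure HybridObserver (Y : Type) where
  Q : Finset ℕ
  δ : ℝ
  γP : ℝ
  γI : ℝ
  pot : Y → Mat3 → ℕ → ℝ
  inj : Y → Mat3 → ℕ → Vec3

/-- A candidate trajectory of the observer state `(R̂, b̂_ω, q)` with its time domain. The values
outside `dom` are irrelevant. -/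
structure HybridArc where
  dom : Set (ℝ × ℕ)
  Rhat : ℝ → ℕ → Mat3
  bhat : ℝ → ℕ → Vec3
  q : ℝ → ℕ → ℕ

/-- The excess `Φ(·, q) - min_{p ∈ Q} Φ(·, p)` that governs the switching. -/
def HybridObserver.gap {Y : Type} (O : HybridObserver Y) (y : Y) (Rhat : Mat3) (q : ℕ) : ℝ :=
  O.pot y Rhat q - sInf (O.pot y Rhat '' O.Q)

/-- `x` is a solution, started at time `t0`, of the hybrid observer `O` driven by the measurement
`y` and the measured angular velocity `ωy`. During flows
`R̂' = R̂ [ωy - b̂ + γ_P β]_×`, `b̂' = -γ_I β`, `q' = 0` in the flow set `gap ≤ δ`; jumps occur in the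
jump set `gap ≥ δ`, leave `R̂` and `b̂` unchanged and move `q` to a minimizer of the potential. -/
structure IsSolution {Y : Type} (O : HybridObserver Y) (y : ℝ → Y) (ωy : ℝ → Vec3)
    (t0 : ℝ) (x : HybridArc) : Prop where
  dom_hybrid : IsHybridTimeDomain t0 x.dom
  Rhat_mem : ∀ t j, (t, j) ∈ x.dom → x.Rhat t j ∈ SO3
  q_mem : ∀ t j, (t, j) ∈ x.dom → x.q t j ∈ O.Q
  Rhat_ac : ∀ j i l, LocAbsCont (fun t => x.Rhat t j i l) (slice x.dom j)
  bhat_ac : ∀ j i, LocAbsCont (fun t => x.bhat t j i) (slice x.dom j)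
  q_const : ∀ j t s, (t, j) ∈ x.dom → (s, j) ∈ x.dom → x.q t j = x.q s j
  flow_set : ∀ j, ∀ t ∈ interior (slice x.dom j),
    O.gap (y t) (x.Rhat t j) (x.q t j) ≤ O.δ
  flow_Rhat : ∀ j, ∀ᵐ t : ℝ, t ∈ interior (slice x.dom j) →
    ∀ i l, HasDerivAt (fun s => x.Rhat s j i l)
      ((x.Rhat t j * skew (ωy t - x.bhat t j +
        O.γP • O.inj (y t) (x.Rhat t j) (x.q t j))) i l) t
  flow_bhat : ∀ j, ∀ᵐ t : ℝ, t ∈ interior (slice x.dom j) →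
    ∀ i, HasDerivAt (fun s => x.bhat s j i)
      ((-(O.γI • O.inj (y t) (x.Rhat t j) (x.q t j))) i) t
  jump_set : ∀ t j, (t, j) ∈ x.dom → (t, j + 1) ∈ x.dom →
    O.δ ≤ O.gap (y t) (x.Rhat t j) (x.q t j)
  jump_Rhat : ∀ t j, (t, j) ∈ x.dom → (t, j + 1) ∈ x.dom → x.Rhat t (j + 1) = x.Rhat t j
  jump_bhat : ∀ t j, (t, j) ∈ x.dom → (t, j + 1) ∈ x.dom → x.bhat t (j + 1) = x.bhat t j
  jump_q : ∀ t j, (t, j) ∈ x.dom → (t, j + 1) ∈ x.dom →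
    ∀ p ∈ O.Q, O.pot (y t) (x.Rhat t j) (x.q t (j + 1)) ≤ O.pot (y t) (x.Rhat t j) p

/-- A solution that cannot be extended to a solution with a larger time domain. -/
def IsMaximalSolution {Y : Type} (O : HybridObserver Y) (y : ℝ → Y) (ωy : ℝ → Vec3)
    (t0 : ℝ) (x : HybridArc) : Prop :=
  IsSolution O y ωy t0 x ∧
    ∀ x' : HybridArc, IsSolution O y ωy t0 x' → x.dom ⊆ x'.dom →
      (∀ t j, (t, j) ∈ x.dom →
        x'.Rhat t j = x.Rhat t j ∧ x'.bhat t j = x.bhat t j ∧ x'.q t j = x.q t j) →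
      x'.dom = x.dom

/-- The time domain is unbounded: infinitely many jumps or infinite continuous time. -/
def HybridArc.IsComplete (x : HybridArc) : Prop :=
  ∀ M : ℝ, ∃ t j, (t, j) ∈ x.dom ∧ M ≤ t + (j : ℝ)

/-- The norm of the error `e = (|R R̂ᵀ|_I, ‖b_ω - b̂_ω‖)`. -/
def errNorm (R : ℝ → Mat3) (bω : Vec3) (x : HybridArc) (t : ℝ) (j : ℕ) : ℝ :=
  √(attDist (R t * (x.Rhat t j)ᵀ) ^ 2 + vnorm (bω - x.bhat t j) ^ 2)

/-- The stability property of the observer `O` with the measurement `y = h(R)` and the biased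
angular velocity `ω + b_ω`, for bounded angular velocities: every maximal solution is complete,
the number of jumps is finite, and the error is bounded by
`K e^{-μ (t - t0 + j)}` times its initial value. The gain `K` is the same for all solutions;
the rate `μ` and the bound `N` on the number of jumps are uniform over all initial times,
attitude trajectories, biases and solutions with initial error at most `r` and angular velocity
at most `c`, where `r` and `c` are arbitrary. -/
def EnsuresExpStability {Y : Type} (O : HybridObserver Y) (h : Mat3 → Y) : Prop :=
  (∀ (t0 : ℝ) (R : ℝ → Mat3) (ω : ℝ → Vec3) (bω : Vec3) (x : HybridArc), 0 ≤ t0 →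
    IsAttitudeTrajectory t0 R ω → (∃ c : ℝ, ∀ t, t0 ≤ t → vnorm (ω t) ≤ c) →
    IsMaximalSolution O (fun t => h (R t)) (fun t => ω t + bω) t0 x → x.IsComplete) ∧
  ∃ K : ℝ, 0 < K ∧ ∀ r c : ℝ, 0 < r → 0 < c → ∃ (N : ℕ) (μ : ℝ), 0 < μ ∧
    ∀ (t0 : ℝ) (R : ℝ → Mat3) (ω : ℝ → Vec3) (bω : Vec3) (x : HybridArc), 0 ≤ t0 →
      IsAttitudeTrajectory t0 R ω → (∀ t, t0 ≤ t → vnorm (ω t) ≤ c) →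
      IsSolution O (fun t => h (R t)) (fun t => ω t + bω) t0 x →
      errNorm R bω x t0 0 ≤ r →
      ∀ t j, (t, j) ∈ x.dom → j ≤ N ∧
        errNorm R bω x t j ≤ K * Real.exp (-μ * (t - t0 + (j : ℝ))) * errNorm R bω x t0 0

/-- The body-frame measurements `b_i = Rᵀ a_i`. -/
def bodyMeas {n : ℕ} (a : Fin n → Vec3) (R : Mat3) : Fin n → Vec3 := fun i => Rᵀ *ᵥ a i

/-- Observer III: potential `Φ̄`, injection `β̄`, computed from the vector measurements. -/
def observerIII {n : ℕ} (ρ : Fin n → ℝ) (a : Fin n → Vec3) (k : ℝ) (u : Vec3) (δ γP γI : ℝ) :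
    HybridObserver (Fin n → Vec3) where
  Q := indexSet
  δ := δ
  γP := γP
  γI := γI
  pot := fun b Rhat q => PhiBar ρ a k (nuMap u) b Rhat q
  inj := fun b Rhat q => betaBar ρ a k (nuMap u) b Rhat q

/-- Observer IV: potential `2 (1 - √(1 - Φ̄))`, injection `β̄ / √(1 - Φ̄)`, computed from the vector
measurements. -/
def observerIV {n : ℕ} (ρ : Fin n → ℝ) (a : Fin n → Vec3) (k : ℝ) (u : Vec3) (δ γP γI : ℝ) :
    HybridObserver (Fin n → Vec3) where
  Q := indexSet
  δ := δ
  γP := γP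
  γI := γI
  pot := fun b Rhat q => 2 * (1 - √(1 - PhiBar ρ a k (nuMap u) b Rhat q))
  inj := fun b Rhat q =>
    (1 / √(1 - PhiBar ρ a k (nuMap u) b Rhat q)) • betaBar ρ a k (nuMap u) b Rhat q

end AttitudeObserver

end

open Matrix Filter Topology MeasureTheory Set
open scoped BigOperators

namespace AttitudeObserver

open scoped Matrix.Norms.Elementwise

/-! ### Euclidean geometry of `ℝ³` -/

/-! The argument has an algebraic half, showing that the flow set of each design contains no
spurious critical point of its potential, and a dynamical half, which uses only this fact and the
smoothness of the potential.

Algebra. Every rotation is `rot η ε` for a unit quaternion (`exists_rot`). Let e_i be the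
coordinates of ε along the eigenvectors and s_i the eigenvalues of Ā divided by the largest one.
Then U_A = ∑ s_i e_i², and |ψ(A X)|² is a positive multiple of ∑ (s_i e_i)² - U_A². Hence U_A is
comparable with |X|_I², and ψ(A X) vanishes only where U_A = 0 or at the half turns about the v_i
(`UA_rot`, `sqNorm_psi_rot`, `eq_half_turn_of_psi_eq_zero`). The gradient of the warped potential is
an invertible linear image of ψ(A Γ), uniformly so because k² < 1/2 (`vnorm_gradVec_bounds`). A bad
critical point X is therefore a half turn about some v_i followed by the rotation by -2φ about ν(q),
where sin φ = k U_A(X). Switching to the opposite axis changes the angle of Γ from 0 to -4φ and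
lowers the potential by 4 k² U² (1 - k² U²) d_i. The choice of u makes d_i ≥ Λ, and U ≥ V̄, so the
drop is at least Δ_III > δ and X is outside the flow set (`exists_drop`). For V_A, concavity of the
square root turns Δ_III into Δ_IV. Compactness then bounds the squared gradient below by a multiple
of |R̃|_I² on the flow set (`exists_le_sqNorm_psi`).

Dynamics. The angular velocity cancels from the error equations. The function Φ + ‖b̃‖²/γ_I
decreases along flows at the rate 2 γ_P |G|², where G is the gradient vector, and by at least δ at
each jump; this bounds the number of jumps and the bias error. The decrease is not strict in b̃. A
small multiple of the cross term (R b̃)·ψ(R̃), which jumps do not change, contributes -‖b̃‖² and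
gives a strict Lyapunov function (`cross_term_le`, `exists_strict_lyapunov`). The bound on ω enters
only through the derivative of this term, so the rate depends on r and c while the gain K does not.

Completeness follows by continuation: a solution on a bounded domain with open end has bounded
velocity and extends to the end point; at a closed end either a jump is possible or the gap is below
δ and the error equations have a local solution (`Realizes.isComplete`). The measurement formulas
reduce to two identities for weighted sums, `sum_sqNorm_sub` and `sum_cross`. -/

theorem dot_eq (x y : Vec3) : x ⬝ᵥ y = x 0 * y 0 + x 1 * y 1 + x 2 * y 2 := vec3_dotProduct x y

theorem sqNorm_eq (x : Vec3) : sqNorm x = x 0 ^ 2 + x 1 ^ 2 + x 2 ^ 2 := by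
  rw [sqNorm, dot_eq]; ring

theorem sqNorm_nonneg (x : Vec3) : 0 ≤ sqNorm x := by rw [sqNorm_eq]; positivity

theorem vnorm_nonneg (x : Vec3) : 0 ≤ vnorm x := Real.sqrt_nonneg _

theorem vnorm_sq (x : Vec3) : vnorm x ^ 2 = sqNorm x := Real.sq_sqrt (sqNorm_nonneg x)

theorem dot_sq_le (x y : Vec3) : (x ⬝ᵥ y) ^ 2 ≤ sqNorm x * sqNorm y := by
  rw [dot_eq, sqNorm_eq, sqNorm_eq]
  nlinarith [sq_nonneg (x 0 * y 1 - x 1 * y 0), sq_nonneg (x 0 * y 2 - x 2 * y 0),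
    sq_nonneg (x 1 * y 2 - x 2 * y 1)]

theorem abs_dot_le (x y : Vec3) : |x ⬝ᵥ y| ≤ vnorm x * vnorm y := by
  apply abs_le_of_sq_le_sq _ (mul_nonneg (vnorm_nonneg x) (vnorm_nonneg y))
  rw [mul_pow, vnorm_sq, vnorm_sq]
  exact dot_sq_le x y

theorem dot_le (x y : Vec3) : x ⬝ᵥ y ≤ vnorm x * vnorm y := (le_abs_self _).trans (abs_dot_le x y)

theorem sqNorm_add (x y : Vec3) : sqNorm (x + y) = sqNorm x + 2 * (x ⬝ᵥ y) + sqNorm y := by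
  simp only [sqNorm_eq, dot_eq, Pi.add_apply]; ring

theorem sqNorm_smul (c : ℝ) (x : Vec3) : sqNorm (c • x) = c ^ 2 * sqNorm x := by
  simp only [sqNorm_eq, Pi.smul_apply, smul_eq_mul]; ring

theorem vnorm_smul (c : ℝ) (x : Vec3) : vnorm (c • x) = |c| * vnorm x := by
  rw [vnorm, sqNorm_smul, Real.sqrt_mul (sq_nonneg c), Real.sqrt_sq_eq_abs, vnorm]

theorem vnorm_neg (x : Vec3) : vnorm (-x) = vnorm x := by
  rw [vnorm, vnorm]; congr 1; simp [sqNorm_eq]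

theorem sqNorm_neg (x : Vec3) : sqNorm (-x) = sqNorm x := by simp [sqNorm_eq]

theorem vnorm_add_le (x y : Vec3) : vnorm (x + y) ≤ vnorm x + vnorm y := by
  apply Real.sqrt_le_iff.2 ⟨add_nonneg (vnorm_nonneg x) (vnorm_nonneg y), ?_⟩
  rw [sqNorm_add, ← vnorm_sq, ← vnorm_sq y]
  nlinarith [dot_le x y]

theorem vnorm_sub_le (x y : Vec3) : vnorm (x - y) ≤ vnorm x + vnorm y := by
  rw [sub_eq_add_neg, ← vnorm_neg y]; exact vnorm_add_le _ _

theorem sqNorm_eq_zero {x : Vec3} : sqNorm x = 0 ↔ x = 0 := by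
  constructor
  · intro h
    rw [sqNorm_eq] at h
    ext i
    fin_cases i <;> simp <;> nlinarith [sq_nonneg (x 0), sq_nonneg (x 1), sq_nonneg (x 2)]
  · rintro rfl; simp [sqNorm_eq]

theorem vnorm_le_of_sqNorm_le {x : Vec3} {c : ℝ} (hc : 0 ≤ c) (h : sqNorm x ≤ c ^ 2) :
    vnorm x ≤ c := Real.sqrt_le_iff.2 ⟨hc, h⟩

theorem abs_apply_le_vnorm (x : Vec3) (i : Fin 3) : |x i| ≤ vnorm x := by
  apply Real.abs_le_sqrt
  rw [sqNorm_eq]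
  fin_cases i <;> simp <;> nlinarith [sq_nonneg (x 0), sq_nonneg (x 1), sq_nonneg (x 2)]

/-! ### Skew-symmetric matrices and `psi` -/

theorem mulVec_eq (M : Mat3) (x : Vec3) (i : Fin 3) :
    (M *ᵥ x) i = M i 0 * x 0 + M i 1 * x 1 + M i 2 * x 2 := by
  simp [Matrix.mulVec, dot_eq]

theorem mul_eq (M N : Mat3) (i j : Fin 3) :
    (M * N) i j = M i 0 * N 0 j + M i 1 * N 1 j + M i 2 * N 2 j := by
  simp [Matrix.mul_apply, Fin.sum_univ_three]

theorem psi_apply (M : Mat3) : psi M 0 = (M 2 1 - M 1 2) / 2 ∧ psi M 1 = (M 0 2 - M 2 0) / 2 ∧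
    psi M 2 = (M 1 0 - M 0 1) / 2 := by
  simp [psi]; refine ⟨?_, ?_, ?_⟩ <;> ring

theorem skew_add (x y : Vec3) : skew (x + y) = skew x + skew y := by
  ext i j; fin_cases i <;> fin_cases j <;> simp [skew] <;> ring

theorem skew_neg (x : Vec3) : skew (-x) = -skew x := by
  ext i j; fin_cases i <;> fin_cases j <;> simp [skew]

theorem skew_transpose (x : Vec3) : (skew x)ᵀ = -skew x := by
  ext i j; fin_cases i <;> fin_cases j <;> simp [skew]

theorem psi_skew (x : Vec3) : psi (skew x) = x := by
  ext i; fin_cases i <;> simp [skew, psi] <;> ring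

theorem psi_add (M N : Mat3) : psi (M + N) = psi M + psi N := by
  ext i; fin_cases i <;> simp [psi] <;> ring

theorem psi_smul (c : ℝ) (M : Mat3) : psi (c • M) = c • psi M := by
  ext i; fin_cases i <;> simp [psi] <;> ring

theorem eq_skew_of_transpose_eq_neg {Ω : Mat3} (h : Ωᵀ = -Ω) : Ω = skew (psi Ω) := by
  have e : ∀ i j, Ω j i = -Ω i j := fun i j => congrFun (congrFun h i) j
  have h0 := e 0 0
  have h1 := e 1 1
  have h2 := e 2 2
  have h3 := e 0 1
  have h4 := e 0 2
  have h5 := e 1 2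
  ext i j; fin_cases i <;> fin_cases j <;> simp [skew, psi] <;> linarith

theorem trace_mul_skew (M : Mat3) (w : Vec3) : (M * skew w).trace = -2 * (psi M ⬝ᵥ w) := by
  obtain ⟨h0, h1, h2⟩ := psi_apply M
  rw [dot_eq, h0, h1, h2]
  simp [Matrix.trace, Fin.sum_univ_three, mul_eq, skew]; ring

/-- For M = I the right-hand side is w. Thus the derivative of ψ(R̃) is the error velocity up to
terms that vanish with |R̃|_I, which is the source of the term -‖b̃‖² in the cross term. -/
theorem psi_mul_skew (M : Mat3) (w : Vec3) :
    psi (M * skew w) = (1 / 2 : ℝ) • (M.trace • w - Mᵀ *ᵥ w) := by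
  ext i; fin_cases i <;>
    simp [Matrix.trace, Fin.sum_univ_three, mul_eq, skew, psi, mulVec_eq] <;> ring

/-- Cross products transform by the cofactor matrix, for every M. A rotation is its own cofactor
matrix. -/
theorem mul_skew_mul_transpose (M : Mat3) (w : Vec3) :
    M * skew w * Mᵀ = skew ((adjugate M)ᵀ *ᵥ w) := by
  ext i j; fin_cases i <;> fin_cases j <;>
    simp [Matrix.adjugate_fin_three, mul_eq, skew, mulVec_eq] <;> ring

theorem psi_conj (M N : Mat3) : psi (M * N * Mᵀ) = (adjugate M)ᵀ *ᵥ psi N := by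
  ext i; fin_cases i <;>
    simp [Matrix.adjugate_fin_three, mul_eq, psi, mulVec_eq] <;> ring

theorem skew_cube (u : Vec3) : skew u * skew u * skew u = -(sqNorm u • skew u) := by
  ext i j; fin_cases i <;> fin_cases j <;>
    simp [mul_eq, skew, sqNorm_eq] <;> ring

theorem skew_cross (x y : Vec3) :
    skew (crossProduct x y) = vecMulVec y x - vecMulVec x y := by
  ext i j; fin_cases i <;> fin_cases j <;> simp [skew, crossProduct, vecMulVec_apply] <;> ring

/-! ### Rotations -/

theorem mem_SO3 {X : Mat3} : X ∈ SO3 ↔ X * Xᵀ = 1 ∧ X.det = 1 := by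
  simp [SO3, Matrix.mem_specialOrthogonalGroup_iff, Matrix.mem_orthogonalGroup_iff]

theorem SO3_mul_transpose {X : Mat3} (h : X ∈ SO3) : X * Xᵀ = 1 := (mem_SO3.1 h).1

theorem SO3_transpose_mul {X : Mat3} (h : X ∈ SO3) : Xᵀ * X = 1 :=
  mul_eq_one_comm.1 (SO3_mul_transpose h)

theorem SO3_transpose {X : Mat3} (h : X ∈ SO3) : Xᵀ ∈ SO3 := by
  rw [mem_SO3, transpose_transpose, det_transpose]
  exact ⟨SO3_transpose_mul h, (mem_SO3.1 h).2⟩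

theorem SO3_mul {X Y : Mat3} (hX : X ∈ SO3) (hY : Y ∈ SO3) : X * Y ∈ SO3 := by
  rw [mem_SO3, transpose_mul, det_mul, (mem_SO3.1 hX).2, (mem_SO3.1 hY).2]
  refine ⟨?_, by simp⟩
  rw [Matrix.mul_assoc, ← Matrix.mul_assoc Y, SO3_mul_transpose hY, Matrix.one_mul,
    SO3_mul_transpose hX]

theorem adjugate_SO3 {X : Mat3} (h : X ∈ SO3) : adjugate X = Xᵀ := by
  have h1 : X * adjugate X = 1 := by rw [mul_adjugate, (mem_SO3.1 h).2, one_smul]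
  calc adjugate X = Xᵀ * X * adjugate X := by rw [SO3_transpose_mul h, Matrix.one_mul]
    _ = Xᵀ := by rw [Matrix.mul_assoc, h1, Matrix.mul_one]

theorem SO3_conj_skew {X : Mat3} (h : X ∈ SO3) (w : Vec3) :
    X * skew w * Xᵀ = skew (X *ᵥ w) := by
  rw [mul_skew_mul_transpose, adjugate_SO3 h, transpose_transpose]

theorem SO3_mul_skew {X : Mat3} (h : X ∈ SO3) (w : Vec3) :
    X * skew w = skew (X *ᵥ w) * X := by
  rw [← SO3_conj_skew h, Matrix.mul_assoc, SO3_transpose_mul h, Matrix.mul_one]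

theorem psi_conj_SO3 {X : Mat3} (h : X ∈ SO3) (N : Mat3) :
    psi (X * N * Xᵀ) = X *ᵥ psi N := by
  rw [psi_conj, adjugate_SO3 h, transpose_transpose]

theorem dot_mulVec_eq (M : Mat3) (x y : Vec3) : x ⬝ᵥ (M *ᵥ y) = (Mᵀ *ᵥ x) ⬝ᵥ y := by
  simp only [dot_eq, mulVec_eq, transpose_apply]; ring

theorem SO3_dot {X : Mat3} (h : X ∈ SO3) (x y : Vec3) :
    (X *ᵥ x) ⬝ᵥ (X *ᵥ y) = x ⬝ᵥ y := by
  rw [dot_mulVec_eq, mulVec_mulVec, SO3_transpose_mul h, one_mulVec]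

theorem SO3_sqNorm {X : Mat3} (h : X ∈ SO3) (x : Vec3) : sqNorm (X *ᵥ x) = sqNorm x :=
  SO3_dot h x x

theorem SO3_vnorm {X : Mat3} (h : X ∈ SO3) (x : Vec3) : vnorm (X *ᵥ x) = vnorm x := by
  rw [vnorm, SO3_sqNorm h, vnorm]

/-- The rotation matrix of the quaternion with scalar part `η` and vector part `ε`. -/
def rot (η : ℝ) (ε : Vec3) : Mat3 :=
  (η ^ 2 - sqNorm ε) • (1 : Mat3) + (2 : ℝ) • vecMulVec ε ε + (2 * η) • skew ε

theorem rot_neg (η : ℝ) (ε : Vec3) : rot (-η) (-ε) = rot η ε := by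
  simp [rot, sqNorm_neg, skew_neg, vecMulVec_neg, neg_vecMulVec]

theorem rot_one_zero : rot 1 0 = 1 := by
  simp [rot, sqNorm_eq]
  ext i j; fin_cases i <;> fin_cases j <;> simp [skew]

/-- The Hamilton product of quaternions. It is a polynomial identity, so no normalization is needed.
-/
theorem rot_mul (η μ : ℝ) (ε δ : Vec3) :
    rot η ε * rot μ δ = rot (η * μ - ε ⬝ᵥ δ) (μ • ε + η • δ + crossProduct ε δ) := by
  have h0 : (μ • ε + η • δ + crossProduct ε δ) 0 =
    μ * ε 0 + η * δ 0 + (ε 1 * δ 2 - ε 2 * δ 1) := by rw [cross_apply]; simp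
  have h1 : (μ • ε + η • δ + crossProduct ε δ) 1 =
    μ * ε 1 + η * δ 1 + (ε 2 * δ 0 - ε 0 * δ 2) := by rw [cross_apply]; simp
  have h2 : (μ • ε + η • δ + crossProduct ε δ) 2 =
    μ * ε 2 + η * δ 2 + (ε 0 * δ 1 - ε 1 * δ 0) := by rw [cross_apply]; simp
  generalize μ • ε + η • δ + crossProduct ε δ = w at h0 h1 h2
  ext i j; fin_cases i <;> fin_cases j <;>
    simp [mul_eq, rot, skew, sqNorm_eq, dot_eq, vecMulVec_apply, h0, h1, h2] <;> ring

theorem rot_mem_SO3 {η : ℝ} {ε : Vec3} (h : η ^ 2 + sqNorm ε = 1) : rot η ε ∈ SO3 := by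
  rw [mem_SO3]
  have h1 : (rot η ε)ᵀ = rot η (-ε) := by
    ext i j; fin_cases i <;> fin_cases j <;>
      simp [rot, skew, sqNorm_eq, vecMulVec_apply] <;> ring
  have hdet : (rot η ε).det = (η ^ 2 + sqNorm ε) ^ 3 := by
    simp [det_fin_three, rot, skew, sqNorm_eq, vecMulVec_apply]; ring
  constructor
  · rw [h1, rot_mul]
    have : η * η - ε ⬝ᵥ -ε = 1 := by rw [← h, dotProduct_neg, sqNorm]; ring
    rw [this]
    have h0 : η • ε + η • -ε + crossProduct ε (-ε) = 0 := by simp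
    rw [h0, rot_one_zero]
  · rw [hdet, h]; norm_num

theorem rodrigues_two_mul (φ : ℝ) {u : Vec3} (hu : sqNorm u = 1) :
    rodrigues (2 * φ) u = rot (Real.cos φ) (Real.sin φ • u) := by
  rw [rodrigues, Real.sin_two_mul, Real.cos_two_mul, rot, sqNorm_smul, hu, mul_one]
  have h1 := Real.sin_sq_add_cos_sq φ
  rw [sqNorm_eq] at hu
  ext i j; fin_cases i <;> fin_cases j <;>
    simp [skew, vecMulVec_apply] <;> grind

theorem rodrigues_mem_SO3 (θ : ℝ) {u : Vec3} (hu : sqNorm u = 1) : rodrigues θ u ∈ SO3 := by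
  have : θ = 2 * (θ / 2) := by ring
  rw [this, rodrigues_two_mul _ hu]
  apply rot_mem_SO3
  rw [sqNorm_smul, hu, mul_one, Real.cos_sq_add_sin_sq]

theorem trace_one_sub_rot {η : ℝ} {ε : Vec3} (h : η ^ 2 + sqNorm ε = 1) :
    (1 - rot η ε).trace = 4 * sqNorm ε := by
  simp [rot, Matrix.trace, Fin.sum_univ_three, skew, sqNorm_eq, vecMulVec_apply] at h ⊢
  linarith

theorem frobInner_self_nonneg (M : Mat3) : 0 ≤ frobInner M M := by
  simp only [frobInner, Matrix.trace, Fin.sum_univ_three, mul_eq, diag_apply, transpose_apply,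
    ← sq]
  positivity

theorem frobNorm_sq (M : Mat3) : frobNorm M ^ 2 = frobInner M M :=
  Real.sq_sqrt (frobInner_self_nonneg M)

theorem attDist_sq {X : Mat3} (h : X ∈ SO3) : attDist X ^ 2 = (1 - X).trace / 4 := by
  rw [attDist, Real.sq_sqrt (by positivity), frobNorm_sq, frobInner]
  have : (1 - X)ᵀ * (1 - X) = (1 - X) + (1 - X)ᵀ := by
    rw [transpose_sub, transpose_one, Matrix.sub_mul, Matrix.mul_sub, Matrix.mul_sub,
      SO3_transpose_mul h, Matrix.mul_one, Matrix.mul_one, Matrix.one_mul]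
    abel
  rw [this, trace_add, trace_transpose]
  ring

theorem attDist_nonneg (X : Mat3) : 0 ≤ attDist X := Real.sqrt_nonneg _

theorem attDist_rot_sq {η : ℝ} {ε : Vec3} (h : η ^ 2 + sqNorm ε = 1) :
    attDist (rot η ε) ^ 2 = sqNorm ε := by
  rw [attDist_sq (rot_mem_SO3 h), trace_one_sub_rot h]; ring

/-- Orthonormality of rows and columns and equality with the cofactor matrix, entry by entry; these
are the relations from which the minors of `quatMat` follow linearly. -/
theorem SO3_entries {X : Mat3} (h : X ∈ SO3) :
    (∀ i, X i 0 ^ 2 + X i 1 ^ 2 + X i 2 ^ 2 = 1) ∧ (∀ j, X 0 j ^ 2 + X 1 j ^ 2 + X 2 j ^ 2 = 1) ∧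
    (X 0 0 = X 1 1 * X 2 2 - X 1 2 * X 2 1 ∧ X 0 1 = X 1 2 * X 2 0 - X 1 0 * X 2 2 ∧
    X 0 2 = X 1 0 * X 2 1 - X 1 1 * X 2 0) ∧
    (X 1 0 = X 0 2 * X 2 1 - X 0 1 * X 2 2 ∧ X 1 1 = X 0 0 * X 2 2 - X 0 2 * X 2 0 ∧
    X 1 2 = X 0 1 * X 2 0 - X 0 0 * X 2 1) ∧
    (X 2 0 = X 0 1 * X 1 2 - X 0 2 * X 1 1 ∧ X 2 1 = X 0 2 * X 1 0 - X 0 0 * X 1 2 ∧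
    X 2 2 = X 0 0 * X 1 1 - X 0 1 * X 1 0) ∧
    (X 0 0 * X 1 0 + X 0 1 * X 1 1 + X 0 2 * X 1 2 = 0 ∧
     X 0 0 * X 2 0 + X 0 1 * X 2 1 + X 0 2 * X 2 2 = 0 ∧
     X 1 0 * X 2 0 + X 1 1 * X 2 1 + X 1 2 * X 2 2 = 0) ∧
    (X 0 0 * X 0 1 + X 1 0 * X 1 1 + X 2 0 * X 2 1 = 0 ∧
     X 0 0 * X 0 2 + X 1 0 * X 1 2 + X 2 0 * X 2 2 = 0 ∧
     X 0 1 * X 0 2 + X 1 1 * X 1 2 + X 2 1 * X 2 2 = 0) := by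
  have a := adjugate_SO3 h
  have r : ∀ i j, (X * Xᵀ) i j = (1 : Mat3) i j := fun i j => by rw [SO3_mul_transpose h]
  have c : ∀ i j, (Xᵀ * X) i j = (1 : Mat3) i j := fun i j => by rw [SO3_transpose_mul h]
  have b : ∀ i j, adjugate X j i = X i j := fun i j => by rw [a, transpose_apply]
  simp only [mul_eq, transpose_apply] at r c
  refine ⟨fun i => ?_, fun j => ?_, ⟨?_, ?_, ?_⟩, ⟨?_, ?_, ?_⟩, ⟨?_, ?_, ?_⟩, ⟨?_, ?_, ?_⟩,
    ?_, ?_, ?_⟩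
  · have := r i i; rw [one_apply_eq] at this; linarith
  · have := c j j; rw [one_apply_eq] at this; linarith
  · rw [← b]; simp [adjugate_fin_three]
  · rw [← b]; simp [adjugate_fin_three]; ring
  · rw [← b]; simp [adjugate_fin_three]
  · rw [← b]; simp [adjugate_fin_three]; ring
  · rw [← b]; simp [adjugate_fin_three]
  · rw [← b]; simp [adjugate_fin_three]; ring
  · rw [← b]; simp [adjugate_fin_three]
  · rw [← b]; simp [adjugate_fin_three]; ring
  · rw [← b]; simp [adjugate_fin_three]
  · simpa using r 0 1
  · simpa using r 0 2
  · simpa using r 1 2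
  · simpa using c 0 1
  · simpa using c 0 2
  · simpa using c 1 2

/-- Four times the matrix `q qᵀ` of the quaternion `q` of a rotation. -/
def quatMat (X : Mat3) : Matrix (Fin 4) (Fin 4) ℝ :=
  !![1 + X 0 0 + X 1 1 + X 2 2, X 2 1 - X 1 2, X 0 2 - X 2 0, X 1 0 - X 0 1;
     X 2 1 - X 1 2, 1 + X 0 0 - X 1 1 - X 2 2, X 0 1 + X 1 0, X 0 2 + X 2 0;
     X 0 2 - X 2 0, X 0 1 + X 1 0, 1 - X 0 0 + X 1 1 - X 2 2, X 1 2 + X 2 1;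
     X 1 0 - X 0 1, X 0 2 + X 2 0, X 1 2 + X 2 1, 1 - X 0 0 - X 1 1 + X 2 2]

/-- The vanishing of these minors says that `quatMat X` has rank one, as it must if it is to equal 4
q qᵀ. -/
theorem quatMat_minor {X : Mat3} (h : X ∈ SO3) (a b c : Fin 4) :
    quatMat X a b * quatMat X a c = quatMat X a a * quatMat X b c := by
  obtain ⟨r, c', ⟨h1, h2, h3⟩, ⟨h4, h5, h6⟩, ⟨h7, h8, h9⟩, ⟨h10, h11, h12⟩, h13, h14, h15⟩ := SO3_entries h
  have r0 := r 0
  have r1 := r 1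
  have r2 := r 2
  have c0 := c' 0
  have c1 := c' 1
  have c2 := c' 2
  clear r c'
  fin_cases a <;> fin_cases b <;> fin_cases c <;> simp [quatMat] <;> try linarith

/-- A rank-one symmetric matrix is recovered from any row with positive diagonal entry, divided by
the root of that entry. The trace of `quatMat X` is 4, so such a row exists; half turns need no
separate treatment. -/
theorem exists_rot {X : Mat3} (h : X ∈ SO3) :
    ∃ (η : ℝ) (ε : Vec3), η ^ 2 + sqNorm ε = 1 ∧ X = rot η ε := by
  have hsum : quatMat X 0 0 + quatMat X 1 1 + quatMat X 2 2 + quatMat X 3 3 = 4 := by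
    simp [quatMat]; ring
  obtain ⟨a, ha⟩ : ∃ a, 0 < quatMat X a a := by
    by_contra! hc
    linarith [hc 0, hc 1, hc 2, hc 3]
  set s := √(quatMat X a a) with hs
  have hs2 : s ^ 2 = quatMat X a a := Real.sq_sqrt ha.le
  have hs0 : 0 < s := Real.sqrt_pos.2 ha
  have key : ∀ b c, (quatMat X a b / (2 * s)) * (quatMat X a c / (2 * s)) = quatMat X b c / 4 := by
    intro b c
    have := quatMat_minor h a b c
    field_simp
    rw [this, hs2]; ring
  have k00 := key 0 0
  have k01 := key 0 1
  have k02 := key 0 2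
  have k03 := key 0 3
  have k11 := key 1 1
  have k12 := key 1 2
  have k13 := key 1 3
  have k22 := key 2 2
  have k23 := key 2 3
  have k33 := key 3 3
  refine ⟨quatMat X a 0 / (2 * s), ![quatMat X a 1 / (2 * s), quatMat X a 2 / (2 * s),
    quatMat X a 3 / (2 * s)], ?_, ?_⟩
  all_goals
    generalize quatMat X a 0 / (2 * s) = q0 at *
    generalize quatMat X a 1 / (2 * s) = q1 at *
    generalize quatMat X a 2 / (2 * s) = q2 at *
    generalize quatMat X a 3 / (2 * s) = q3 at *
    clear key
    simp [quatMat] at k00 k01 k02 k03 k11 k12 k13 k22 k23 k33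
  · simp [sqNorm_eq]; linarith
  · ext i j; fin_cases i <;> fin_cases j <;>
      simp [rot, skew, sqNorm_eq] <;> linarith

/-! ### Spectral decomposition -/

/-- `A` is symmetric with orthonormal eigenvectors `v` for the eigenvalues
`0 < lam 0 < lam 1 < lam 2`. -/
structure SpectralFrame (A : Mat3) (lam : Fin 3 → ℝ) (v : Fin 3 → Vec3) : Prop where
  symm : Aᵀ = A
  eigen : ∀ i, A *ᵥ v i = lam i • v i
  unit : ∀ i, v i ⬝ᵥ v i = 1
  orth : ∀ i j, i ≠ j → v i ⬝ᵥ v j = 0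
  pos : 0 < lam 0
  lt01 : lam 0 < lam 1
  lt12 : lam 1 < lam 2

theorem weightMat_transpose {n : ℕ} (ρ : Fin n → ℝ) (a : Fin n → Vec3) :
    (weightMat ρ a)ᵀ = weightMat ρ a := by
  simp [weightMat, transpose_sum, transpose_vecMulVec]

theorem dot_weightMat {n : ℕ} (ρ : Fin n → ℝ) (a : Fin n → Vec3) (x : Vec3) :
    x ⬝ᵥ (weightMat ρ a *ᵥ x) = ∑ i, ρ i * (a i ⬝ᵥ x) ^ 2 := by
  rw [weightMat, sum_mulVec, dotProduct_sum]
  refine Finset.sum_congr rfl fun i _ => ?_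
  simp only [dot_eq, mulVec_eq, Matrix.smul_apply, vecMulVec_apply, smul_eq_mul]
  ring

/-- If the form vanished at x, then x would be orthogonal to every a_i, hence to three independent
vectors. The positivity of the smallest eigenvalue rests on this. -/
theorem dot_weightMat_pos {n : ℕ} {ρ : Fin n → ℝ} {a : Fin n → Vec3} (hρ : ∀ i, 0 < ρ i)
    (hmeas : ∃ s : Fin 3 → Fin n, LinearIndependent ℝ (fun m => a (s m))) {x : Vec3} (hx : x ≠ 0) :
    0 < x ⬝ᵥ (weightMat ρ a *ᵥ x) := by
  rw [dot_weightMat]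
  by_contra! h
  have hz : ∀ i, a i ⬝ᵥ x = 0 := by
    intro i
    have h0 : ∀ i ∈ Finset.univ, 0 ≤ ρ i * (a i ⬝ᵥ x) ^ 2 := fun i _ =>
      mul_nonneg (hρ i).le (sq_nonneg _)
    have := (Finset.sum_eq_zero_iff_of_nonneg h0).1 (le_antisymm h (Finset.sum_nonneg h0)) i
      (Finset.mem_univ i)
    have := (mul_eq_zero.1 this).resolve_left (hρ i).ne'
    exact pow_eq_zero_iff two_ne_zero |>.1 this
  obtain ⟨s, hs⟩ := hmeas
  have hu : IsUnit (Matrix.of fun m => a (s m)) :=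
    Matrix.linearIndependent_rows_iff_isUnit.1 hs
  apply hx
  have : (Matrix.of fun m => a (s m)) *ᵥ x = (Matrix.of fun m => a (s m)) *ᵥ 0 := by
    ext m
    simpa [Matrix.mulVec] using hz (s m)
  exact (Matrix.mulVec_injective_iff_isUnit.2 hu) this

theorem IsDesign.spectralFrame {n : ℕ} {ρ : Fin n → ℝ} {a : Fin n → Vec3} (hρ : ∀ i, 0 < ρ i)
    (hmeas : ∃ s : Fin 3 → Fin n, LinearIndependent ℝ (fun m => a (s m)))
    {lam : Fin 3 → ℝ} {v : Fin 3 → Vec3} {u : Vec3} {k : ℝ}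
    (hD : IsDesign (weightMat ρ a) lam v u k) : SpectralFrame (weightMat ρ a) lam v := by
  refine ⟨weightMat_transpose ρ a, hD.eigen, hD.unit_v, fun i j hij => ?_, ?_,
    hD.lam_strictMono (by decide), hD.lam_strictMono (by decide)⟩
  · have h1 : v i ⬝ᵥ (weightMat ρ a *ᵥ v j) = (weightMat ρ a *ᵥ v i) ⬝ᵥ v j := by
      rw [dot_mulVec_eq, weightMat_transpose]
    rw [hD.eigen, hD.eigen, dotProduct_smul, smul_dotProduct, smul_eq_mul, smul_eq_mul] at h1
    have h2 : (lam j - lam i) * (v i ⬝ᵥ v j) = 0 := by linarith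
    exact (mul_eq_zero.1 h2).resolve_left
      (sub_ne_zero.2 fun h => hij (hD.lam_strictMono.injective h).symm)
  · have hv : v 0 ≠ 0 := by
      intro h
      have := hD.unit_v 0
      rw [h] at this
      simp [sqNorm] at this
    have := dot_weightMat_pos hρ hmeas hv
    have h1 := hD.unit_v 0
    rw [sqNorm] at h1
    rwa [hD.eigen, dotProduct_smul, h1, smul_eq_mul, mul_one] at this

namespace SpectralFrame

variable {A : Mat3} {lam : Fin 3 → ℝ} {v : Fin 3 → Vec3}

theorem of_mul_transpose (h : SpectralFrame A lam v) : (of v) * (of v)ᵀ = 1 := by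
  ext i j
  have h1 : (of v * (of v)ᵀ) i j = v i ⬝ᵥ v j := by
    rw [mul_eq, dot_eq]; rfl
  rw [h1]
  by_cases hij : i = j
  · subst hij
    rw [one_apply_eq, h.unit]
  · rw [one_apply_ne hij, h.orth i j hij]

theorem of_transpose_mul (h : SpectralFrame A lam v) : (of v)ᵀ * (of v) = 1 :=
  mul_eq_one_comm.1 h.of_mul_transpose

theorem parseval (h : SpectralFrame A lam v) (x y : Vec3) :
    x ⬝ᵥ y = (v 0 ⬝ᵥ x) * (v 0 ⬝ᵥ y) + (v 1 ⬝ᵥ x) * (v 1 ⬝ᵥ y) + (v 2 ⬝ᵥ x) * (v 2 ⬝ᵥ y) := by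
  have h1 : x ⬝ᵥ y = (of v *ᵥ x) ⬝ᵥ (of v *ᵥ y) := by
    rw [dot_mulVec_eq, mulVec_mulVec, h.of_transpose_mul, one_mulVec]
  rw [h1, dot_eq]
  rfl

theorem sqNorm_eq_sum (h : SpectralFrame A lam v) (x : Vec3) :
    sqNorm x = (v 0 ⬝ᵥ x) ^ 2 + (v 1 ⬝ᵥ x) ^ 2 + (v 2 ⬝ᵥ x) ^ 2 := by
  rw [sqNorm, h.parseval]; ring

theorem ext_coord (h : SpectralFrame A lam v) {x y : Vec3} (hxy : ∀ i, v i ⬝ᵥ x = v i ⬝ᵥ y) :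
    x = y := by
  rw [← sub_eq_zero, ← sqNorm_eq_zero, h.sqNorm_eq_sum]
  simp [dotProduct_sub, hxy]

theorem coord_mulVec (h : SpectralFrame A lam v) (i : Fin 3) (x : Vec3) :
    v i ⬝ᵥ (A *ᵥ x) = lam i * (v i ⬝ᵥ x) := by
  rw [dot_mulVec_eq, h.symm, h.eigen, smul_dotProduct, smul_eq_mul]

theorem eq_conj (h : SpectralFrame A lam v) : A = (of v)ᵀ * diagonal lam * of v := by
  have h1 : A * (of v)ᵀ = (of v)ᵀ * diagonal lam := by
    ext i j
    have := congrFun (h.eigen j) i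
    rw [mulVec_eq] at this
    rw [mul_eq, mul_diagonal]
    simp only [transpose_apply, of_apply]
    simp only [Pi.smul_apply, smul_eq_mul] at this
    linarith
  rw [← h1, Matrix.mul_assoc, h.of_transpose_mul, Matrix.mul_one]

theorem trace_eq (h : SpectralFrame A lam v) : A.trace = lam 0 + lam 1 + lam 2 := by
  rw [h.eq_conj, Matrix.mul_assoc, trace_mul_comm, Matrix.mul_assoc, h.of_mul_transpose,
    Matrix.mul_one, trace_diagonal, Fin.sum_univ_three]

theorem barMat_eq_conj (h : SpectralFrame A lam v) : barMat A =
    (of v)ᵀ * diagonal (fun i => (lam 0 + lam 1 + lam 2 - lam i) / 2) * of v := by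
  have h1 : diagonal (fun i => (lam 0 + lam 1 + lam 2 - lam i) / 2) =
      (1 / 2 : ℝ) • ((lam 0 + lam 1 + lam 2) • (1 : Mat3) - diagonal lam) := by
    ext i j
    by_cases hij : i = j
    · subst hij; simp; ring
    · simp [hij]
  rw [h1, barMat, h.trace_eq, Matrix.mul_smul, Matrix.smul_mul, Matrix.mul_sub, Matrix.sub_mul,
    ← h.eq_conj, Matrix.mul_smul, Matrix.smul_mul, Matrix.mul_one, h.of_transpose_mul]

theorem mem_spectrum_barMat (h : SpectralFrame A lam v) (μ : ℝ) :
    μ ∈ spectrum ℝ (barMat A) ↔ ∃ i, μ = (lam 0 + lam 1 + lam 2 - lam i) / 2 := by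
  rw [spectrum.mem_iff, Matrix.isUnit_iff_isUnit_det, isUnit_iff_ne_zero, not_not]
  have h1 : algebraMap ℝ Mat3 μ - barMat A = (of v)ᵀ *
      diagonal (fun i => μ - (lam 0 + lam 1 + lam 2 - lam i) / 2) * of v := by
    have : diagonal (fun i => μ - (lam 0 + lam 1 + lam 2 - lam i) / 2) = μ • (1 : Mat3) -
        diagonal (fun i => (lam 0 + lam 1 + lam 2 - lam i) / 2) := by
      ext i j
      by_cases hij : i = j
      · subst hij; simp
      · simp [hij]
    rw [this, Matrix.mul_sub, Matrix.sub_mul, ← h.barMat_eq_conj, Matrix.mul_smul,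
      Matrix.smul_mul, Matrix.mul_one, h.of_transpose_mul, Algebra.algebraMap_eq_smul_one]
  have h2 : (of v).det * (of v).det = 1 := by
    have := congrArg Matrix.det h.of_transpose_mul
    rwa [det_mul, det_transpose, det_one] at this
  have h3 : (of v).det ≠ 0 := fun h0 => by rw [h0] at h2; simp at h2
  rw [h1, det_mul, det_mul, det_transpose, det_diagonal]
  simp [h3, Finset.prod_eq_zero_iff, sub_eq_zero]

theorem eigMax_barMat (h : SpectralFrame A lam v) : eigMax (barMat A) = (lam 1 + lam 2) / 2 := by
  apply IsGreatest.csSup_eq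
  constructor
  · exact (h.mem_spectrum_barMat _).2 ⟨0, by ring⟩
  · intro μ hμ
    obtain ⟨i, rfl⟩ := (h.mem_spectrum_barMat _).1 hμ
    have := h.lt01
    have := h.lt12
    fin_cases i <;> simp <;> linarith

theorem eigMin_barMat (h : SpectralFrame A lam v) : eigMin (barMat A) = (lam 0 + lam 1) / 2 := by
  apply IsLeast.csInf_eq
  constructor
  · exact (h.mem_spectrum_barMat _).2 ⟨2, by ring⟩
  · intro μ hμ
    obtain ⟨i, rfl⟩ := (h.mem_spectrum_barMat _).1 hμ
    have := h.lt01
    have := h.lt12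
    fin_cases i <;> simp <;> linarith

theorem xi_eq (h : SpectralFrame A lam v) : xi A = (lam 0 + lam 1) / (lam 1 + lam 2) := by
  rw [xi, h.eigMax_barMat, h.eigMin_barMat]
  have := h.pos; have := h.lt01; have := h.lt12
  have : lam 1 + lam 2 ≠ 0 := by linarith
  field_simp

theorem sum_pos (h : SpectralFrame A lam v) : 0 < lam 1 + lam 2 := by
  have := h.pos; have := h.lt01; have := h.lt12
  linarith

theorem xi_pos (h : SpectralFrame A lam v) : 0 < xi A := by
  rw [h.xi_eq]
  have := h.pos; have := h.lt01; have := h.lt12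
  apply div_pos <;> linarith

theorem xi_lt_one (h : SpectralFrame A lam v) : xi A < 1 := by
  rw [h.xi_eq, div_lt_one h.sum_pos]
  have := h.lt01; have := h.lt12
  linarith

/-- Since ξ < 1, the maximum in `kBar` is below 4. The upper bound on the gain acts through k² < 1/2
alone. -/
theorem gain_sq_lt (h : SpectralFrame A lam v) {k : ℝ} (hk : 0 < k) (hk' : k < kBar A) :
    k ^ 2 < 1 / 2 := by
  have h1 : 2 < 6 - max 1 (4 * xi A ^ 2) := by
    have : max 1 (4 * xi A ^ 2) < 4 := max_lt (by norm_num) (by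
      nlinarith [h.xi_pos, h.xi_lt_one])
    linarith
  have h2 : kBar A ^ 2 < 1 / 2 := by
    rw [kBar, div_pow, Real.sq_sqrt (by linarith), one_pow]
    exact one_div_lt_one_div_of_lt (by norm_num) h1
  nlinarith

end SpectralFrame

/-- The eigenvalues of `Ā` divided by the largest one. -/
noncomputable def ratio (lam : Fin 3 → ℝ) (i : Fin 3) : ℝ :=
  (lam 0 + lam 1 + lam 2 - lam i) / (lam 1 + lam 2)

namespace SpectralFrame

variable {A : Mat3} {lam : Fin 3 → ℝ} {v : Fin 3 → Vec3}

theorem ratio_zero (h : SpectralFrame A lam v) : ratio lam 0 = 1 := by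
  rw [ratio, div_eq_one_iff_eq h.sum_pos.ne']; ring

theorem ratio_two (h : SpectralFrame A lam v) : ratio lam 2 = xi A := by
  rw [ratio, h.xi_eq]; congr 1; ring

theorem ratio_lt_10 (h : SpectralFrame A lam v) : ratio lam 1 < ratio lam 0 := by
  unfold ratio
  have := h.sum_pos
  have := h.lt01
  gcongr

theorem ratio_lt_21 (h : SpectralFrame A lam v) : ratio lam 2 < ratio lam 1 := by
  unfold ratio
  have := h.sum_pos
  have := h.lt12
  gcongr

theorem UA_eq (h : SpectralFrame A lam v) (X : Mat3) :
    UA A X = (A * (1 - X)).trace / (2 * (lam 1 + lam 2)) := by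
  rw [UA, h.eigMax_barMat]; congr 1; ring

/-- The trace tr(A (I - X)) equals 4 εᵀ Ā ε, so U_A is the quadratic form of Ā / λ_max(Ā) in ε,
which is diagonal in the frame v. -/
theorem UA_rot (h : SpectralFrame A lam v) {η : ℝ} {ε : Vec3} (hq : η ^ 2 + sqNorm ε = 1) :
    UA A (rot η ε) = ratio lam 0 * (v 0 ⬝ᵥ ε) ^ 2 + ratio lam 1 * (v 1 ⬝ᵥ ε) ^ 2 +
      ratio lam 2 * (v 2 ⬝ᵥ ε) ^ 2 := by
  have h1 : (A * (1 - rot η ε)).trace = 2 * (A.trace * sqNorm ε - ε ⬝ᵥ (A *ᵥ ε)) := by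
    have s := fun i j => congrFun (congrFun h.symm i) j
    have s01 := s 0 1
    have s02 := s 0 2
    have s12 := s 1 2
    have hq' : η ^ 2 = 1 - sqNorm ε := by linarith
    simp only [transpose_apply] at s01 s02 s12
    simp only [rot, hq', Matrix.trace, Fin.sum_univ_three, diag_apply, mul_eq, Matrix.sub_apply,
      Matrix.add_apply, Matrix.smul_apply, vecMulVec_apply, dot_eq, mulVec_eq, sqNorm_eq]
    simp [skew, s01, s02, s12]
    ring
  have h2 := h.sum_pos.ne'
  rw [h.UA_eq, h1, h.trace_eq, h.sqNorm_eq_sum, h.parseval ε, h.coord_mulVec, h.coord_mulVec,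
    h.coord_mulVec]
  unfold ratio
  field_simp
  ring

/-- With a = (tr(A) I - A) ε one has ψ(A X) = η a + ε × A ε, and ε × A ε = -ε × a is orthogonal to
a. The squared norm is η² |a|² + |ε|² |a|² - (ε·a)², where η² + |ε|² = 1 and ε·a = (λ₂ + λ₃) U_A. -/
theorem sqNorm_psi_rot (h : SpectralFrame A lam v) {η : ℝ} {ε : Vec3}
    (hq : η ^ 2 + sqNorm ε = 1) :
    sqNorm (psi (A * rot η ε)) = (lam 1 + lam 2) ^ 2 *
      ((ratio lam 0 * (v 0 ⬝ᵥ ε)) ^ 2 + (ratio lam 1 * (v 1 ⬝ᵥ ε)) ^ 2 +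
        (ratio lam 2 * (v 2 ⬝ᵥ ε)) ^ 2 - UA A (rot η ε) ^ 2) := by
  have h0 : psi (A * rot η ε) = η • (A.trace • ε - A *ᵥ ε) + crossProduct ε (A *ᵥ ε) := by
    have s := fun i j => congrFun (congrFun h.symm i) j
    have s01 := s 0 1
    have s02 := s 0 2
    have s12 := s 1 2
    simp only [transpose_apply] at s01 s02 s12
    have hc : crossProduct ε (A *ᵥ ε) = ![ε 1 * (A *ᵥ ε) 2 - ε 2 * (A *ᵥ ε) 1,
        ε 2 * (A *ᵥ ε) 0 - ε 0 * (A *ᵥ ε) 2, ε 0 * (A *ᵥ ε) 1 - ε 1 * (A *ᵥ ε) 0] :=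
      cross_apply _ _
    obtain ⟨p0, p1, p2⟩ := psi_apply (A * rot η ε)
    have hr : rot η ε = rot η ε := rfl
    ext i
    fin_cases i
    · change psi (A * rot η ε) 0 = (η • (A.trace • ε - A *ᵥ ε)) 0 + crossProduct ε (A *ᵥ ε) 0
      rw [p0, hc]
      simp [rot, Matrix.trace, Fin.sum_univ_three, mul_eq, mulVec_eq, vecMulVec_apply, sqNorm_eq,
        s01, s02, s12, skew]
      ring
    · change psi (A * rot η ε) 1 = (η • (A.trace • ε - A *ᵥ ε)) 1 + crossProduct ε (A *ᵥ ε) 1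
      rw [p1, hc]
      simp [rot, Matrix.trace, Fin.sum_univ_three, mul_eq, mulVec_eq, vecMulVec_apply, sqNorm_eq,
        s01, s02, s12, skew]
      ring
    · change psi (A * rot η ε) 2 = (η • (A.trace • ε - A *ᵥ ε)) 2 + crossProduct ε (A *ᵥ ε) 2
      rw [p2, hc]
      simp [rot, Matrix.trace, Fin.sum_univ_three, mul_eq, mulVec_eq, vecMulVec_apply, sqNorm_eq,
        s01, s02, s12, skew]
      ring
  have h1 : ∀ y : Vec3, sqNorm (η • (A.trace • ε - y) + crossProduct ε y) =
      η ^ 2 * sqNorm (A.trace • ε - y) + (sqNorm ε * sqNorm (A.trace • ε - y) -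
        (ε ⬝ᵥ (A.trace • ε - y)) ^ 2) := by
    intro y
    have hc : ∀ i, crossProduct ε y i = ![ε 1 * y 2 - ε 2 * y 1,
        ε 2 * y 0 - ε 0 * y 2, ε 0 * y 1 - ε 1 * y 0] i := fun i => by rw [cross_apply]
    simp only [sqNorm_eq, dot_eq, Pi.add_apply, Pi.smul_apply, Pi.sub_apply, smul_eq_mul, hc]
    simp
    ring
  have h3 : ∀ i, v i ⬝ᵥ (A.trace • ε - A *ᵥ ε) = (lam 1 + lam 2) * (ratio lam i * (v i ⬝ᵥ ε)) := by
    intro i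
    rw [dotProduct_sub, h.coord_mulVec, dotProduct_smul, h.trace_eq, ratio, smul_eq_mul]
    have := h.sum_pos.ne'
    field_simp
  rw [h0, h1, h.UA_rot hq, h.sqNorm_eq_sum (A.trace • ε - A *ᵥ ε),
    h.parseval ε (A.trace • ε - A *ᵥ ε), h3, h3, h3]
  linear_combination ((lam 1 + lam 2) ^ 2 * ((ratio lam 0 * (v 0 ⬝ᵥ ε)) ^ 2 +
    (ratio lam 1 * (v 1 ⬝ᵥ ε)) ^ 2 + (ratio lam 2 * (v 2 ⬝ᵥ ε)) ^ 2)) * hq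

end SpectralFrame
theorem attDist_le_one {X : Mat3} (hX : X ∈ SO3) : attDist X ≤ 1 := by
  obtain ⟨η, ε, hq, rfl⟩ := exists_rot hX
  have := attDist_rot_sq hq
  nlinarith [attDist_nonneg (rot η ε), sq_nonneg η]

namespace SpectralFrame

variable {A : Mat3} {lam : Fin 3 → ℝ} {v : Fin 3 → Vec3}

/-! ### Bounds for `U_A` and `ψ(A X)` on `SO(3)` -/

theorem UA_le (h : SpectralFrame A lam v) {X : Mat3} (hX : X ∈ SO3) :
    UA A X ≤ attDist X ^ 2 := by
  obtain ⟨η, ε, hq, rfl⟩ := exists_rot hX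
  rw [h.UA_rot hq, attDist_rot_sq hq, h.sqNorm_eq_sum, h.ratio_zero]
  have h1 := h.ratio_lt_10
  have h2 := h.ratio_lt_21
  rw [h.ratio_zero] at h1
  nlinarith [sq_nonneg (v 1 ⬝ᵥ ε), sq_nonneg (v 2 ⬝ᵥ ε)]

theorem le_UA (h : SpectralFrame A lam v) {X : Mat3} (hX : X ∈ SO3) :
    xi A * attDist X ^ 2 ≤ UA A X := by
  obtain ⟨η, ε, hq, rfl⟩ := exists_rot hX
  rw [h.UA_rot hq, attDist_rot_sq hq, h.sqNorm_eq_sum, ← h.ratio_two]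
  have h1 := h.ratio_lt_10
  have h2 := h.ratio_lt_21
  nlinarith [sq_nonneg (v 1 ⬝ᵥ ε), sq_nonneg (v 0 ⬝ᵥ ε)]

theorem UA_nonneg (h : SpectralFrame A lam v) {X : Mat3} (hX : X ∈ SO3) : 0 ≤ UA A X :=
  (mul_nonneg h.xi_pos.le (sq_nonneg _)).trans (h.le_UA hX)

theorem UA_le_one (h : SpectralFrame A lam v) {X : Mat3} (hX : X ∈ SO3) : UA A X ≤ 1 := by
  have := h.UA_le hX
  nlinarith [attDist_le_one hX, attDist_nonneg X]

/-- From s_i ≥ ξ. The bound is informative where U_A < ξ, that is, near the identity; elsewhere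
compactness takes over. -/
theorem le_sqNorm_psi (h : SpectralFrame A lam v) {X : Mat3} (hX : X ∈ SO3) :
    (lam 1 + lam 2) ^ 2 * (UA A X * (xi A - UA A X)) ≤ sqNorm (psi (A * X)) := by
  obtain ⟨η, ε, hq, rfl⟩ := exists_rot hX
  rw [h.sqNorm_psi_rot hq]
  refine mul_le_mul_of_nonneg_left ?_ (sq_nonneg _)
  have h0 := h.xi_pos
  have h1 := h.ratio_lt_10
  have h2 := h.ratio_lt_21
  have h3 := h.ratio_two
  have key : ∀ i, xi A ≤ ratio lam i → xi A * (ratio lam i * (v i ⬝ᵥ ε) ^ 2) ≤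
      (ratio lam i * (v i ⬝ᵥ ε)) ^ 2 := by
    intro i hi
    rw [mul_pow, sq (ratio lam i), mul_assoc]
    exact mul_le_mul_of_nonneg_right hi
      (mul_nonneg (h0.le.trans hi) (sq_nonneg _))
  have k0 := key 0 (by linarith)
  have k1 := key 1 (by linarith)
  have k2 := key 2 (by linarith)
  have hU := h.UA_rot hq
  nlinarith

/-- From s_i ≤ 1. It shows in particular that points with U_A = 1 are critical, which later keeps
the flow set of V_A away from them. -/
theorem sqNorm_psi_le (h : SpectralFrame A lam v) {X : Mat3} (hX : X ∈ SO3) :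
    sqNorm (psi (A * X)) ≤ (lam 1 + lam 2) ^ 2 * (UA A X - UA A X ^ 2) := by
  obtain ⟨η, ε, hq, rfl⟩ := exists_rot hX
  rw [h.sqNorm_psi_rot hq]
  refine mul_le_mul_of_nonneg_left ?_ (sq_nonneg _)
  have h0 := h.xi_pos
  have h1 := h.ratio_lt_10
  have h2 := h.ratio_lt_21
  have h3 := h.ratio_two
  have h4 := h.ratio_zero
  have key : ∀ i, 0 ≤ ratio lam i → ratio lam i ≤ 1 → (ratio lam i * (v i ⬝ᵥ ε)) ^ 2 ≤
      ratio lam i * (v i ⬝ᵥ ε) ^ 2 := by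
    intro i hi hi'
    rw [mul_pow]
    exact mul_le_mul_of_nonneg_right (by nlinarith) (sq_nonneg _)
  have k0 := key 0 (by linarith) (by linarith)
  have k1 := key 1 (by linarith) (by linarith)
  have k2 := key 2 (by linarith) (by linarith)
  have hU := h.UA_rot hq
  linarith

/-- The critical points of `U_A` are the identity and the half turns about the eigenvectors. -/
theorem eq_half_turn_of_psi_eq_zero (h : SpectralFrame A lam v) {X : Mat3} (hX : X ∈ SO3)
    (hpsi : psi (A * X) = 0) : UA A X = 0 ∨ ∃ i, X = rot 0 (v i) := by
  obtain ⟨η, ε, hq, rfl⟩ := exists_rot hX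
  have h0 := h.sqNorm_psi_rot hq
  have hU := h.UA_rot hq
  rw [hpsi, sqNorm_eq_zero.2 rfl] at h0
  have h1 := (mul_eq_zero.1 h0.symm).resolve_left (pow_ne_zero 2 h.sum_pos.ne')
  rw [hU] at h1
  rw [hU]
  have hn := h.sqNorm_eq_sum ε
  have hr0 := h.ratio_zero
  have hr1 := h.ratio_lt_10
  have hr2 := h.ratio_lt_21
  have hr3 : 0 < ratio lam 2 := h.ratio_two ▸ h.xi_pos
  have hunit : ∀ i, (v i ⬝ᵥ ε) ^ 2 = 1 → (∀ j, j ≠ i → v j ⬝ᵥ ε = 0) → η ^ 2 = 0 →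
      rot η ε = rot 0 (v i) := by
    intro i hi hj hη
    have hη0 : η = 0 := pow_eq_zero_iff two_ne_zero |>.1 hη
    have h2 : ε = (v i ⬝ᵥ ε) • v i := by
      apply h.ext_coord
      intro j
      rw [dotProduct_smul, smul_eq_mul]
      by_cases hij : j = i
      · subst hij; rw [h.unit, mul_one]
      · rw [h.orth j i hij, mul_zero, hj j hij]
    rcases mul_self_eq_one_iff.1 (sq (v i ⬝ᵥ ε) ▸ hi) with h3 | h3
    · rw [h3, one_smul] at h2
      rw [h2, hη0]
    · rw [h3, neg_one_smul] at h2
      rw [h2, hη0, ← rot_neg, neg_zero, neg_neg]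
  set e0 := v 0 ⬝ᵥ ε with he0
  set e1 := v 1 ⬝ᵥ ε with he1
  set e2 := v 2 ⬝ᵥ ε with he2
  generalize ratio lam 0 = s0 at *
  generalize ratio lam 1 = s1 at *
  generalize ratio lam 2 = s2 at *
  have hη2 : η ^ 2 = 1 - (e0 ^ 2 + e1 ^ 2 + e2 ^ 2) := by linarith
  -- Lagrange's identity writes the vanishing quantity as a sum of squares. As the s_i are positive
  -- and distinct, at most one e_i is nonzero, and η = 0 if one is.
  have hlag : (η * (s0 * e0)) ^ 2 + (η * (s1 * e1)) ^ 2 + (η * (s2 * e2)) ^ 2 +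
      ((s0 - s1) * (e0 * e1)) ^ 2 + ((s0 - s2) * (e0 * e2)) ^ 2 +
      ((s1 - s2) * (e1 * e2)) ^ 2 = 0 := by
    rw [← h1]
    linear_combination ((s0 * e0) ^ 2 + (s1 * e1) ^ 2 + (s2 * e2) ^ 2) * hη2
  have z0 := sq_nonneg (η * (s0 * e0))
  have z1 := sq_nonneg (η * (s1 * e1))
  have z2 := sq_nonneg (η * (s2 * e2))
  have z3 := sq_nonneg ((s0 - s1) * (e0 * e1))
  have z4 := sq_nonneg ((s0 - s2) * (e0 * e2))
  have z5 := sq_nonneg ((s1 - s2) * (e1 * e2))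
  have y0 : e0 = 0 ∨ η = 0 := by
    have : η * (s0 * e0) = 0 := pow_eq_zero_iff two_ne_zero |>.1 (by linarith)
    rcases mul_eq_zero.1 this with h | h
    · exact Or.inr h
    · exact Or.inl ((mul_eq_zero.1 h).resolve_left (by linarith))
  have y1 : e1 = 0 ∨ η = 0 := by
    have : η * (s1 * e1) = 0 := pow_eq_zero_iff two_ne_zero |>.1 (by linarith)
    rcases mul_eq_zero.1 this with h | h
    · exact Or.inr h
    · exact Or.inl ((mul_eq_zero.1 h).resolve_left (by linarith))
  have y2 : e2 = 0 ∨ η = 0 := by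
    have : η * (s2 * e2) = 0 := pow_eq_zero_iff two_ne_zero |>.1 (by linarith)
    rcases mul_eq_zero.1 this with h | h
    · exact Or.inr h
    · exact Or.inl ((mul_eq_zero.1 h).resolve_left (by linarith))
  have y3 : e0 = 0 ∨ e1 = 0 := by
    have : (s0 - s1) * (e0 * e1) = 0 := pow_eq_zero_iff two_ne_zero |>.1 (by linarith)
    exact mul_eq_zero.1 ((mul_eq_zero.1 this).resolve_left (by linarith))
  have y4 : e0 = 0 ∨ e2 = 0 := by
    have : (s0 - s2) * (e0 * e2) = 0 := pow_eq_zero_iff two_ne_zero |>.1 (by linarith)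
    exact mul_eq_zero.1 ((mul_eq_zero.1 this).resolve_left (by linarith))
  have y5 : e1 = 0 ∨ e2 = 0 := by
    have : (s1 - s2) * (e1 * e2) = 0 := pow_eq_zero_iff two_ne_zero |>.1 (by linarith)
    exact mul_eq_zero.1 ((mul_eq_zero.1 this).resolve_left (by linarith))
  by_cases c0 : e0 = 0
  · by_cases c1 : e1 = 0
    · by_cases c2 : e2 = 0
      · left; rw [c0, c1, c2]; ring
      · have hη := y2.resolve_left c2
        rw [hη, c0, c1] at hη2
        refine Or.inr ⟨2, hunit 2 (by linarith) (fun j hj => ?_) (by rw [hη]; ring)⟩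
        fin_cases j
        · exact c0
        · exact c1
        · exact absurd rfl hj
    · have hη := y1.resolve_left c1
      have c2 := y5.resolve_left c1
      rw [hη, c0, c2] at hη2
      refine Or.inr ⟨1, hunit 1 (by linarith) (fun j hj => ?_) (by rw [hη]; ring)⟩
      fin_cases j
      · exact c0
      · exact absurd rfl hj
      · exact c2
  · have hη := y0.resolve_left c0
    have c1 := y3.resolve_left c0
    have c2 := y4.resolve_left c0
    rw [hη, c1, c2] at hη2
    refine Or.inr ⟨0, hunit 0 (by linarith) (fun j hj => ?_) (by rw [hη]; ring)⟩
    fin_cases j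
    · exact absurd rfl hj
    · exact c1
    · exact c2

/-! ### Rotating a half turn about an eigenvector -/

/-- The decrease coefficient of `U_A` when the half turn about `v i` is composed with a rotation
about `u`. -/
noncomputable def dropCoeff (lam : Fin 3 → ℝ) (v : Fin 3 → Vec3) (u : Vec3) (i : Fin 3) : ℝ :=
  ratio lam i - ∑ j ∈ Finset.univ.erase i, ratio lam j * (1 - (v i ⬝ᵥ u) ^ 2 - (v j ⬝ᵥ u) ^ 2)

/-- The square of a triple product is a Gram determinant, here that of v_i, u, v_j. -/
theorem coord_cross_sq (h : SpectralFrame A lam v) {u : Vec3} (hu : sqNorm u = 1) {i j : Fin 3}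
    (hij : i ≠ j) :
    (v j ⬝ᵥ crossProduct (v i) u) ^ 2 = 1 - (v i ⬝ᵥ u) ^ 2 - (v j ⬝ᵥ u) ^ 2 := by
  have gram : ∀ x y z : Vec3, (z ⬝ᵥ crossProduct x y) ^ 2 =
      (x ⬝ᵥ x) * (y ⬝ᵥ y) * (z ⬝ᵥ z) + 2 * (x ⬝ᵥ y) * (y ⬝ᵥ z) * (x ⬝ᵥ z) -
        (x ⬝ᵥ x) * (y ⬝ᵥ z) ^ 2 - (y ⬝ᵥ y) * (x ⬝ᵥ z) ^ 2 - (z ⬝ᵥ z) * (x ⬝ᵥ y) ^ 2 := by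
    intro x y z
    have hc : ∀ i, crossProduct x y i = ![x 1 * y 2 - x 2 * y 1,
        x 2 * y 0 - x 0 * y 2, x 0 * y 1 - x 1 * y 0] i := fun i => by rw [cross_apply]
    simp only [dot_eq, hc]
    simp
    ring
  rw [sqNorm] at hu
  rw [gram, h.unit, h.unit, hu, h.orth i j hij, dotProduct_comm u]
  ring

/-- The product quaternion has vector part cos φ v_i + sin φ (v_i × u), so the value of U_A depends
on φ only through sin² φ. -/
theorem UA_half_turn_mul (h : SpectralFrame A lam v) {u : Vec3} (hu : sqNorm u = 1) (i : Fin 3)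
    (φ : ℝ) : UA A (rot 0 (v i) * rodrigues (2 * φ) u) =
      ratio lam i - Real.sin φ ^ 2 * dropCoeff lam v u i := by
  have hq0 : (0 : ℝ) ^ 2 + sqNorm (v i) = 1 := by rw [sqNorm, h.unit]; ring
  have hsc := Real.sin_sq_add_cos_sq φ
  rw [rodrigues_two_mul φ hu, rot_mul, zero_smul, add_zero, zero_mul, zero_sub]
  set w := crossProduct (v i) u with hw
  have hvw : v i ⬝ᵥ w = 0 := dot_self_cross _ _
  have hε : Real.cos φ • v i + crossProduct (v i) (Real.sin φ • u) =
      Real.cos φ • v i + Real.sin φ • w := by rw [map_smul]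
  have hj : ∀ j, j ≠ i → (v j ⬝ᵥ (Real.cos φ • v i + Real.sin φ • w)) ^ 2 =
      Real.sin φ ^ 2 * (1 - (v i ⬝ᵥ u) ^ 2 - (v j ⬝ᵥ u) ^ 2) := by
    intro j hj
    rw [dotProduct_add, dotProduct_smul, dotProduct_smul, h.orth j i hj, smul_zero, zero_add,
      smul_eq_mul, mul_pow, h.coord_cross_sq hu hj.symm]
  have hi : (v i ⬝ᵥ (Real.cos φ • v i + Real.sin φ • w)) ^ 2 = Real.cos φ ^ 2 := by
    rw [dotProduct_add, dotProduct_smul, dotProduct_smul, h.unit, hvw]; simp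
  have hq : (-(v i ⬝ᵥ Real.sin φ • u)) ^ 2 + sqNorm (Real.cos φ • v i + Real.sin φ • w) = 1 := by
    have hs : sqNorm w = 1 - (v i ⬝ᵥ u) ^ 2 := by
      have h1 : ∀ x y : Vec3, sqNorm (crossProduct x y) = sqNorm x * sqNorm y - (x ⬝ᵥ y) ^ 2 := by
        intro x y
        have hc : ∀ i, crossProduct x y i = ![x 1 * y 2 - x 2 * y 1,
          x 2 * y 0 - x 0 * y 2, x 0 * y 1 - x 1 * y 0] i := fun i => by rw [cross_apply]
        simp only [dot_eq, sqNorm_eq, hc]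
        simp
        ring
      rw [h1, hu, sqNorm, h.unit]; ring
    rw [sqNorm_add, sqNorm_smul, sqNorm_smul, smul_dotProduct, dotProduct_smul, dotProduct_smul, hvw, hs,
      sqNorm, h.unit]
    simp only [smul_eq_mul]
    linear_combination hsc
  rw [hε, h.UA_rot hq, dropCoeff]
  have hc2 : Real.cos φ ^ 2 = 1 - Real.sin φ ^ 2 := by linarith
  fin_cases i
  · rw [show Finset.univ.erase (⟨0, by decide⟩ : Fin 3) = {1, 2} by decide,
      Finset.sum_pair (by decide)]
    have j1 := hj 1 (by decide)
    have j2 := hj 2 (by decide)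
    simp only [Fin.zero_eta] at *
    rw [hi, j1, j2, hc2]; ring
  · rw [show Finset.univ.erase (⟨1, by decide⟩ : Fin 3) = {0, 2} by decide,
      Finset.sum_pair (by decide)]
    have j1 := hj 0 (by decide)
    have j2 := hj 2 (by decide)
    simp only [Fin.mk_one] at *
    rw [hi, j1, j2, hc2]; ring
  · rw [show Finset.univ.erase (⟨2, by decide⟩ : Fin 3) = {0, 1} by decide,
      Finset.sum_pair (by decide)]
    have j1 := hj 0 (by decide)
    have j2 := hj 1 (by decide)
    simp only [Fin.reduceFinMk] at *
    rw [hi, j1, j2, hc2]; ring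

theorem dropCoeff_neg (u : Vec3) (i : Fin 3) :
    dropCoeff lam v (-u) i = dropCoeff lam v u i := by
  simp [dropCoeff]

/-- The values of the decrease coefficient for the prescribed axis. -/
theorem dropCoeff_eq (h : SpectralFrame A lam v) {u : Vec3} {k : ℝ} (hD : IsDesign A lam v u k) :
    dropCoeff lam v u 1 = capLambda lam ∧ dropCoeff lam v u 2 = capLambda lam ∧
      (dropCoeff lam v u 0 = capLambda lam ∨
        capLambda lam ≤ dropCoeff lam v u 0 ∧ dropCoeff lam v u 0 ≤ 1 / 2 ∧ xi A ≤ 3 / 4) := by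
  have p0 := h.pos
  have l01 := h.lt01
  have l12 := h.lt12
  have hL := h.sum_pos
  have e0 : Finset.univ.erase (0 : Fin 3) = {1, 2} := by decide
  have e1 : Finset.univ.erase (1 : Fin 3) = {0, 2} := by decide
  have e2 : Finset.univ.erase (2 : Fin 3) = {0, 1} := by decide
  have s0 : ∀ f : Fin 3 → ℝ, ∑ j ∈ Finset.univ.erase (0 : Fin 3), f j = f 1 + f 2 := fun f => by
    rw [e0, Finset.sum_pair (by decide)]
  have s1 : ∀ f : Fin 3 → ℝ, ∑ j ∈ Finset.univ.erase (1 : Fin 3), f j = f 0 + f 2 := fun f => by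
    rw [e1, Finset.sum_pair (by decide)]
  have s2 : ∀ f : Fin 3 → ℝ, ∑ j ∈ Finset.univ.erase (2 : Fin 3), f j = f 0 + f 1 := fun f => by
    rw [e2, Finset.sum_pair (by decide)]
  simp only [dropCoeff, s0, s1, s2, ratio, capLambda]
  -- In the first case u is orthogonal to the first eigenvector and only the last two coefficients
  -- equal Λ; the bounds on the first coefficient and on ξ replace the missing equality. In the
  -- second case u equalizes all three coefficients.
  split_ifs with hc
  · obtain ⟨u0, u1, u2⟩ := hD.u_case_nonneg hc
    rw [dotProduct_comm] at u0 u1 u2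
    rw [u0, u1, u2, h.xi_eq]
    refine ⟨?_, ?_, Or.inr ⟨?_, ?_, ?_⟩⟩
    · field_simp; ring
    · field_simp; ring
    · rw [← sub_nonneg]
      have : (lam 0 + lam 1 + lam 2 - lam 0) / (lam 1 + lam 2) -
          ((lam 0 + lam 1 + lam 2 - lam 1) / (lam 1 + lam 2) *
            (1 - 0 ^ 2 - lam 1 / (lam 1 + lam 2)) +
          (lam 0 + lam 1 + lam 2 - lam 2) / (lam 1 + lam 2) *
            (1 - 0 ^ 2 - lam 2 / (lam 1 + lam 2))) - lam 0 / (lam 1 + lam 2) =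
          2 * (lam 1 * lam 2 - lam 0 * lam 1 - lam 0 * lam 2) / (lam 1 + lam 2) ^ 2 := by
        field_simp; ring
      rw [this]
      positivity
    · rw [← sub_nonneg]
      have : 1 / 2 - ((lam 0 + lam 1 + lam 2 - lam 0) / (lam 1 + lam 2) -
          ((lam 0 + lam 1 + lam 2 - lam 1) / (lam 1 + lam 2) *
            (1 - 0 ^ 2 - lam 1 / (lam 1 + lam 2)) +
          (lam 0 + lam 1 + lam 2 - lam 2) / (lam 1 + lam 2) *
            (1 - 0 ^ 2 - lam 2 / (lam 1 + lam 2)))) =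
          ((lam 1 - lam 2) ^ 2 + 2 * lam 0 * (lam 1 + lam 2)) / (2 * (lam 1 + lam 2) ^ 2) := by
        field_simp; ring
      rw [this]
      positivity
    · rw [div_le_div_iff₀ hL (by norm_num)]
      nlinarith
  · have hv := hD.u_case_neg (not_le.1 hc)
    have hp : pairSum lam = 2 * (lam 0 * lam 1 + lam 0 * lam 2 + lam 1 * lam 2) := by
      rw [pairSum, Fin.sum_univ_three, s0, s1, s2]; ring
    have q0 := hv 0
    have q1 := hv 1
    have q2 := hv 2
    rw [dotProduct_comm, hp, e0, Finset.prod_pair (by decide)] at q0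
    rw [dotProduct_comm, hp, e1, Finset.prod_pair (by decide)] at q1
    rw [dotProduct_comm, hp, e2, Finset.prod_pair (by decide)] at q2
    rw [q0, q1, q2, hp, Fin.prod_univ_three]
    have hl1 : 0 < lam 1 := p0.trans l01
    have hl2 : 0 < lam 2 := hl1.trans l12
    refine ⟨?_, ?_, Or.inl ?_⟩
    all_goals
      field_simp
      ring

theorem capLambda_pos (h : SpectralFrame A lam v) : 0 < capLambda lam := by
  have p0 := h.pos
  have hl1 : 0 < lam 1 := p0.trans h.lt01
  have hl2 : 0 < lam 2 := hl1.trans h.lt12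
  have hp : pairSum lam = 2 * (lam 0 * lam 1 + lam 0 * lam 2 + lam 1 * lam 2) := by
    simp only [pairSum, Fin.sum_univ_three,
      show Finset.univ.erase (0 : Fin 3) = {1, 2} by decide,
      show Finset.univ.erase (1 : Fin 3) = {0, 2} by decide,
      show Finset.univ.erase (2 : Fin 3) = {0, 1} by decide]
    rw [Finset.sum_pair (by decide), Finset.sum_pair (by decide), Finset.sum_pair (by decide)]
    ring
  unfold capLambda
  rw [hp, Fin.prod_univ_three]
  split_ifs <;> positivity

end SpectralFrame
-- Rotations about a common axis and the opposite axes of the two configurations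
theorem rodrigues_neg (θ : ℝ) (u : Vec3) : rodrigues θ (-u) = rodrigues (-θ) u := by
  simp [rodrigues, skew_neg]

theorem rodrigues_mul (φ ψ : ℝ) {u : Vec3} (hu : sqNorm u = 1) :
    rodrigues (2 * φ) u * rodrigues (2 * ψ) u = rodrigues (2 * (φ + ψ)) u := by
  rw [rodrigues_two_mul _ hu, rodrigues_two_mul _ hu, rodrigues_two_mul _ hu, rot_mul,
    Real.cos_add, Real.sin_add]
  congr 1
  · rw [smul_dotProduct, dotProduct_smul, ← sqNorm, hu]; simp
  · rw [map_smul, map_smul, LinearMap.smul_apply, cross_self, smul_zero, smul_zero, add_zero,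
      smul_smul, smul_smul, ← add_smul]
    congr 1; ring

theorem rodrigues_zero (u : Vec3) : rodrigues 0 u = 1 := by simp [rodrigues]

theorem rodrigues_transpose (θ : ℝ) (u : Vec3) : (rodrigues θ u)ᵀ = rodrigues (-θ) u := by
  simp [rodrigues, skew_transpose, transpose_mul]

theorem sqNorm_nuMap {u : Vec3} (hu : sqNorm u = 1) (q : ℕ) : sqNorm (nuMap u q) = 1 := by
  unfold nuMap
  split_ifs
  · exact hu
  · rw [sqNorm_neg, hu]

theorem mem_indexSet {q : ℕ} : q ∈ indexSet ↔ q = 1 ∨ q = 2 := by simp [indexSet]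

theorem exists_nuMap_neg (u : Vec3) {q : ℕ} (hq : q ∈ indexSet) :
    ∃ p ∈ indexSet, nuMap u p = -nuMap u q := by
  rcases mem_indexSet.1 hq with rfl | rfl
  · exact ⟨2, by simp [indexSet], by simp [nuMap]⟩
  · exact ⟨1, by simp [indexSet], by simp [nuMap]⟩

/-! ### The warped potential -/

/-- The warping `X ↦ X R_a(2 arcsin(k U_A(X)), w)` about the axis `w`. -/
noncomputable def warp (A : Mat3) (k : ℝ) (w : Vec3) (X : Mat3) : Mat3 :=
  X * rodrigues (2 * Real.arcsin (k * UA A X)) w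

theorem Gam_eq_warp (A : Mat3) (k : ℝ) (ν : ℕ → Vec3) (X : Mat3) (q : ℕ) :
    Gam A k ν X q = warp A k (ν q) X := rfl

theorem warp_mem_SO3 {A : Mat3} {k : ℝ} {w : Vec3} (hw : sqNorm w = 1) {X : Mat3} (hX : X ∈ SO3) :
    warp A k w X ∈ SO3 := SO3_mul hX (rodrigues_mem_SO3 _ hw)

namespace SpectralFrame

variable {A : Mat3} {lam : Fin 3 → ℝ} {v : Fin 3 → Vec3}

theorem sin_arcsin_UA (h : SpectralFrame A lam v) {k : ℝ} (hk : 0 < k) (hk2 : k ^ 2 < 1 / 2)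
    {X : Mat3} (hX : X ∈ SO3) : Real.sin (Real.arcsin (k * UA A X)) = k * UA A X := by
  have h0 := h.UA_nonneg hX
  have h1 := h.UA_le_one hX
  have hk1 : k < 1 := by nlinarith
  apply Real.sin_arcsin <;> nlinarith [mul_nonneg hk.le h0]

theorem gain_mul_UA_sq_lt (h : SpectralFrame A lam v) {k : ℝ} (hk2 : k ^ 2 < 1 / 2)
    {X : Mat3} (hX : X ∈ SO3) : k ^ 2 * UA A X ^ 2 < 1 / 2 := by
  have h0 := h.UA_nonneg hX
  have h1 := h.UA_le_one hX
  have h2 : UA A X ^ 2 ≤ 1 := by nlinarith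
  nlinarith [sq_nonneg k]

/-- The vector part of the warped quaternion is cos φ ε + sin φ (η w + ε × w), where the second
vector has norm at most 1. Moreover sin φ = k U_A ≤ k |X|_I and cos φ ≥ √(1 - k²), so the warping
distorts the distance to the identity by bounded factors. -/
theorem attDist_warp_le (h : SpectralFrame A lam v) {k : ℝ} (hk : 0 < k) (hk2 : k ^ 2 < 1 / 2)
    {w : Vec3} (hw : sqNorm w = 1) {X : Mat3} (hX : X ∈ SO3) :
    attDist (warp A k w X) ≤ 2 * attDist X ∧
      (√(1 - k ^ 2) - k) * attDist X ≤ attDist (warp A k w X) := by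
  have hU0 := h.UA_nonneg hX
  have hU1 := h.UA_le_one hX
  have hUd := h.UA_le hX
  have hd1 := attDist_le_one hX
  have hd0 := attDist_nonneg X
  have hk1 : k < 1 := by nlinarith
  have hsin := h.sin_arcsin_UA hk hk2 hX
  have hcos := Real.cos_arcsin (k * UA A X)
  have hΓ := warp_mem_SO3 (A := A) (k := k) hw hX
  have hcos_le : √(1 - k ^ 2) ≤ Real.cos (Real.arcsin (k * UA A X)) := by
    rw [hcos]
    apply Real.sqrt_le_sqrt
    nlinarith [mul_nonneg (sq_nonneg k) (mul_nonneg hU0 (sub_nonneg.2 hU1)), mul_nonneg (sq_nonneg k) (sub_nonneg.2 hU1)]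
  have hcos0 := Real.cos_arcsin_nonneg (k * UA A X)
  have hcos1 := Real.cos_le_one (Real.arcsin (k * UA A X))
  have hsc := Real.sin_sq_add_cos_sq (Real.arcsin (k * UA A X))
  unfold warp at *
  generalize UA A X = U at *
  obtain ⟨η, ε, hq, rfl⟩ := exists_rot hX
  have hdX : attDist (rot η ε) = vnorm ε := by
    rw [← Real.sqrt_sq hd0, attDist_rot_sq hq]; rfl
  have hz : vnorm (η • w + crossProduct ε w) ≤ 1 := by
    apply vnorm_le_of_sqNorm_le zero_le_one
    have hc : ∀ i, crossProduct ε w i = ![ε 1 * w 2 - ε 2 * w 1,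
          ε 2 * w 0 - ε 0 * w 2, ε 0 * w 1 - ε 1 * w 0] i := fun i => by rw [cross_apply]
    have : sqNorm (η • w + crossProduct ε w) =
        (η ^ 2 + sqNorm ε) * sqNorm w - (ε ⬝ᵥ w) ^ 2 := by
      simp only [sqNorm_eq, dot_eq, Pi.add_apply, Pi.smul_apply, smul_eq_mul, hc]
      simp
      ring
    rw [this, hq, hw]
    nlinarith [sq_nonneg (ε ⬝ᵥ w)]
  set φ := Real.arcsin (k * U) with hφ
  have hprod : rot η ε * rodrigues (2 * φ) w = rot (η * Real.cos φ - ε ⬝ᵥ (Real.sin φ • w))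
      (Real.cos φ • ε + Real.sin φ • (η • w + crossProduct ε w)) := by
    rw [rodrigues_two_mul _ hw, rot_mul]
    congr 1
    rw [map_smul, smul_add, smul_smul, smul_smul, mul_comm η, add_assoc]
  have hq' : (η * Real.cos φ - ε ⬝ᵥ (Real.sin φ • w)) ^ 2 +
      sqNorm (Real.cos φ • ε + Real.sin φ • (η • w + crossProduct ε w)) = 1 := by
    have hc : ∀ i, crossProduct ε w i = ![ε 1 * w 2 - ε 2 * w 1,
          ε 2 * w 0 - ε 0 * w 2, ε 0 * w 1 - ε 1 * w 0] i := fun i => by rw [cross_apply]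
    have : (η * Real.cos φ - ε ⬝ᵥ (Real.sin φ • w)) ^ 2 +
      sqNorm (Real.cos φ • ε + Real.sin φ • (η • w + crossProduct ε w)) =
      (η ^ 2 + sqNorm ε) * (Real.sin φ ^ 2 * sqNorm w + Real.cos φ ^ 2) := by
      simp only [sqNorm_eq, dot_eq, Pi.add_apply, Pi.smul_apply, smul_eq_mul, hc]
      simp
      ring
    rw [this, hq, hw, mul_one, hsc, mul_one]
  have hdΓ : attDist (rot η ε * rodrigues (2 * φ) w) =
      vnorm (Real.cos φ • ε + Real.sin φ • (η • w + crossProduct ε w)) := by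
    rw [hprod, ← Real.sqrt_sq (attDist_nonneg _), attDist_rot_sq hq']; rfl
  rw [hdΓ, hdX]
  rw [hdX] at hd0 hd1 hUd
  have hs0 : 0 ≤ Real.sin φ := by rw [hsin]; positivity
  have hsk : Real.sin φ ≤ k * vnorm ε := by
    rw [hsin]
    have : U ≤ vnorm ε := by nlinarith
    exact mul_le_mul_of_nonneg_left this hk.le
  have hn1 : vnorm (Real.sin φ • (η • w + crossProduct ε w)) ≤ Real.sin φ := by
    rw [vnorm_smul, abs_of_nonneg hs0]
    nlinarith
  have hn2 : vnorm (Real.cos φ • ε) = Real.cos φ * vnorm ε := by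
    rw [vnorm_smul, abs_of_nonneg hcos0]
  constructor
  · have := vnorm_add_le (Real.cos φ • ε) (Real.sin φ • (η • w + crossProduct ε w))
    nlinarith
  · have := vnorm_sub_le (Real.cos φ • ε + Real.sin φ • (η • w + crossProduct ε w))
      (Real.sin φ • (η • w + crossProduct ε w))
    rw [add_sub_cancel_right, hn2] at this
    nlinarith

/-! ### The hysteresis gap at the critical points -/

/-- V̄ is the positive root of k² Λ V² + V = ξ, to be compared with the equation that U_A(X)
satisfies at a critical point of the warped potential. -/
theorem barV_spec (h : SpectralFrame A lam v) {k : ℝ} (hk : 0 < k) :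
    0 < barV A lam k ∧ barV A lam k + k ^ 2 * capLambda lam * barV A lam k ^ 2 = xi A := by
  have hΛ := h.capLambda_pos
  have hm : 0 < k ^ 2 * capLambda lam := by positivity
  have hx := h.xi_pos
  have e : 4 * k ^ 2 * xi A * capLambda lam = 4 * (k ^ 2 * capLambda lam) * xi A := by ring
  have e' : 2 * k ^ 2 * capLambda lam = 2 * (k ^ 2 * capLambda lam) := by ring
  rw [barV, e, e']
  generalize k ^ 2 * capLambda lam = m at *
  have hs := Real.sq_sqrt (show (0 : ℝ) ≤ 1 + 4 * m * xi A by positivity)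
  have hs1 : 1 < √(1 + 4 * m * xi A) := by
    apply Real.lt_sqrt_of_sq_lt
    nlinarith [mul_pos hm hx]
  generalize √(1 + 4 * m * xi A) = s at *
  refine ⟨div_pos (by linarith) (by linarith), ?_⟩
  field_simp
  nlinarith

/-- At a critical point of the warped potential other than the identity, switching to the opposite
axis lowers the potential by at least `Δ_III`. -/
theorem exists_drop (h : SpectralFrame A lam v) {u : Vec3} {k : ℝ} (hD : IsDesign A lam v u k)
    {X : Mat3} (hX : X ∈ SO3) {q : ℕ} (hq : q ∈ indexSet) {i : Fin 3}
    (hΓ : Gam A k (nuMap u) X q = rot 0 (v i)) :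
    PhiU A k (nuMap u) X q = ratio lam i ∧
      ∃ p ∈ indexSet, PhiU A k (nuMap u) X p + DeltaIII A lam k ≤ PhiU A k (nuMap u) X q := by
  have hk := hD.k_pos
  have hk2 := h.gain_sq_lt hk hD.k_lt
  have hw := sqNorm_nuMap hD.unit_u q
  have hsin := h.sin_arcsin_UA hk hk2 hX
  have hU0 := h.UA_nonneg hX
  have hU1 := h.UA_le_one hX
  have hcos := Real.cos_arcsin (k * UA A X)
  set φ := Real.arcsin (k * UA A X) with hφ
  have hdrop : dropCoeff lam v (nuMap u q) i = dropCoeff lam v u i := by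
    unfold nuMap
    split_ifs
    · rfl
    · exact dropCoeff_neg u i
  have hXΓ : X = rot 0 (v i) * rodrigues (2 * (-φ)) (nuMap u q) := by
    rw [← hΓ, Gam_eq_warp, warp, ← hφ, Matrix.mul_assoc, rodrigues_mul _ _ hw, add_neg_cancel,
      mul_zero, rodrigues_zero, Matrix.mul_one]
  -- Undoing the warp at the half turn gives an equation for U = U_A(X), namely U + k² U² d_i = s_i.
  have hUX : UA A X = ratio lam i - (k * UA A X) ^ 2 * dropCoeff lam v u i := by
    conv_lhs => rw [hXΓ, h.UA_half_turn_mul hw, Real.sin_neg, hsin, neg_sq, hdrop]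
  have hΦq : PhiU A k (nuMap u) X q = ratio lam i := by
    have := h.UA_half_turn_mul hw i 0
    rw [mul_zero, rodrigues_zero, Matrix.mul_one, Real.sin_zero] at this
    rw [PhiU, hΓ, this]; ring
  refine ⟨hΦq, ?_⟩
  obtain ⟨p, hp, hpu⟩ := exists_nuMap_neg u hq
  refine ⟨p, hp, ?_⟩
  -- The opposite axis does not cancel the rotation by -2φ but doubles it, whence sin²(2φ) in place
  -- of 0.
  have hΦp : PhiU A k (nuMap u) X p = ratio lam i - (2 * (k * UA A X) * √(1 - (k * UA A X) ^ 2)) ^ 2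
      * dropCoeff lam v u i := by
    have : Gam A k (nuMap u) X p = rot 0 (v i) * rodrigues (2 * (-(2 * φ))) (nuMap u q) := by
      rw [Gam_eq_warp, warp, ← hφ, hpu, rodrigues_neg]
      conv_lhs => rw [hXΓ]
      rw [Matrix.mul_assoc, ← mul_neg, rodrigues_mul _ _ hw]
      congr 3; ring
    rw [PhiU, this, h.UA_half_turn_mul hw, Real.sin_neg, neg_sq, Real.sin_two_mul, hsin, hcos,
      hdrop]
  have hlt := h.gain_mul_UA_sq_lt hk2 hX
  have hsq : √(1 - (k * UA A X) ^ 2) ^ 2 = 1 - (k * UA A X) ^ 2 := by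
    apply Real.sq_sqrt; rw [mul_pow]; linarith
  rw [hΦp, hΦq, mul_pow, hsq]
  clear hΦp hΦq hpu hXΓ hdrop hsin hcos hΓ hφ hw hsq
  clear_value φ
  generalize UA A X = U at *
  obtain ⟨d1, d2, d0⟩ := h.dropCoeff_eq hD
  obtain ⟨hV0, hV⟩ := h.barV_spec hk
  have hΛ := h.capLambda_pos
  have r0 := h.ratio_zero
  have r1 := h.ratio_lt_21
  have r2 := h.ratio_two
  have hx0 := h.xi_pos
  have hx1 := h.xi_lt_one
  rw [DeltaIII]
  generalize barV A lam k = V at *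
  generalize capLambda lam = Λ at *
  have hVle : V ≤ xi A := by nlinarith [mul_pos (pow_pos hk 2) hΛ, sq_nonneg V]
  -- The function t ↦ t (1 - k² t) is increasing in the relevant range because k² (U² + V²) ≤ 1, so
  -- the drop at U is at least the one at V̄ with coefficient Λ.
  have main : V ≤ U → Λ ≤ dropCoeff lam v u i → ratio lam i - (2 * (k * U)) ^ 2 *
      (1 - (k * U) ^ 2) * dropCoeff lam v u i + 4 * k ^ 2 * V ^ 2 * (1 - k ^ 2 * V ^ 2) * Λ ≤
      ratio lam i := by
    intro h1 h2
    have hUV : V ^ 2 ≤ U ^ 2 := by nlinarith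
    have hU2 : U ^ 2 ≤ 1 := by nlinarith
    have h3 : V ^ 2 * (1 - k ^ 2 * V ^ 2) ≤ U ^ 2 * (1 - k ^ 2 * U ^ 2) := by
      have : 0 ≤ 1 - k ^ 2 * (U ^ 2 + V ^ 2) := by nlinarith [sq_nonneg k]
      nlinarith [mul_nonneg (sub_nonneg.2 hUV) this]
    have h4 : 0 ≤ U ^ 2 * (1 - k ^ 2 * U ^ 2) := mul_nonneg (sq_nonneg _) (by linarith)
    have h5 : V ^ 2 * (1 - k ^ 2 * V ^ 2) * Λ ≤ U ^ 2 * (1 - k ^ 2 * U ^ 2) *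
        dropCoeff lam v u i := mul_le_mul h3 h2 hΛ.le h4
    nlinarith [mul_le_mul_of_nonneg_left h5 (sq_nonneg k)]
  -- If d_i = Λ, the increasing function t + k² Λ t² takes the value s_i at U and the value ξ ≤ s_i
  -- at V̄.
  have easy : xi A ≤ ratio lam i → dropCoeff lam v u i = Λ → V ≤ U := by
    intro h1 h2
    rw [h2] at hUX
    by_contra! h3
    have h4 : U ^ 2 < V ^ 2 := by nlinarith
    nlinarith [mul_pos (pow_pos hk 2) hΛ]
  fin_cases i
  · simp only [Fin.zero_eta] at *
    rcases d0 with d0 | ⟨d0, d0', hx⟩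
    · exact main (easy (by linarith) d0) d0.ge
    · refine main ?_ d0
      -- Here d_0 may exceed Λ. With s_0 = 1, k² < 1/2 and d_0 ≤ 1/2, a value U < 3/4 would force U
      -- ≥ 1 - 9/64. Then V̄ ≤ ξ ≤ 3/4 ≤ U.
      have : 3 / 4 ≤ U := by
        by_contra! h3
        have h4 : U ^ 2 ≤ 9 / 16 := by nlinarith
        have h5 : k ^ 2 * U ^ 2 ≤ 1 / 2 * (9 / 16) := mul_le_mul hk2.le h4 (sq_nonneg _) (by norm_num)
        have h6 : k ^ 2 * U ^ 2 * dropCoeff lam v u 0 ≤ 1 / 2 * (9 / 16) * (1 / 2) :=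
          mul_le_mul h5 d0' (hΛ.le.trans d0) (by norm_num)
        rw [mul_pow] at hUX
        linarith
      linarith
  · simp only [Fin.mk_one] at *
    exact main (easy (by linarith) d1) d1.ge
  · simp only [Fin.reduceFinMk] at *
    exact main (easy (by linarith) d2) d2.ge

end SpectralFrame
-- The hysteresis gap, compactness of SO(3) and continuity of the potentials
theorem exists_min_eq_sInf (f : ℕ → ℝ) {Q : Finset ℕ} (hQ : Q.Nonempty) :
    ∃ p ∈ Q, sInf (f '' Q) = f p ∧ ∀ p' ∈ Q, f p ≤ f p' := by
  obtain ⟨p, hp, hmin⟩ := Q.exists_min_image f hQ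
  refine ⟨p, hp, IsLeast.csInf_eq ⟨⟨p, hp, rfl⟩, ?_⟩, hmin⟩
  rintro _ ⟨p', hp', rfl⟩
  exact hmin p' hp'

theorem sub_sInf_le_iff (f : ℕ → ℝ) {Q : Finset ℕ} (hQ : Q.Nonempty) (q : ℕ) (δ : ℝ) :
    f q - sInf (f '' Q) ≤ δ ↔ ∀ p ∈ Q, f q - f p ≤ δ := by
  obtain ⟨p, hp, h1, h2⟩ := exists_min_eq_sInf f hQ
  rw [h1]
  exact ⟨fun h p' hp' => by linarith [h2 p' hp'], fun h => h p hp⟩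

theorem le_sub_sInf_iff (f : ℕ → ℝ) {Q : Finset ℕ} (hQ : Q.Nonempty) (q : ℕ) (δ : ℝ) :
    δ ≤ f q - sInf (f '' Q) ↔ ∃ p ∈ Q, δ ≤ f q - f p := by
  obtain ⟨p, hp, h1, h2⟩ := exists_min_eq_sInf f hQ
  rw [h1]
  exact ⟨fun h => ⟨p, hp, h⟩, fun ⟨p', hp', h⟩ => by linarith [h2 p' hp']⟩

theorem indexSet_nonempty : indexSet.Nonempty := ⟨1, by simp [indexSet]⟩

theorem isClosed_SO3 : IsClosed SO3 := by
  have : SO3 = {X : Mat3 | X * Xᵀ = 1} ∩ {X : Mat3 | X.det = 1} := by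
    ext X; exact mem_SO3
  rw [this]
  apply IsClosed.inter
  · exact isClosed_eq (by fun_prop) continuous_const
  · exact isClosed_eq (by fun_prop) continuous_const

theorem abs_apply_le_one {X : Mat3} (hX : X ∈ SO3) (i j : Fin 3) : |X i j| ≤ 1 := by
  have h := (SO3_entries hX).1 i
  rw [abs_le]
  fin_cases j <;> constructor <;> simp <;>
    nlinarith [sq_nonneg (X i 0), sq_nonneg (X i 1), sq_nonneg (X i 2)]

theorem isCompact_SO3 : IsCompact SO3 := by
  have hc : IsCompact (Set.pi univ fun _ : Fin 3 => Set.pi univ fun _ : Fin 3 => Icc (-1 : ℝ) 1) :=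
    isCompact_univ_pi fun _ => isCompact_univ_pi fun _ => isCompact_Icc
  refine IsCompact.of_isClosed_subset (X := Fin 3 → Fin 3 → ℝ) hc isClosed_SO3 ?_
  intro X hX i _ j _
  exact abs_le.1 (abs_apply_le_one hX i j)

theorem continuous_UA (A : Mat3) : Continuous (UA A) := by
  unfold UA; fun_prop

theorem continuous_rodrigues (w : Vec3) : Continuous fun θ => rodrigues θ w := by
  unfold rodrigues; fun_prop

theorem continuous_warp (A : Mat3) (k : ℝ) (w : Vec3) : Continuous (warp A k w) := by
  unfold warp
  have h := continuous_UA A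
  have h1 : Continuous fun X => rodrigues (2 * Real.arcsin (k * UA A X)) w :=
    (continuous_rodrigues w).comp (by fun_prop)
  fun_prop

theorem continuous_PhiU (A : Mat3) (k : ℝ) (ν : ℕ → Vec3) (q : ℕ) :
    Continuous fun X => PhiU A k ν X q :=
  (continuous_UA A).comp (continuous_warp A k (ν q))

theorem continuous_PhiV (A : Mat3) (k : ℝ) (ν : ℕ → Vec3) (q : ℕ) :
    Continuous fun X => PhiV A k ν X q := by
  have := continuous_PhiU A k ν q
  unfold PhiU at this
  unfold PhiV VA
  fun_prop

theorem continuous_psi : Continuous psi := by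
  refine continuous_pi fun i => ?_
  fin_cases i <;> simp [psi] <;> fun_prop

theorem continuous_sqNorm : Continuous sqNorm := by
  unfold sqNorm dotProduct; fun_prop

theorem isCompact_flowSet_slice {Φ : Mat3 → ℕ → ℝ} (hΦ : ∀ q, Continuous fun X => Φ X q)
    {Q : Finset ℕ} (hQ : Q.Nonempty) (δ : ℝ) (q : ℕ) :
    IsCompact {X | (X, q) ∈ flowSet Φ Q δ} := by
  have : {X | (X, q) ∈ flowSet Φ Q δ} =
      SO3 ∩ ({X | q ∈ Q} ∩ ⋂ p ∈ Q, {X | Φ X q - Φ X p ≤ δ}) := by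
    ext X
    simp only [flowSet, mem_ofPred_eq, mem_inter_iff, mem_iInter]
    rw [sub_sInf_le_iff _ hQ]
  rw [this]
  refine isCompact_SO3.inter_right (IsClosed.inter ?_ ?_)
  · exact isClosed_const
  · refine isClosed_biInter fun p _ => ?_
    exact isClosed_le ((hΦ q).sub (hΦ p)) continuous_const

/-! ### Critical points in the flow sets and lower bounds for the gradient -/

namespace SpectralFrame

variable {A : Mat3} {lam : Fin 3 → ℝ} {v : Fin 3 → Vec3} {u : Vec3} {k : ℝ}

theorem contraction_pos (hk2 : k ^ 2 < 1 / 2) : 0 < √(1 - k ^ 2) - k := by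
  have : k < √(1 - k ^ 2) := Real.lt_sqrt_of_sq_lt (by linarith)
  linarith

theorem PhiU_bounds (h : SpectralFrame A lam v) (hD : IsDesign A lam v u k)
    {X : Mat3} (hX : X ∈ SO3) (q : ℕ) :
    xi A * (√(1 - k ^ 2) - k) ^ 2 * attDist X ^ 2 ≤ PhiU A k (nuMap u) X q ∧
      PhiU A k (nuMap u) X q ≤ 4 * attDist X ^ 2 := by
  have hw := sqNorm_nuMap hD.unit_u q
  have hk2 := h.gain_sq_lt hD.k_pos hD.k_lt
  have hΓ := warp_mem_SO3 (A := A) (k := k) hw hX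
  obtain ⟨h1, h2⟩ := h.attDist_warp_le hD.k_pos hk2 hw hX
  have hc := contraction_pos hk2
  have h3 := h.UA_le hΓ
  have h4 := h.le_UA hΓ
  have hd := attDist_nonneg X
  rw [PhiU, Gam_eq_warp]
  constructor
  · refine le_trans ?_ h4
    rw [mul_assoc, ← mul_pow]
    exact mul_le_mul_of_nonneg_left (pow_le_pow_left₀ (mul_nonneg hc.le hd) h2 2) h.xi_pos.le
  · refine h3.trans ?_
    calc attDist (warp A k (nuMap u q) X) ^ 2 ≤ (2 * attDist X) ^ 2 :=
          pow_le_pow_left₀ (attDist_nonneg _) h1 2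
      _ = 4 * attDist X ^ 2 := by ring

theorem PhiU_nonneg (h : SpectralFrame A lam v) (hD : IsDesign A lam v u k)
    {X : Mat3} (hX : X ∈ SO3) (q : ℕ) : 0 ≤ PhiU A k (nuMap u) X q :=
  h.UA_nonneg (warp_mem_SO3 (sqNorm_nuMap hD.unit_u q) hX)

theorem PhiU_le_one (h : SpectralFrame A lam v) (hD : IsDesign A lam v u k)
    {X : Mat3} (hX : X ∈ SO3) (q : ℕ) : PhiU A k (nuMap u) X q ≤ 1 :=
  h.UA_le_one (warp_mem_SO3 (sqNorm_nuMap hD.unit_u q) hX)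

/-- In the flow set of `Φ_{U_A}` the warped potential has no critical point with positive value. -/
theorem no_critical_flowSet_U (h : SpectralFrame A lam v) (hD : IsDesign A lam v u k) {δ : ℝ}
    (hδ : δ < DeltaIII A lam k) {X : Mat3} {q : ℕ}
    (hz : (X, q) ∈ flowSet (PhiU A k (nuMap u)) indexSet δ)
    (hpsi : psi (A * Gam A k (nuMap u) X q) = 0) : PhiU A k (nuMap u) X q = 0 := by
  obtain ⟨hX, hq, hgap⟩ := hz
  have hΓ := warp_mem_SO3 (A := A) (k := k) (sqNorm_nuMap hD.unit_u q) hX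
  rcases h.eq_half_turn_of_psi_eq_zero hΓ hpsi with h0 | ⟨i, hi⟩
  · exact h0
  · obtain ⟨-, p, hp, hdrop⟩ := h.exists_drop hD hX hq hi
    have := (sub_sInf_le_iff _ indexSet_nonempty q δ).1 hgap p hp
    dsimp only at this
    linarith

theorem DeltaIII_pos (h : SpectralFrame A lam v) (hD : IsDesign A lam v u k) :
    0 < DeltaIII A lam k := by
  have hk := hD.k_pos
  have hk2 := h.gain_sq_lt hk hD.k_lt
  obtain ⟨h1, h2⟩ := h.barV_spec hk
  have hΛ := h.capLambda_pos
  have hx := h.xi_lt_one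
  have hV : barV A lam k < 1 := by nlinarith [mul_pos (pow_pos hk 2) hΛ, sq_nonneg (barV A lam k)]
  have : k ^ 2 * barV A lam k ^ 2 < 1 := by nlinarith
  unfold DeltaIII
  have : 0 < 1 - k ^ 2 * barV A lam k ^ 2 := by linarith
  positivity

/-- In the flow set of `Φ_{V_A}` the warped potential has no critical point with positive value. -/
theorem no_critical_flowSet_V (h : SpectralFrame A lam v) (hD : IsDesign A lam v u k) {δ : ℝ}
    (hδ : δ < DeltaIV A lam k) {X : Mat3} {q : ℕ}
    (hz : (X, q) ∈ flowSet (PhiV A k (nuMap u)) indexSet δ)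
    (hpsi : psi (A * Gam A k (nuMap u) X q) = 0) : PhiU A k (nuMap u) X q = 0 := by
  obtain ⟨hX, hq, hgap⟩ := hz
  have hΓ := warp_mem_SO3 (A := A) (k := k) (sqNorm_nuMap hD.unit_u q) hX
  rcases h.eq_half_turn_of_psi_eq_zero hΓ hpsi with h0 | ⟨i, hi⟩
  · exact h0
  · obtain ⟨hval, p, hp, hdrop⟩ := h.exists_drop hD hX hq hi
    have hg := (sub_sInf_le_iff _ indexSet_nonempty q δ).1 hgap p hp
    have h1 := h.PhiU_le_one hD hX q
    have hxi : xi A ≤ PhiU A k (nuMap u) X q := by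
      rw [hval, ← h.ratio_two]
      have := h.ratio_lt_10
      have := h.ratio_lt_21
      fin_cases i <;> simp <;> linarith
    have hΔ := h.DeltaIII_pos hD
    have hV : ∀ p, PhiV A k (nuMap u) X p = 2 * (1 - √(1 - PhiU A k (nuMap u) X p)) :=
      fun _ => rfl
    rw [DeltaIV] at hδ
    dsimp only at hg
    rw [hV, hV] at hg
    have h2 : √(1 - PhiU A k (nuMap u) X q + DeltaIII A lam k) ≤
        √(1 - PhiU A k (nuMap u) X p) := Real.sqrt_le_sqrt (by linarith)
    -- By concavity the increment of the square root over a step Δ_III grows as its argument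
    -- decreases, and 1 - x ≤ 1 - ξ at the half turns.
    have h3 : √(1 - xi A + DeltaIII A lam k) - √(1 - xi A) ≤
        √(1 - PhiU A k (nuMap u) X q + DeltaIII A lam k) - √(1 - PhiU A k (nuMap u) X q) := by
      generalize PhiU A k (nuMap u) X q = x at *
      generalize DeltaIII A lam k = D at *
      have a1 := Real.sq_sqrt (show 0 ≤ 1 - xi A + D by linarith)
      have a2 := Real.sq_sqrt (show 0 ≤ 1 - xi A by linarith)
      have a3 := Real.sq_sqrt (show 0 ≤ 1 - x + D by linarith)
      have a4 := Real.sq_sqrt (show 0 ≤ 1 - x by linarith)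
      have b1 : √(1 - x + D) ≤ √(1 - xi A + D) := Real.sqrt_le_sqrt (by linarith)
      have b2 : √(1 - x) ≤ √(1 - xi A) := Real.sqrt_le_sqrt (by linarith)
      have b3 : 0 < √(1 - x + D) := Real.sqrt_pos.2 (by linarith)
      have b4 := Real.sqrt_nonneg (1 - x)
      have b5 : √(1 - x) ≤ √(1 - x + D) := Real.sqrt_le_sqrt (by linarith)
      generalize √(1 - xi A + D) = p1 at *
      generalize √(1 - xi A) = p2 at *
      generalize √(1 - x + D) = p3 at *
      generalize √(1 - x) = p4 at *
      by_contra! hc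
      nlinarith
    linarith

/-- The flow set of `Φ_{V_A}` avoids the maximizers of the warped potential. -/
theorem PhiU_ne_one_of_mem_flowSet (h : SpectralFrame A lam v) (hD : IsDesign A lam v u k) {δ : ℝ}
    (hδ : δ < DeltaIV A lam k) {X : Mat3} {q : ℕ}
    (hz : (X, q) ∈ flowSet (PhiV A k (nuMap u)) indexSet δ) : PhiU A k (nuMap u) X q ≠ 1 := by
  intro h1
  have hX := hz.1
  have hΓ := warp_mem_SO3 (A := A) (k := k) (sqNorm_nuMap hD.unit_u q) hX
  have hpsi : psi (A * Gam A k (nuMap u) X q) = 0 := by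
    have := h.sqNorm_psi_le hΓ
    rw [← Gam_eq_warp, show UA A (Gam A k (nuMap u) X q) = 1 from h1] at this
    exact sqNorm_eq_zero.1 (le_antisymm (by linarith) (sqNorm_nonneg _))
  have := h.no_critical_flowSet_V hD hδ hz hpsi
  linarith

/-- A uniform lower bound for the gradient of `U_A` at the warped attitude. -/
theorem exists_le_sqNorm_psi (h : SpectralFrame A lam v) (hD : IsDesign A lam v u k)
    {Φ : Mat3 → ℕ → ℝ} (hΦ : ∀ q, Continuous fun X => Φ X q) {δ : ℝ}
    (hcrit : ∀ X q, (X, q) ∈ flowSet Φ indexSet δ → psi (A * Gam A k (nuMap u) X q) = 0 →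
      PhiU A k (nuMap u) X q = 0) :
    ∃ c : ℝ, 0 < c ∧ ∀ X q, (X, q) ∈ flowSet Φ indexSet δ →
      c * attDist X ^ 2 ≤ sqNorm (psi (A * Gam A k (nuMap u) X q)) := by
  have hx := h.xi_pos
  have hL := h.sum_pos
  have hκ := contraction_pos (h.gain_sq_lt hD.k_pos hD.k_lt)
  -- Away from the identity the squared norm is positive on a compact part of the flow set and
  -- attains a positive minimum there.
  have far : ∀ q, ∃ c : ℝ, 0 < c ∧ ∀ X, (X, q) ∈ flowSet Φ indexSet δ →
      xi A / 2 ≤ PhiU A k (nuMap u) X q → c ≤ sqNorm (psi (A * Gam A k (nuMap u) X q)) := by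
    intro q
    have hK : IsCompact ({X | (X, q) ∈ flowSet Φ indexSet δ} ∩
        {X | xi A / 2 ≤ PhiU A k (nuMap u) X q}) :=
      (isCompact_flowSet_slice hΦ indexSet_nonempty δ q).inter_right
        (isClosed_le continuous_const (continuous_PhiU A k _ q))
    rcases ({X | (X, q) ∈ flowSet Φ indexSet δ} ∩
        {X | xi A / 2 ≤ PhiU A k (nuMap u) X q}).eq_empty_or_nonempty with he | hne
    · refine ⟨1, one_pos, fun X h1 h2 => ?_⟩
      have : X ∈ ({X | (X, q) ∈ flowSet Φ indexSet δ} ∩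
        {X | xi A / 2 ≤ PhiU A k (nuMap u) X q}) := ⟨h1, h2⟩
      rw [he] at this
      exact this.elim
    · have hcont : Continuous fun X => sqNorm (psi (A * Gam A k (nuMap u) X q)) := by
        have h1 : Continuous fun X => Gam A k (nuMap u) X q := continuous_warp A k _
        exact continuous_sqNorm.comp (continuous_psi.comp (by fun_prop))
      obtain ⟨X0, hX0, hmin⟩ := hK.exists_isMinOn hne hcont.continuousOn
      refine ⟨_, ?_, fun X h1 h2 => hmin ⟨h1, h2⟩⟩
      refine lt_of_le_of_ne (sqNorm_nonneg _) fun h0 => ?_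
      have h3 := hcrit X0 q hX0.1 (sqNorm_eq_zero.1 h0.symm)
      have h4 : xi A / 2 ≤ PhiU A k (nuMap u) X0 q := hX0.2
      linarith
  obtain ⟨c1, hc1, h1⟩ := far 1
  obtain ⟨c2, hc2, h2⟩ := far 2
  -- The constant near the identity: in U (ξ - U) the first factor is at least ξ (√(1 - k²) - k)²
  -- |X|_I² and the second exceeds ξ / 2.
  set c3 := (lam 1 + lam 2) ^ 2 * (xi A * (√(1 - k ^ 2) - k) ^ 2 * (xi A / 2)) with hc3
  have hc3_pos : 0 < c3 := by positivity
  refine ⟨min (min c1 c2) c3, lt_min (lt_min hc1 hc2) hc3_pos, fun X q hz => ?_⟩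
  have hX := hz.1
  have hq := hz.2.1
  have hd2 : attDist X ^ 2 ≤ 1 := pow_le_one₀ (attDist_nonneg X) (attDist_le_one hX)
  have hd0 := sq_nonneg (attDist X)
  have hmin : 0 < min (min c1 c2) c3 := lt_min (lt_min hc1 hc2) hc3_pos
  by_cases hfar : xi A / 2 ≤ PhiU A k (nuMap u) X q
  · have : min c1 c2 ≤ sqNorm (psi (A * Gam A k (nuMap u) X q)) := by
      rcases mem_indexSet.1 hq with rfl | rfl
      · exact (min_le_left _ _).trans (h1 X hz hfar)
      · exact (min_le_right _ _).trans (h2 X hz hfar)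
    nlinarith [min_le_left (min c1 c2) c3]
  · push Not at hfar
    have hΓ := warp_mem_SO3 (A := A) (k := k) (sqNorm_nuMap hD.unit_u q) hX
    have h3 := h.le_sqNorm_psi hΓ
    obtain ⟨h4, -⟩ := h.PhiU_bounds hD hX q
    have hf : UA A (warp A k (nuMap u q) X) < xi A / 2 := hfar
    rw [Gam_eq_warp]
    refine le_trans ?_ h3
    have h4' : xi A * (√(1 - k ^ 2) - k) ^ 2 * attDist X ^ 2 ≤ UA A (warp A k (nuMap u q) X) := h4
    calc min (min c1 c2) c3 * attDist X ^ 2 ≤ c3 * attDist X ^ 2 :=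
          mul_le_mul_of_nonneg_right (min_le_right _ _) hd0
      _ = (lam 1 + lam 2) ^ 2 * (xi A * (√(1 - k ^ 2) - k) ^ 2 * attDist X ^ 2 * (xi A / 2)) := by
          rw [hc3]; ring
      _ ≤ _ := by
          refine mul_le_mul_of_nonneg_left ?_ (sq_nonneg _)
          exact mul_le_mul h4' (by linarith) (by positivity) (h.UA_nonneg hΓ)

end SpectralFrame
/-! ### Smoothness of matrix-valued maps -/

section Smooth

variable {E : Type*} [NormedAddCommGroup E] [NormedSpace ℝ E] {n : WithTop ℕ∞} {x : E}

theorem contDiffAt_matrix_iff {f : E → Mat3} :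
    ContDiffAt ℝ n f x ↔ ∀ i j, ContDiffAt ℝ n (fun y => f y i j) x :=
  (contDiffAt_pi (𝕜 := ℝ) (F' := fun _ : Fin 3 => Fin 3 → ℝ) (Φ := f)).trans
    (forall_congr' fun i => contDiffAt_pi (𝕜 := ℝ) (F' := fun _ : Fin 3 => ℝ)
      (Φ := fun y => f y i))

theorem _root_.ContDiffAt.matrixMul {f g : E → Mat3} (hf : ContDiffAt ℝ n f x)
    (hg : ContDiffAt ℝ n g x) : ContDiffAt ℝ n (fun y => f y * g y) x := by
  rw [contDiffAt_matrix_iff] at *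
  intro i j
  simp only [mul_eq]
  exact (((hf i 0).mul (hg 0 j)).add ((hf i 1).mul (hg 1 j))).add ((hf i 2).mul (hg 2 j))

theorem _root_.ContDiffAt.matrixTranspose {f : E → Mat3} (hf : ContDiffAt ℝ n f x) :
    ContDiffAt ℝ n (fun y => (f y)ᵀ) x := by
  rw [contDiffAt_matrix_iff] at *
  exact fun i j => hf j i

theorem _root_.ContDiffAt.matrixMulVec {f : E → Mat3} {g : E → Vec3} (hf : ContDiffAt ℝ n f x)
    (hg : ContDiffAt ℝ n g x) : ContDiffAt ℝ n (fun y => f y *ᵥ g y) x := by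
  rw [contDiffAt_matrix_iff] at hf
  rw [contDiffAt_pi] at *
  intro i
  simp only [mulVec_eq]
  exact (((hf i 0).mul (hg 0)).add ((hf i 1).mul (hg 1))).add ((hf i 2).mul (hg 2))

theorem _root_.ContDiffAt.skew {f : E → Vec3} (hf : ContDiffAt ℝ n f x) :
    ContDiffAt ℝ n (fun y => skew (f y)) x := by
  rw [contDiffAt_pi] at hf
  rw [contDiffAt_matrix_iff]
  intro i j
  have h0 := hf 0
  have h1 := hf 1
  have h2 := hf 2
  fin_cases i <;> fin_cases j <;> simp [AttitudeObserver.skew] <;>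
    first
    | exact contDiffAt_const
    | assumption
    | exact ContDiffAt.neg (by assumption)

theorem _root_.ContDiffAt.psi {f : E → Mat3} (hf : ContDiffAt ℝ n f x) :
    ContDiffAt ℝ n (fun y => psi (f y)) x := by
  rw [contDiffAt_matrix_iff] at hf
  rw [contDiffAt_pi]
  intro i
  fin_cases i
  · exact (contDiffAt_const (c := (1 / 2 : ℝ))).mul ((hf 2 1).sub (hf 1 2))
  · exact (contDiffAt_const (c := (1 / 2 : ℝ))).mul ((hf 0 2).sub (hf 2 0))
  · exact (contDiffAt_const (c := (1 / 2 : ℝ))).mul ((hf 1 0).sub (hf 0 1))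

theorem _root_.ContDiffAt.dotVec {f g : E → Vec3} (hf : ContDiffAt ℝ n f x)
    (hg : ContDiffAt ℝ n g x) : ContDiffAt ℝ n (fun y => f y ⬝ᵥ g y) x := by
  rw [contDiffAt_pi] at *
  simp only [dot_eq]
  exact (((hf 0).mul (hg 0)).add ((hf 1).mul (hg 1))).add ((hf 2).mul (hg 2))

theorem _root_.ContDiffAt.UA {f : E → Mat3} (hf : ContDiffAt ℝ n f x) (A : Mat3) :
    ContDiffAt ℝ n (fun y => UA A (f y)) x := by
  have h1 : ContDiffAt ℝ n (fun y => A * (1 - f y)) x :=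
    contDiffAt_const.matrixMul (contDiffAt_const.sub hf)
  rw [contDiffAt_matrix_iff] at h1
  simp only [AttitudeObserver.UA, Matrix.trace, Fin.sum_univ_three, diag_apply]
  exact (((h1 0 0).add (h1 1 1)).add (h1 2 2)).div_const _

theorem _root_.ContDiffAt.warp {f : E → Mat3} (hf : ContDiffAt ℝ n f x) (A : Mat3) {k : ℝ} (w : Vec3)
    (hlt : (k * AttitudeObserver.UA A (f x)) ^ 2 < 1) :
    ContDiffAt ℝ n (fun y => rodrigues (2 * Real.arcsin (k * AttitudeObserver.UA A (f y))) w) x ∧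
      ContDiffAt ℝ n (fun y => warp A k w (f y)) x := by
  have h1 : ContDiffAt ℝ n (fun y => 2 * Real.arcsin (k * AttitudeObserver.UA A (f y))) x := by
    refine contDiffAt_const.mul ?_
    have h2 := contDiffAt_const (c := k) |>.mul (hf.UA A)
    have h3 : ContDiffAt ℝ n Real.arcsin (k * AttitudeObserver.UA A (f x)) :=
      Real.contDiffAt_arcsin (by intro h; rw [h] at hlt; norm_num at hlt)
        (by intro h; rw [h] at hlt; norm_num at hlt)
    exact ContDiffAt.comp (g := Real.arcsin) x h3 h2
  have h4 : ContDiffAt ℝ n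
      (fun y => rodrigues (2 * Real.arcsin (k * AttitudeObserver.UA A (f y))) w) x := by
    unfold rodrigues
    refine (contDiffAt_const.add ?_).add ?_
    · exact (Real.contDiff_sin.contDiffAt.comp x h1).smul contDiffAt_const
    · exact (contDiffAt_const.sub (Real.contDiff_cos.contDiffAt.comp x h1)).smul contDiffAt_const
  exact ⟨h4, hf.matrixMul h4⟩

end Smooth

/-! ### The gradient of the warped potential -/

/-- The vector `p` in `Θ = I + p wᵀ`. -/
noncomputable def thetaVec (A : Mat3) (k : ℝ) (X : Mat3) : Vec3 :=
  (k / (eigMax (barMat A) * √(1 - k ^ 2 * UA A X ^ 2))) • psi (A * X)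

/-- The vector `ψ(Xᵀ ∇Φ(X))` of the warped potential with the axis `w`. -/
noncomputable def gradVec (A : Mat3) (k : ℝ) (w : Vec3) (X : Mat3) : Vec3 :=
  (1 / (4 * eigMax (barMat A))) •
    (rodrigues (2 * Real.arcsin (k * UA A X)) w *ᵥ psi (A * warp A k w X) +
      (w ⬝ᵥ (rodrigues (2 * Real.arcsin (k * UA A X)) w *ᵥ psi (A * warp A k w X))) •
        thetaVec A k X)

theorem contDiffAt_gradVec (A : Mat3) {k : ℝ} (w : Vec3) {X : Mat3}
    (hlt : k ^ 2 * UA A X ^ 2 < 1) : ContDiffAt ℝ 1 (gradVec A k w) X := by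
  have hid : ContDiffAt ℝ 1 (fun Y : Mat3 => Y) X := contDiffAt_id
  obtain ⟨h1, h2⟩ := hid.warp A (k := k) w (by rwa [mul_pow])
  have h3 : ContDiffAt ℝ 1 (fun Y : Mat3 => rodrigues (2 * Real.arcsin (k * UA A Y)) w *ᵥ
      psi (A * warp A k w Y)) X := h1.matrixMulVec (contDiffAt_const.matrixMul h2).psi
  have h4 : ContDiffAt ℝ 1 (thetaVec A k) X := by
    by_cases h0 : eigMax (barMat A) = 0
    · have : thetaVec A k = fun _ => 0 := by
        ext Y; simp [thetaVec, h0]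
      rw [this]; exact contDiffAt_const
    · have h5 : ContDiffAt ℝ 1 (fun Y : Mat3 => psi (A * Y)) X :=
        (contDiffAt_const.matrixMul hid).psi
      have h6 : ContDiffAt ℝ 1 (fun Y : Mat3 =>
          k / (eigMax (barMat A) * √(1 - k ^ 2 * UA A Y ^ 2))) X := by
        refine contDiffAt_const.div (contDiffAt_const.mul ?_)
          (mul_ne_zero h0 (Real.sqrt_pos.2 (by linarith)).ne')
        have : ContDiffAt ℝ 1 (fun Y => 1 - k ^ 2 * UA A Y ^ 2) X :=
          contDiffAt_const.sub (contDiffAt_const.mul ((hid.UA A).pow 2))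
        exact (Real.contDiffAt_sqrt (by linarith)).comp X this
      have h7 := h6.smul h5
      exact h7
  have h5 : ContDiffAt ℝ 1 (fun Y : Mat3 => w ⬝ᵥ (rodrigues (2 * Real.arcsin (k * UA A Y)) w *ᵥ
      psi (A * warp A k w Y))) X := contDiffAt_const.dotVec h3
  have h6 : ContDiffAt ℝ 1 (fun _ : Mat3 => 1 / (4 * eigMax (barMat A))) X := contDiffAt_const
  exact h6.smul (h3.add (h5.smul h4))

/-- The right-hand side is the derivative of the rotation in its angle, so the turning of the warp
contributes the trace of A Γ [w]_×. -/
theorem rodrigues_mul_skew (θ : ℝ) {u : Vec3} (hu : sqNorm u = 1) :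
    rodrigues θ u * skew u = Real.cos θ • skew u + Real.sin θ • (skew u * skew u) := by
  rw [rodrigues, Matrix.add_mul, Matrix.add_mul, Matrix.one_mul, Matrix.smul_mul, Matrix.smul_mul,
    skew_cube, hu, one_smul]
  module

theorem rodrigues_mulVec_axis (θ : ℝ) (u : Vec3) : rodrigues θ u *ᵥ u = u := by
  have h : skew u *ᵥ u = 0 := by rw [skew_mulVec, cross_self]
  rw [rodrigues, add_mulVec, add_mulVec, one_mulVec, smul_mulVec, smul_mulVec, ← mulVec_mulVec, h]
  simp

theorem UA_affine (A X : Mat3) : UA A X = (A.trace - (A * X).trace) / (4 * eigMax (barMat A)) := by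
  rw [UA, Matrix.mul_sub, Matrix.mul_one, trace_sub]

/-- Differentiability comes from smoothness of the warp, so only directional derivatives need
computing. They have two parts: the motion of X with the warp frozen, giving 𝓡 ψ(A Γ), and the
change of the warping angle, giving the rank-one correction. The factor 2 is the ratio of tr([g]_×ᵀ
[ω]_×) to g·ω. -/
theorem hasFDerivAt_warped (A : Mat3) {k : ℝ} {w : Vec3} (hw : sqNorm w = 1) {X : Mat3}
    (hlt : k ^ 2 * UA A X ^ 2 < 1) :
    ∃ D : Mat3 →L[ℝ] ℝ, HasFDerivAt (fun Y => UA A (warp A k w Y)) D X ∧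
      ∀ ω, D (X * skew ω) = 2 * (gradVec A k w X ⬝ᵥ ω) := by
  have hid : ContDiffAt ℝ 1 (fun Y : Mat3 => Y) X := contDiffAt_id
  have hlt' : (k * UA A X) ^ 2 < 1 := by rwa [mul_pow]
  have hcd := (hid.warp A (k := k) w hlt').2.UA A
  obtain ⟨D, hD⟩ : ∃ D : Mat3 →L[ℝ] ℝ, HasFDerivAt (fun Y => UA A (warp A k w Y)) D X :=
    ⟨_, (hcd.differentiableAt one_ne_zero).hasFDerivAt⟩
  refine ⟨D, hD, fun ω => ?_⟩
  set H := X * skew ω with hH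
  set lm := eigMax (barMat A) with hlm
  set S := skew w with hS
  have hline : HasDerivAt (fun t : ℝ => X + t • H) H 0 := by
    have : HasDerivAt (fun t : ℝ => t • H) H 0 := by
      have h := (hasDerivAt_id (0 : ℝ)).smul_const H
      rw [one_smul] at h
      exact h
    exact this.const_add X
  have hD0 : HasFDerivAt (fun Y => UA A (warp A k w Y)) D (X + (0 : ℝ) • H) := by
    rw [zero_smul, add_zero]; exact hD
  have hcomp : HasDerivAt (fun t : ℝ => UA A (warp A k w (X + t • H))) (D H) 0 :=
    HasFDerivAt.comp_hasDerivAt (l := fun Y => UA A (warp A k w Y)) (0 : ℝ) hD0 hline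
  -- U_A is affine on the space of all matrices, so the warped potential along this line is
  -- explicit, although the line leaves SO(3).
  have hU : ∀ t : ℝ, UA A (X + t • H) = UA A X + t * (-(A * H).trace / (4 * lm)) := by
    intro t
    rw [UA_affine, UA_affine, Matrix.mul_add, Matrix.mul_smul, trace_add, trace_smul, smul_eq_mul]
    ring
  have hfun : ∀ t : ℝ, UA A (warp A k w (X + t • H)) =
      (A.trace - ((A * X).trace + t * (A * H).trace +
        Real.sin (2 * Real.arcsin (k * (UA A X + t * (-(A * H).trace / (4 * lm))))) *
          ((A * X * S).trace + t * (A * H * S).trace) +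
        (1 - Real.cos (2 * Real.arcsin (k * (UA A X + t * (-(A * H).trace / (4 * lm)))))) *
          ((A * X * (S * S)).trace + t * (A * H * (S * S)).trace))) / (4 * lm) := by
    intro t
    rw [UA_affine, warp, hU, rodrigues, ← hS]
    congr 2
    rw [← Matrix.mul_assoc, Matrix.mul_add A X, Matrix.mul_smul, Matrix.mul_add, Matrix.mul_add,
      Matrix.mul_one, Matrix.mul_smul, Matrix.mul_smul, Matrix.add_mul, Matrix.add_mul,
      Matrix.smul_mul, Matrix.smul_mul]
    simp only [trace_add, trace_smul, smul_eq_mul]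
  set θ' := k * (psi (A * X) ⬝ᵥ ω) / (lm * √(1 - k ^ 2 * UA A X ^ 2)) with hθ'
  have hth : HasDerivAt (fun t : ℝ => 2 * Real.arcsin (k * (UA A X + t * (-(A * H).trace / (4 * lm)))))
      θ' 0 := by
    have h1 : HasDerivAt (fun t : ℝ => k * (UA A X + t * (-(A * H).trace / (4 * lm))))
        (k * (-(A * H).trace / (4 * lm))) 0 := by
      have := (((hasDerivAt_id (0 : ℝ)).mul_const (-(A * H).trace / (4 * lm))).const_add
        (UA A X)).const_mul k
      simpa using this
    have h2 : HasDerivAt Real.arcsin (1 / √(1 - (k * UA A X) ^ 2))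
        (k * (UA A X + 0 * (-(A * H).trace / (4 * lm)))) := by
      rw [zero_mul, add_zero]
      exact Real.hasDerivAt_arcsin (by intro h; rw [h] at hlt'; norm_num at hlt')
        (by intro h; rw [h] at hlt'; norm_num at hlt')
    have h3 := (h2.comp (0 : ℝ) h1).const_mul 2
    refine h3.congr_deriv ?_
    rw [hθ', hH, ← Matrix.mul_assoc, trace_mul_skew, mul_pow, mul_comm lm, ← div_div, ← mul_div]
    by_cases h0 : lm = 0
    · simp [h0]
    · field_simp
      ring
  set θ := 2 * Real.arcsin (k * UA A X) with hθ
  have hex : HasDerivAt (fun t : ℝ => UA A (warp A k w (X + t • H)))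
      (-((A * H).trace + (Real.cos θ * θ' * (A * X * S).trace + Real.sin θ * (A * H * S).trace) +
        (Real.sin θ * θ' * (A * X * (S * S)).trace + (1 - Real.cos θ) * (A * H * (S * S)).trace))
        / (4 * lm)) 0 := by
    simp_rw [hfun]
    have lin : ∀ a b : ℝ, HasDerivAt (fun t : ℝ => a + t * b) b 0 := by
      intro a b
      simpa using ((hasDerivAt_id (0 : ℝ)).mul_const b).const_add a
    have hs := hth.sin.mul (lin (A * X * S).trace (A * H * S).trace)
    have hc := (hth.cos.const_sub 1).mul (lin (A * X * (S * S)).trace (A * H * (S * S)).trace)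
    have := ((((lin (A * X).trace (A * H).trace).add hs).add hc).const_sub A.trace).div_const (4 * lm)
    refine this.congr_deriv ?_
    simp only [zero_mul, add_zero, ← hθ, neg_neg, neg_mul]
  have heq := hcomp.unique hex
  have hrod := rodrigues_mem_SO3 θ hw
  have e1 : (A * H).trace + Real.sin θ * (A * H * S).trace +
      (1 - Real.cos θ) * (A * H * (S * S)).trace = (A * H * rodrigues θ w).trace := by
    rw [rodrigues, Matrix.mul_add, Matrix.mul_add, Matrix.mul_one, Matrix.mul_smul,
      Matrix.mul_smul, trace_add, trace_add, trace_smul, trace_smul, smul_eq_mul, smul_eq_mul]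
  have e2 : Real.cos θ * (A * X * S).trace + Real.sin θ * (A * X * (S * S)).trace =
      -2 * (psi (A * warp A k w X) ⬝ᵥ w) := by
    have : A * (X * rodrigues θ w) * S = A * X * (Real.cos θ • S + Real.sin θ • (S * S)) := by
      rw [← rodrigues_mul_skew θ hw, ← Matrix.mul_assoc, Matrix.mul_assoc (A * X)]
    rw [← trace_mul_skew, warp, ← hθ, this, Matrix.mul_add, Matrix.mul_smul,
      Matrix.mul_smul, trace_add, trace_smul, trace_smul, smul_eq_mul, smul_eq_mul]
  have e3 : (A * H * rodrigues θ w).trace =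
      -2 * ((rodrigues θ w *ᵥ psi (A * warp A k w X)) ⬝ᵥ ω) := by
    rw [trace_mul_comm, hH, ← Matrix.mul_assoc, ← Matrix.mul_assoc, trace_mul_skew,
      ← psi_conj_SO3 hrod, warp, ← hθ]
    congr 3
    rw [Matrix.mul_assoc, Matrix.mul_assoc, Matrix.mul_assoc, Matrix.mul_assoc,
      SO3_mul_transpose hrod, Matrix.mul_one]
  have e4 : psi (A * warp A k w X) ⬝ᵥ w = w ⬝ᵥ (rodrigues θ w *ᵥ psi (A * warp A k w X)) := by
    rw [dot_mulVec_eq, rodrigues_transpose, rodrigues_mulVec_axis, dotProduct_comm]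
  rw [heq, gradVec, ← hθ, ← e4]
  rw [smul_dotProduct, add_dotProduct, smul_dotProduct, thetaVec, smul_dotProduct]
  simp only [smul_eq_mul]
  have e5 : k / (lm * √(1 - k ^ 2 * UA A X ^ 2)) * (psi (A * X) ⬝ᵥ ω) = θ' := by
    rw [hθ']; ring
  rw [e5]
  have e6 : (A * H).trace + (Real.cos θ * θ' * (A * X * S).trace + Real.sin θ * (A * H * S).trace) +
        (Real.sin θ * θ' * (A * X * (S * S)).trace + (1 - Real.cos θ) * (A * H * (S * S)).trace) =
      -2 * ((rodrigues θ w *ᵥ psi (A * warp A k w X)) ⬝ᵥ ω) +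
        θ' * (-2 * (psi (A * warp A k w X) ⬝ᵥ w)) := by
    rw [← e2, ← e3, ← e1]; ring
  rw [e6, ← hlm]
  ring

/-! ### Gradients on `SO(3)` from Fréchet derivatives -/

theorem norm_le_frobNorm (M : Mat3) : ‖M‖ ≤ frobNorm M := by
  refine (Matrix.norm_le_iff (Real.sqrt_nonneg (frobInner M M))).2 fun i j => ?_
  apply Real.abs_le_sqrt
  simp only [frobInner, Matrix.trace, Fin.sum_univ_three, mul_eq, diag_apply, transpose_apply]
  fin_cases i <;> fin_cases j <;> simp <;>
    nlinarith [sq_nonneg (M 0 0), sq_nonneg (M 0 1), sq_nonneg (M 0 2), sq_nonneg (M 1 0),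
      sq_nonneg (M 1 1), sq_nonneg (M 1 2), sq_nonneg (M 2 0), sq_nonneg (M 2 1),
      sq_nonneg (M 2 2)]

theorem norm_mul_le_three (M N : Mat3) : ‖M * N‖ ≤ 3 * (‖M‖ * ‖N‖) := by
  rw [Matrix.norm_le_iff (by positivity)]
  intro i j
  rw [mul_eq]
  have h : ∀ l, |M i l * N l j| ≤ ‖M‖ * ‖N‖ := fun l => by
    rw [abs_mul]
    exact mul_le_mul (Matrix.norm_entry_le_entrywise_sup_norm M)
      (Matrix.norm_entry_le_entrywise_sup_norm N) (abs_nonneg _) (norm_nonneg _)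
  calc ‖M i 0 * N 0 j + M i 1 * N 1 j + M i 2 * N 2 j‖
      ≤ |M i 0 * N 0 j| + |M i 1 * N 1 j| + |M i 2 * N 2 j| := norm_add₃_le
    _ ≤ 3 * (‖M‖ * ‖N‖) := by linarith [h 0, h 1, h 2]

theorem frobInner_SO3_mul {X : Mat3} (hX : X ∈ SO3) (M N : Mat3) :
    frobInner (X * M) (X * N) = frobInner M N := by
  rw [frobInner, frobInner, transpose_mul, Matrix.mul_assoc, ← Matrix.mul_assoc Xᵀ,
    SO3_transpose_mul hX, Matrix.one_mul]

theorem frobInner_skew_left (g : Vec3) (M : Mat3) : frobInner (skew g) M = 2 * (g ⬝ᵥ psi M) := by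
  rw [frobInner, skew_transpose, trace_mul_comm, ← skew_neg, trace_mul_skew, dotProduct_neg,
    dotProduct_comm]
  ring

theorem exists_abs_le_norm (D : Mat3 →ₗ[ℝ] ℝ) : ∃ C : ℝ, 0 ≤ C ∧ ∀ M, |D M| ≤ C * ‖M‖ := by
  refine ⟨∑ i, ∑ j, |D (Matrix.single i j 1)|, by positivity, fun M => ?_⟩
  have h : D M = ∑ i, ∑ j, M i j * D (Matrix.single i j 1) := by
    conv_lhs => rw [Matrix.matrix_eq_sum_single M]
    rw [map_sum]
    refine Finset.sum_congr rfl fun i _ => ?_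
    rw [map_sum]
    refine Finset.sum_congr rfl fun j _ => ?_
    rw [← smul_eq_mul, ← map_smul, Matrix.smul_single, smul_eq_mul, mul_one]
  rw [h, Finset.sum_mul]
  refine (Finset.abs_sum_le_sum_abs _ _).trans (Finset.sum_le_sum fun i _ => ?_)
  rw [Finset.sum_mul]
  refine (Finset.abs_sum_le_sum_abs _ _).trans (Finset.sum_le_sum fun j _ => ?_)
  rw [abs_mul, mul_comm]
  exact mul_le_mul_of_nonneg_left (Matrix.norm_entry_le_entrywise_sup_norm M) (abs_nonneg _)

/-- For Y in SO(3) the increment Y - X is a tangent vector plus a term quadratic in Y - X, so the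
derivative on matrices and the tangential gradient agree to first order. -/
theorem isGradSO3_of_hasFDerivAt {f : Mat3 → ℝ} {X : Mat3} (hX : X ∈ SO3) {D : Mat3 →L[ℝ] ℝ}
    (hf : HasFDerivAt f D X) {g : Vec3} (hg : ∀ ω, D (X * skew ω) = 2 * (g ⬝ᵥ ω)) :
    IsGradSO3 f X (X * skew g) := by
  refine ⟨⟨skew g, skew_transpose g, rfl⟩, ?_⟩
  rw [Asymptotics.isLittleO_iff]
  intro c hc
  have key : ∀ Y ∈ SO3, D (Y - X) - frobInner (X * skew g) (Y - X) =
      -(1 / 2) * D (X * ((Y - X)ᵀ * (Y - X))) := by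
    intro Y hY
    -- The symmetric part of I - Xᵀ Y is half of (Y - X)ᵀ (Y - X), because both matrices are
    -- orthogonal.
    have e1 : Y - X = X * skew (psi (Xᵀ * Y)) +
        (-(1 / 2) : ℝ) • (X * ((Y - X)ᵀ * (Y - X))) := by
      have s1 : skew (psi (Xᵀ * Y)) = (1 / 2 : ℝ) • (Xᵀ * Y - Yᵀ * X) := by
        have : Yᵀ * X = (Xᵀ * Y)ᵀ := by rw [transpose_mul, transpose_transpose]
        rw [this]
        generalize Xᵀ * Y = M
        ext i j
        obtain ⟨h0, h1, h2⟩ := psi_apply M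
        fin_cases i <;> fin_cases j <;> simp [skew, h0, h1, h2] <;> ring
      have s2 : (Y - X)ᵀ * (Y - X) = (2 : ℝ) • (1 : Mat3) - Yᵀ * X - Xᵀ * Y := by
        rw [transpose_sub, Matrix.sub_mul, Matrix.mul_sub, Matrix.mul_sub, SO3_transpose_mul hX,
          SO3_transpose_mul hY]
        module
      have s3 : X * (Xᵀ * Y) = Y := by
        rw [← Matrix.mul_assoc, SO3_mul_transpose hX, Matrix.one_mul]
      rw [s1, s2, Matrix.mul_smul, Matrix.mul_sub, Matrix.mul_sub, Matrix.mul_sub, Matrix.mul_smul,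
        s3, Matrix.mul_one]
      module
    have e2 : frobInner (X * skew g) (Y - X) = 2 * (g ⬝ᵥ psi (Xᵀ * Y)) := by
      have : Y - X = X * (Xᵀ * Y + (-1 : ℝ) • 1) := by
        rw [Matrix.mul_add, ← Matrix.mul_assoc, SO3_mul_transpose hX, Matrix.one_mul,
          Matrix.mul_smul, Matrix.mul_one]
        module
      have h1 : psi 1 = 0 := by ext i; fin_cases i <;> simp [psi]
      rw [this, frobInner_SO3_mul hX, frobInner_skew_left, psi_add, psi_smul, h1, smul_zero,
        add_zero]
    rw [e2, ← hg]
    conv_lhs => rw [e1]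
    rw [map_add, map_smul, smul_eq_mul]
    ring
  have hlo := (Asymptotics.isLittleO_iff.1 hf.isLittleO (half_pos hc)).filter_mono
    (nhdsWithin_le_nhds (s := SO3))
  obtain ⟨C, hC0, hCD⟩ := exists_abs_le_norm D
  have hC : 0 ≤ C * (9 * ‖X‖) := by positivity
  have hball : ∀ᶠ Y in 𝓝[SO3] X, ‖Y - X‖ < c / (C * (9 * ‖X‖) + 1) := by
    apply mem_nhdsWithin_of_mem_nhds
    have : (fun Y : Mat3 => ‖Y - X‖) ⁻¹' Iio (c / (C * (9 * ‖X‖) + 1)) ∈ 𝓝 X := by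
      apply ContinuousAt.preimage_mem_nhds
      · exact (continuous_norm.comp (continuous_id.sub continuous_const)).continuousAt
      · apply Iio_mem_nhds
        rw [sub_self, norm_zero]
        positivity
    exact this
  filter_upwards [hlo, hball, self_mem_nhdsWithin] with Y h1 h2 hY
  have h3 := key Y hY
  have h4 : |D (X * ((Y - X)ᵀ * (Y - X)))| ≤ C * (9 * ‖X‖) * (‖Y - X‖ * ‖Y - X‖) := by
    refine (hCD _).trans ?_
    rw [mul_assoc]
    refine mul_le_mul_of_nonneg_left ?_ hC0
    refine (norm_mul_le_three _ _).trans ?_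
    have := norm_mul_le_three (Y - X)ᵀ (Y - X)
    rw [Matrix.norm_transpose] at this
    nlinarith [norm_nonneg X]
  have h5 : C * (9 * ‖X‖) * ‖Y - X‖ ≤ c := by
    rw [lt_div_iff₀ (by positivity)] at h2
    nlinarith [norm_nonneg (Y - X)]
  have h6 := norm_le_frobNorm (Y - X)
  have h7 : ‖frobNorm (Y - X)‖ = frobNorm (Y - X) := Real.norm_of_nonneg (Real.sqrt_nonneg _)
  rw [h7]
  have h8 : |D (Y - X) - frobInner (X * skew g) (Y - X)| ≤ c / 2 * ‖Y - X‖ := by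
    rw [h3, abs_mul, abs_neg, abs_of_pos (by norm_num : (0 : ℝ) < 1 / 2)]
    nlinarith [norm_nonneg (Y - X)]
  calc ‖f Y - f X - frobInner (X * skew g) (Y - X)‖
      = ‖(f Y - f X - D (Y - X)) + (D (Y - X) - frobInner (X * skew g) (Y - X))‖ := by
        congr 1; ring
    _ ≤ c / 2 * ‖Y - X‖ + c / 2 * ‖Y - X‖ := (norm_add_le _ _).trans (add_le_add h1 h8)
    _ = c * ‖Y - X‖ := by ring
    _ ≤ c * frobNorm (Y - X) := mul_le_mul_of_nonneg_left h6 hc.le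

theorem psi_rodrigues (θ : ℝ) (e : Vec3) : psi (rodrigues θ e) = Real.sin θ • e := by
  ext i
  obtain ⟨h0, h1, h2⟩ := psi_apply (rodrigues θ e)
  fin_cases i
  · change psi (rodrigues θ e) 0 = _
    rw [h0]; simp [rodrigues, skew]; ring
  · change psi (rodrigues θ e) 1 = _
    rw [h1]; simp [rodrigues, skew]; ring
  · change psi (rodrigues θ e) 2 = _
    rw [h2]; simp [rodrigues, skew]; ring

/-- Two gradients differ by X [d]_×, whose pairing with Y - X would be o(‖Y - X‖). Along rotations
about d itself the pairing is of first order, so d = 0. -/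
theorem IsGradSO3.unique {f : Mat3 → ℝ} {X G G' : Mat3} (hX : X ∈ SO3) (h : IsGradSO3 f X G)
    (h' : IsGradSO3 f X G') : G = G' := by
  obtain ⟨⟨Ω, hΩ, rfl⟩, hG⟩ := h
  obtain ⟨⟨Ω', hΩ', rfl⟩, hG'⟩ := h'
  rw [eq_skew_of_transpose_eq_neg hΩ, eq_skew_of_transpose_eq_neg hΩ'] at *
  set g := psi Ω
  set g' := psi Ω'
  suffices g - g' = 0 by rw [sub_eq_zero.1 this]
  by_contra hd
  set d := g - g' with hd_def
  have hd0 : 0 < vnorm d := by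
    refine lt_of_le_of_ne (vnorm_nonneg d) fun h => hd ?_
    rw [← sqNorm_eq_zero, ← vnorm_sq, ← h]; ring
  set e := (vnorm d)⁻¹ • d with he
  have hde : d ⬝ᵥ e = vnorm d := by
    rw [he, dotProduct_smul, ← sqNorm, ← vnorm_sq, smul_eq_mul]
    field_simp
  have heu : sqNorm e = 1 := by
    rw [he, sqNorm_smul, ← vnorm_sq]; field_simp
  have hsub := hG'.sub hG
  have hsub' : (fun Y => frobInner (X * skew d) (Y - X)) =o[𝓝[SO3] X]
      (fun Y => frobNorm (Y - X)) := by
    refine hsub.congr_left fun Y => ?_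
    have : X * skew d = X * skew g - X * skew g' := by
      rw [hd_def, sub_eq_add_neg, skew_add, skew_neg, Matrix.mul_add, Matrix.mul_neg, sub_eq_add_neg]
    rw [this]
    simp only [frobInner, transpose_sub, Matrix.sub_mul, trace_sub]
    ring
  have hcurve : Tendsto (fun t : ℝ => X * rodrigues (2 * t) e) (𝓝[≠] 0) (𝓝[SO3] X) := by
    apply tendsto_nhdsWithin_of_tendsto_nhds_of_eventually_within
    · have hc : Continuous fun t : ℝ => X * rodrigues (2 * t) e :=
        continuous_const.matrix_mul ((continuous_rodrigues e).comp (by fun_prop))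
      have := (hc.tendsto 0).mono_left (nhdsWithin_le_nhds (s := {0}ᶜ))
      simpa [rodrigues_zero] using this
    · exact Eventually.of_forall fun t => SO3_mul hX (rodrigues_mem_SO3 _ heu)
  have h1 := hcurve.eventually (Asymptotics.isLittleO_iff.1 hsub' hd0)
  -- The squared pairing is 16 sin² t cos² t |d|² and the squared distance 8 sin² t; with cos t >
  -- 3/4 the first exceeds 9 sin² t |d|², contradicting the little-o bound with constant |d|.
  have h2 : ∀ᶠ t in 𝓝[≠] (0 : ℝ), 3 / 4 < Real.cos t := by
    apply mem_nhdsWithin_of_mem_nhds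
    apply Real.continuous_cos.continuousAt.preimage_mem_nhds
    apply Ioi_mem_nhds
    rw [Real.cos_zero]; norm_num
  have h3 : ∀ᶠ t in 𝓝[≠] (0 : ℝ), 0 < Real.sin t ^ 2 := by
    have hb : Ioo (-1 : ℝ) 1 ∈ 𝓝 (0 : ℝ) := Ioo_mem_nhds (by norm_num) (by norm_num)
    filter_upwards [mem_nhdsWithin_of_mem_nhds hb, self_mem_nhdsWithin] with t ht ht0
    have hpi := Real.pi_gt_three
    have : Real.sin t ≠ 0 := by
      intro h0
      exact ht0 ((Real.sin_eq_zero_iff_of_lt_of_lt (by linarith [ht.1]) (by linarith [ht.2])).1 h0)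
    positivity
  obtain ⟨t, ⟨h1, h2⟩, h3⟩ := ((h1.and h2).and h3).exists
  have hYX : X * rodrigues (2 * t) e - X = X * (rodrigues (2 * t) e + (-1 : ℝ) • 1) := by
    rw [Matrix.mul_add, Matrix.mul_smul, Matrix.mul_one]; module
  have hone : psi 1 = 0 := by ext i; fin_cases i <;> simp [psi]
  have e1 : frobInner (X * skew d) (X * rodrigues (2 * t) e - X) = 2 * (Real.sin (2 * t) * vnorm d) := by
    rw [hYX, frobInner_SO3_mul hX, frobInner_skew_left, psi_add, psi_smul, hone, smul_zero, add_zero,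
      psi_rodrigues, dotProduct_smul, hde, smul_eq_mul]
  have e2 : frobNorm (X * rodrigues (2 * t) e - X) ^ 2 = 8 * Real.sin t ^ 2 := by
    have ha := attDist_rot_sq (η := Real.cos t) (ε := Real.sin t • e) (by
      rw [sqNorm_smul, heu, mul_one, Real.cos_sq_add_sin_sq])
    rw [← rodrigues_two_mul t heu, attDist, Real.sq_sqrt (by positivity), sqNorm_smul, heu,
      mul_one] at ha
    have : frobNorm (X * rodrigues (2 * t) e - X) = frobNorm (1 - rodrigues (2 * t) e) := by
      rw [frobNorm, frobNorm, hYX, frobInner_SO3_mul hX]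
      have : rodrigues (2 * t) e + (-1 : ℝ) • 1 = -(1 - rodrigues (2 * t) e) := by module
      rw [this]
      have hn : ∀ M : Mat3, frobInner (-M) (-M) = frobInner M M := fun M => by
        rw [frobInner, transpose_neg, neg_mul_neg, frobInner]
      rw [hn]
    rw [this]; linarith
  rw [e1, Real.norm_eq_abs, Real.norm_eq_abs,
    abs_of_nonneg (show 0 ≤ frobNorm (X * rodrigues (2 * t) e - X) from Real.sqrt_nonneg _),
    Real.sin_two_mul] at h1
  have h4 : (2 * (2 * Real.sin t * Real.cos t * vnorm d)) ^ 2 ≤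
      (vnorm d * frobNorm (X * rodrigues (2 * t) e - X)) ^ 2 := by
    rw [← sq_abs (2 * _)]
    exact pow_le_pow_left₀ (abs_nonneg _) h1 2
  rw [mul_pow (vnorm d), e2] at h4
  have h5 : 0 < vnorm d ^ 2 * Real.sin t ^ 2 := by positivity
  have h6 : 9 / 16 < Real.cos t ^ 2 := by nlinarith
  nlinarith

theorem gradSO3_eq {f : Mat3 → ℝ} {X : Mat3} (hX : X ∈ SO3) {G : Mat3} (h : IsGradSO3 f X G) :
    gradSO3 f X = G := by
  have hd : DiffAtSO3 f X := ⟨G, h⟩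
  rw [gradSO3, dif_pos hd]
  exact hd.choose_spec.unique hX h

theorem beta_eq {Φ : Mat3 → ℕ → ℝ} {Rhat X : Mat3} {q : ℕ} (hX : X ∈ SO3) {g : Vec3}
    (h : IsGradSO3 (fun Y => Φ Y q) X (X * skew g)) : beta Φ Rhat X q = Rhatᵀ *ᵥ g := by
  rw [beta, gradSO3_eq hX h, ← Matrix.mul_assoc, SO3_transpose_mul hX, Matrix.one_mul, psi_skew]

/-! ### Evaluation from vector measurements -/

section Measurements

variable {n : ℕ} (ρ : Fin n → ℝ) (a : Fin n → Vec3)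

theorem trace_weightMat_mul (M : Mat3) :
    (weightMat ρ a * M).trace = ∑ i, ρ i * (a i ⬝ᵥ (M *ᵥ a i)) := by
  rw [weightMat, Finset.sum_mul, trace_sum]
  refine Finset.sum_congr rfl fun i _ => ?_
  rw [Matrix.smul_mul, trace_smul, smul_eq_mul]
  congr 1
  simp only [Matrix.trace, Fin.sum_univ_three, diag_apply, mul_eq, vecMulVec_apply, dot_eq, mulVec_eq]
  ring

/-- Rotations preserve the lengths of the a_i, so each summand is twice a_iᵀ (I - R S) a_i, and the
weighted sum is a trace against A. -/
theorem sum_sqNorm_sub {R S : Mat3} (hR : R ∈ SO3) (hS : S ∈ SO3) :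
    ∑ i, ρ i * sqNorm (Rᵀ *ᵥ a i - S *ᵥ a i) = 2 * (weightMat ρ a * (1 - R * S)).trace := by
  rw [trace_weightMat_mul, Finset.mul_sum]
  refine Finset.sum_congr rfl fun i _ => ?_
  rw [sub_eq_add_neg, sqNorm_add, sqNorm_neg, SO3_sqNorm (SO3_transpose hR), SO3_sqNorm hS,
    dotProduct_neg, sub_mulVec, one_mulVec, dotProduct_sub, ← mulVec_mulVec, dot_mulVec_eq R,
    ← sqNorm]
  ring

/-- The skew matrix of x × y is y xᵀ - x yᵀ, so the sum is twice ψ(S A R); writing S A R as the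
conjugate of A R S by S moves S outside ψ. -/
theorem sum_cross {R S : Mat3} (hS : S ∈ SO3) :
    ∑ i, ρ i • crossProduct (Rᵀ *ᵥ a i) (S *ᵥ a i) =
      (2 : ℝ) • (S *ᵥ psi (weightMat ρ a * (R * S))) := by
  have hsum : ∀ f : Fin n → Mat3, psi (∑ i, f i) = ∑ i, psi (f i) := fun f =>
    map_sum (AddMonoidHom.mk' psi psi_add) f Finset.univ
  have h1 : S * (weightMat ρ a * (R * S)) * Sᵀ = S * weightMat ρ a * R := by
    rw [Matrix.mul_assoc, Matrix.mul_assoc, Matrix.mul_assoc R, SO3_mul_transpose hS,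
      Matrix.mul_one, Matrix.mul_assoc]
  rw [← psi_conj_SO3 hS, h1, weightMat, Matrix.mul_sum, Finset.sum_mul, hsum, Finset.smul_sum]
  refine Finset.sum_congr rfl fun i _ => ?_
  rw [Matrix.mul_smul, Matrix.smul_mul, psi_smul, smul_comm]
  congr 1
  rw [← psi_skew (crossProduct _ _), skew_cross, ← psi_smul]
  have h2 : vecMulVec (S *ᵥ a i) (Rᵀ *ᵥ a i) = S * vecMulVec (a i) (a i) * R := by
    rw [mul_vecMulVec, vecMulVec_mul, mulVec_transpose]
  have h3 : vecMulVec (Rᵀ *ᵥ a i) (S *ᵥ a i) = (S * vecMulVec (a i) (a i) * R)ᵀ := by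
    rw [← h2, transpose_vecMulVec]
  rw [h2, h3]
  generalize S * vecMulVec (a i) (a i) * R = N
  ext j
  fin_cases j <;> simp [psi] <;> ring

end Measurements

section Measurements

variable {n : ℕ} (ρ : Fin n → ℝ) (a : Fin n → Vec3)

theorem varth_bodyMeas {R Rhat : Mat3} (hR : R ∈ SO3) (hRh : Rhat ∈ SO3) :
    varth ρ a (bodyMeas a R) Rhat = UA (weightMat ρ a) (R * Rhatᵀ) := by
  simp only [varth, bodyMeas]
  rw [sum_sqNorm_sub ρ a hR (SO3_transpose hRh), UA, lmax]
  rw [mul_div_mul_comm]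
  conv_lhs => rw [← mul_div_mul_comm, show (8 : ℝ) * eigMax (barMat (weightMat ρ a)) =
    2 * (4 * eigMax (barMat (weightMat ρ a))) by ring]
  rw [mul_div_mul_left _ _ two_ne_zero]

theorem RBar_bodyMeas {R Rhat : Mat3} (hR : R ∈ SO3) (hRh : Rhat ∈ SO3) (k : ℝ) (ν : ℕ → Vec3)
    (q : ℕ) : RBar ρ a k ν (bodyMeas a R) Rhat q =
      rodrigues (2 * Real.arcsin (k * UA (weightMat ρ a) (R * Rhatᵀ))) (ν q) := by
  rw [RBar, varth_bodyMeas ρ a hR hRh]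

theorem PhiBar_bodyMeas {R Rhat : Mat3} (hR : R ∈ SO3) (hRh : Rhat ∈ SO3) (k : ℝ) {ν : ℕ → Vec3}
    {q : ℕ} (hν : sqNorm (ν q) = 1) : PhiBar ρ a k ν (bodyMeas a R) Rhat q =
      PhiU (weightMat ρ a) k ν (R * Rhatᵀ) q := by
  rw [PhiBar, RBar_bodyMeas ρ a hR hRh]
  simp only [bodyMeas, mulVec_mulVec]
  rw [sum_sqNorm_sub ρ a hR (SO3_mul (SO3_transpose hRh) (rodrigues_mem_SO3 _ hν)),
    PhiU, Gam, ← Matrix.mul_assoc, lmax]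
  generalize R * Rhatᵀ * rodrigues _ _ = Z
  rw [UA]
  by_cases h0 : eigMax (barMat (weightMat ρ a)) = 0
  · simp [h0]
  · field_simp; ring

/-- Both cross-product sums carry the factor 2 of `sum_cross`. These factors turn the coefficients
1/(8 λ_max) and k/(2 λ_max) of the measured expressions into 1/(4 λ_max) and k/λ_max in the
gradient. -/
theorem betaBar_bodyMeas {R Rhat : Mat3} (hR : R ∈ SO3) (hRh : Rhat ∈ SO3) (k : ℝ) {ν : ℕ → Vec3}
    {q : ℕ} (hν : sqNorm (ν q) = 1) : betaBar ρ a k ν (bodyMeas a R) Rhat q =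
      Rhatᵀ *ᵥ gradVec (weightMat ρ a) k (ν q) (R * Rhatᵀ) := by
  have hRt := SO3_transpose hRh
  have h1 : Rhat *ᵥ ∑ i, ρ i • crossProduct (bodyMeas a R i) (Rhatᵀ *ᵥ a i) =
      (2 : ℝ) • psi (weightMat ρ a * (R * Rhatᵀ)) := by
    simp only [bodyMeas]
    rw [sum_cross ρ a hRt, mulVec_smul, mulVec_mulVec, SO3_mul_transpose hRh, one_mulVec]
  have h2 : Rhat *ᵥ ∑ i, ρ i • crossProduct (bodyMeas a R i)
      (Rhatᵀ *ᵥ (RBar ρ a k ν (bodyMeas a R) Rhat q *ᵥ a i)) =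
      (2 : ℝ) • (rodrigues (2 * Real.arcsin (k * UA (weightMat ρ a) (R * Rhatᵀ))) (ν q) *ᵥ
        psi (weightMat ρ a * warp (weightMat ρ a) k (ν q) (R * Rhatᵀ))) := by
    rw [RBar_bodyMeas ρ a hR hRh]
    simp only [bodyMeas, mulVec_mulVec]
    rw [sum_cross ρ a (SO3_mul hRt (rodrigues_mem_SO3 _ hν)), mulVec_smul, mulVec_mulVec,
      ← Matrix.mul_assoc, SO3_mul_transpose hRh, Matrix.one_mul, warp, Matrix.mul_assoc R]
  rw [betaBar, h2, ThetaBar, h1, varth_bodyMeas ρ a hR hRh, gradVec, thetaVec, lmax]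
  have h3 : ∀ (c : ℝ) (x w z : Vec3),
      (1 + c • vecMulVec ((2 : ℝ) • x) w) *ᵥ ((2 : ℝ) • z) =
        (2 : ℝ) • (z + (w ⬝ᵥ z) • ((2 * c) • x)) := by
    intro c x w z
    rw [add_mulVec, one_mulVec]
    ext i
    simp only [mulVec_eq, dot_eq, Pi.add_apply, Pi.smul_apply, smul_eq_mul,
      Matrix.smul_apply, vecMulVec_apply]
    ring
  rw [h3, mulVec_smul, smul_smul, mulVec_smul]
  congr 1
  · by_cases h0 : eigMax (barMat (weightMat ρ a)) = 0
    · simp [h0]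
    · field_simp; norm_num
  · congr 4
    by_cases h0 : eigMax (barMat (weightMat ρ a)) = 0
    · simp [h0]
    · by_cases h4 : √(1 - k ^ 2 * UA (weightMat ρ a) (R * Rhatᵀ) ^ 2) = 0
      · simp [h4]
      · field_simp

end Measurements

/-! ### Bounds for the gradient -/

namespace SpectralFrame

variable {A : Mat3} {lam : Fin 3 → ℝ} {v : Fin 3 → Vec3} {u : Vec3} {k : ℝ}

/-- A bound below 1 makes Θ = I + p wᵀ invertible with uniform constants, so that warping creates no
new critical points. -/
theorem vnorm_thetaVec_le (h : SpectralFrame A lam v) (hk2 : k ^ 2 < 1 / 2) {X : Mat3}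
    (hX : X ∈ SO3) : vnorm (thetaVec A k X) ≤ 5 / 6 := by
  apply vnorm_le_of_sqNorm_le (by norm_num)
  have hL := h.sum_pos
  have hU0 := h.UA_nonneg hX
  have hU1 := h.UA_le_one hX
  have hlt := h.gain_mul_UA_sq_lt hk2 hX
  have hpsi := h.sqNorm_psi_le hX
  have hpos : 0 < 1 - k ^ 2 * UA A X ^ 2 := by linarith
  rw [thetaVec, sqNorm_smul, div_pow, mul_pow, Real.sq_sqrt hpos.le, h.eigMax_barMat,
    div_mul_eq_mul_div, div_le_iff₀ (by positivity)]
  calc k ^ 2 * sqNorm (psi (A * X))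
      ≤ k ^ 2 * ((lam 1 + lam 2) ^ 2 * (UA A X - UA A X ^ 2)) :=
        mul_le_mul_of_nonneg_left hpsi (sq_nonneg _)
    _ = (lam 1 + lam 2) ^ 2 * (k ^ 2 * (UA A X - UA A X ^ 2)) := by ring
    _ ≤ (lam 1 + lam 2) ^ 2 * ((1 - k ^ 2 * UA A X ^ 2) / 6) := by
        refine mul_le_mul_of_nonneg_left ?_ (sq_nonneg _)
        -- The claim is k² (6 U - 5 U²) ≤ 1. The bracket is largest at U = 3/5, with value 9/5, and
        -- k² < 1/2.
        nlinarith [sq_nonneg (UA A X - 3 / 5), sq_nonneg k,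
          mul_nonneg (sq_nonneg k) (sq_nonneg (UA A X - 3 / 5))]
    _ ≤ _ := by nlinarith [mul_nonneg (sq_nonneg (lam 1 + lam 2)) hpos.le]

/-- For z' = z + (w·z) p one has w·z' = (w·z)(1 + w·p) and 1 + w·p ≥ 1/6. This controls w·z, and
then z itself, by z': |z| ≤ 6 |z'|. The remaining factor is the normalization of `gradVec`. -/
theorem vnorm_gradVec_bounds (h : SpectralFrame A lam v) (hk2 : k ^ 2 < 1 / 2) {w : Vec3}
    (hw : sqNorm w = 1) {X : Mat3} (hX : X ∈ SO3) :
    vnorm (psi (A * warp A k w X)) ≤ 12 * (lam 1 + lam 2) * vnorm (gradVec A k w X) ∧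
      (lam 1 + lam 2) * vnorm (gradVec A k w X) ≤ vnorm (psi (A * warp A k w X)) := by
  have hL := h.sum_pos
  have hp := h.vnorm_thetaVec_le hk2 hX
  have hp0 := vnorm_nonneg (thetaVec A k X)
  have hrod := rodrigues_mem_SO3 (2 * Real.arcsin (k * UA A X)) hw
  rw [gradVec, h.eigMax_barMat, vnorm_smul,
    abs_of_pos (show 0 < 1 / (4 * ((lam 1 + lam 2) / 2)) by positivity),
    ← SO3_vnorm hrod (psi (A * warp A k w X))]
  set z := rodrigues (2 * Real.arcsin (k * UA A X)) w *ᵥ psi (A * warp A k w X)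
  set p := thetaVec A k X
  have hw1 : vnorm w = 1 := by rw [vnorm, hw, Real.sqrt_one]
  have hwz : |w ⬝ᵥ z| ≤ vnorm z := by
    have := abs_dot_le w z
    rwa [hw1, one_mul] at this
  have hwp : |w ⬝ᵥ p| ≤ 5 / 6 := by
    have := abs_dot_le w p
    rw [hw1, one_mul] at this
    linarith
  have hz0 := vnorm_nonneg z
  have hnp : vnorm ((w ⬝ᵥ z) • p) ≤ |w ⬝ᵥ z| * (5 / 6) := by
    rw [vnorm_smul]
    exact mul_le_mul_of_nonneg_left hp (abs_nonneg _)
  have hup : vnorm (z + (w ⬝ᵥ z) • p) ≤ 2 * vnorm z := by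
    have := vnorm_add_le z ((w ⬝ᵥ z) • p)
    linarith [abs_nonneg (w ⬝ᵥ z)]
  have hlow : vnorm z ≤ 6 * vnorm (z + (w ⬝ᵥ z) • p) := by
    have h1 : w ⬝ᵥ (z + (w ⬝ᵥ z) • p) = (w ⬝ᵥ z) * (1 + w ⬝ᵥ p) := by
      rw [dotProduct_add, dotProduct_smul, smul_eq_mul]; ring
    have h2 : |w ⬝ᵥ (z + (w ⬝ᵥ z) • p)| ≤ vnorm (z + (w ⬝ᵥ z) • p) := by
      have := abs_dot_le w (z + (w ⬝ᵥ z) • p)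
      rwa [hw1, one_mul] at this
    have h3 : |w ⬝ᵥ z| * (1 / 6) ≤ |w ⬝ᵥ (z + (w ⬝ᵥ z) • p)| := by
      rw [h1, abs_mul]
      refine mul_le_mul_of_nonneg_left ?_ (abs_nonneg _)
      refine le_trans ?_ (le_abs_self _)
      linarith [neg_le_of_abs_le hwp]
    have h4 := vnorm_sub_le (z + (w ⬝ᵥ z) • p) ((w ⬝ᵥ z) • p)
    rw [add_sub_cancel_right] at h4
    linarith
  have e1 : 12 * (lam 1 + lam 2) * (1 / (4 * ((lam 1 + lam 2) / 2)) *
      vnorm (z + (w ⬝ᵥ z) • p)) = 6 * vnorm (z + (w ⬝ᵥ z) • p) := by field_simp; ring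
  have e2 : (lam 1 + lam 2) * (1 / (4 * ((lam 1 + lam 2) / 2)) *
      vnorm (z + (w ⬝ᵥ z) • p)) = vnorm (z + (w ⬝ᵥ z) • p) / 2 := by field_simp; ring
  rw [e1, e2]
  exact ⟨hlow, by linarith⟩

theorem vnorm_gradVec_le (h : SpectralFrame A lam v) (hD : IsDesign A lam v u k) {X : Mat3}
    (hX : X ∈ SO3) (q : ℕ) : vnorm (gradVec A k (nuMap u q) X) ≤ 2 * attDist X := by
  have hw := sqNorm_nuMap hD.unit_u q
  have hk2 := h.gain_sq_lt hD.k_pos hD.k_lt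
  have hL := h.sum_pos
  have hΓ := warp_mem_SO3 (A := A) (k := k) hw hX
  have h1 := (h.vnorm_gradVec_bounds hk2 hw hX).2
  have h2 := h.sqNorm_psi_le hΓ
  have h3 : UA A (warp A k (nuMap u q) X) ≤ 4 * attDist X ^ 2 := (h.PhiU_bounds hD hX q).2
  have h4 : vnorm (psi (A * warp A k (nuMap u q) X)) ≤ (lam 1 + lam 2) * (2 * attDist X) := by
    apply vnorm_le_of_sqNorm_le (by have := attDist_nonneg X; positivity)
    refine h2.trans ?_
    rw [mul_pow]
    refine mul_le_mul_of_nonneg_left ?_ (sq_nonneg _)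
    nlinarith [sq_nonneg (UA A (warp A k (nuMap u q) X))]
  exact le_of_mul_le_mul_left (h1.trans h4) hL

end SpectralFrame

/-! ### Potentials suitable for the hybrid observer -/

/-- A hybrid potential `P` on `SO(3)` with gap `δ` and the vector field `G` of its gradient: `P` is
equivalent to the squared distance to the identity, and in the flow set it is continuously
differentiable with a gradient equivalent to the distance. -/
structure IsHybridPotential (Q : Finset ℕ) (δ : ℝ) (P : Mat3 → ℕ → ℝ) (G : Mat3 → ℕ → Vec3)
    (c₁ c₂ c₃ c₄ : ℝ) : Prop where
  nonempty : Q.Nonempty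
  δ_pos : 0 < δ
  c₁_pos : 0 < c₁
  c₂_pos : 0 < c₂
  c₃_pos : 0 < c₃
  c₄_pos : 0 < c₄
  cont : ∀ q, Continuous fun X => P X q
  le_pot : ∀ X ∈ SO3, ∀ q ∈ Q, c₁ * attDist X ^ 2 ≤ P X q
  pot_le : ∀ X ∈ SO3, ∀ q ∈ Q, P X q ≤ c₂ * attDist X ^ 2
  le_grad : ∀ X q, (X, q) ∈ flowSet P Q δ → c₃ * attDist X ^ 2 ≤ sqNorm (G X q)
  grad_le : ∀ X q, (X, q) ∈ flowSet P Q δ → vnorm (G X q) ≤ c₄ * attDist X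
  deriv : ∀ X q, (X, q) ∈ flowSet P Q δ → ∃ D : Mat3 →L[ℝ] ℝ,
    HasFDerivAt (fun Y => P Y q) D X ∧ ∀ ω, D (X * skew ω) = 2 * (G X q ⬝ᵥ ω)
  smooth : ∀ X q, (X, q) ∈ flowSet P Q δ → ContDiffAt ℝ 1 (fun Y => G Y q) X

namespace SpectralFrame

variable {A : Mat3} {lam : Fin 3 → ℝ} {v : Fin 3 → Vec3} {u : Vec3} {k : ℝ}

theorem gain_lt_one (h : SpectralFrame A lam v) (hD : IsDesign A lam v u k) {X : Mat3}
    (hX : X ∈ SO3) : k ^ 2 * UA A X ^ 2 < 1 := by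
  have := h.gain_mul_UA_sq_lt (h.gain_sq_lt hD.k_pos hD.k_lt) hX
  linarith

theorem isHybridPotential_U (h : SpectralFrame A lam v) (hD : IsDesign A lam v u k) {δ : ℝ}
    (hδ : 0 < δ) (hδ' : δ < DeltaIII A lam k) : ∃ c₁ c₂ c₃ c₄, IsHybridPotential indexSet δ
      (PhiU A k (nuMap u)) (fun X q => gradVec A k (nuMap u q) X) c₁ c₂ c₃ c₄ := by
  have hk2 := h.gain_sq_lt hD.k_pos hD.k_lt
  have hL := h.sum_pos
  have hκ := contraction_pos hk2
  have hx := h.xi_pos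
  obtain ⟨c, hc, hcle⟩ := h.exists_le_sqNorm_psi hD (continuous_PhiU A k (nuMap u))
    fun X q hz => h.no_critical_flowSet_U hD hδ' hz
  refine ⟨xi A * (√(1 - k ^ 2) - k) ^ 2, 4, c / (12 * (lam 1 + lam 2)) ^ 2, 2,
    indexSet_nonempty, hδ, by positivity, by norm_num, by positivity, by norm_num,
    continuous_PhiU A k (nuMap u), fun X hX q _ => (h.PhiU_bounds hD hX q).1,
    fun X hX q _ => (h.PhiU_bounds hD hX q).2, fun X q hz => ?_,
    fun X q hz => h.vnorm_gradVec_le hD hz.1 q,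
    fun X q hz => hasFDerivAt_warped A (sqNorm_nuMap hD.unit_u q) (h.gain_lt_one hD hz.1),
    fun X q hz => contDiffAt_gradVec A _ (h.gain_lt_one hD hz.1)⟩
  have h1 := hcle X q hz
  have h2 := (h.vnorm_gradVec_bounds hk2 (sqNorm_nuMap hD.unit_u q) hz.1).1
  have h3 := pow_le_pow_left₀ (vnorm_nonneg _) h2 2
  rw [vnorm_sq, mul_pow, vnorm_sq] at h3
  rw [div_mul_eq_mul_div, div_le_iff₀ (by positivity)]
  linarith [show c * attDist X ^ 2 ≤ sqNorm (psi (A * warp A k (nuMap u q) X)) from h1]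

/-- Compactness turns Φ_{U_A} ≠ 1 into a uniform margin, which keeps the factor 1/√(1 - Φ_{U_A}) in
the gradient of Φ_{V_A} bounded on the flow set. -/
theorem exists_PhiU_le_of_mem_flowSet (h : SpectralFrame A lam v) (hD : IsDesign A lam v u k)
    {δ : ℝ} (hδ' : δ < DeltaIV A lam k) : ∃ m : ℝ, 0 < m ∧ ∀ X q,
      (X, q) ∈ flowSet (PhiV A k (nuMap u)) indexSet δ → m ≤ 1 - PhiU A k (nuMap u) X q := by
  have hq : ∀ q, ∃ m : ℝ, 0 < m ∧ ∀ X, (X, q) ∈ flowSet (PhiV A k (nuMap u)) indexSet δ →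
      m ≤ 1 - PhiU A k (nuMap u) X q := by
    intro q
    have hK := isCompact_flowSet_slice (continuous_PhiV A k (nuMap u)) indexSet_nonempty δ q
    rcases ({X | (X, q) ∈ flowSet (PhiV A k (nuMap u)) indexSet δ}).eq_empty_or_nonempty with
      he | hne
    · refine ⟨1, one_pos, fun X hX => ?_⟩
      have : X ∈ {X | (X, q) ∈ flowSet (PhiV A k (nuMap u)) indexSet δ} := hX
      rw [he] at this
      exact this.elim
    · obtain ⟨X0, hX0, hmin⟩ := hK.exists_isMinOn hne
        (continuous_const.sub (continuous_PhiU A k (nuMap u) q)).continuousOn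
      refine ⟨_, ?_, fun X hX => hmin hX⟩
      have h1 := h.PhiU_ne_one_of_mem_flowSet hD hδ' hX0
      have h2 := h.PhiU_le_one hD hX0.1 q
      exact sub_pos.2 (lt_of_le_of_ne h2 h1)
  obtain ⟨m1, hm1, h1⟩ := hq 1
  obtain ⟨m2, hm2, h2⟩ := hq 2
  refine ⟨min m1 m2, lt_min hm1 hm2, fun X q hz => ?_⟩
  rcases mem_indexSet.1 hz.2.1 with rfl | rfl
  · exact (min_le_left _ _).trans (h1 X hz)
  · exact (min_le_right _ _).trans (h2 X hz)

theorem hasFDerivAt_PhiV (h : SpectralFrame A lam v) (hD : IsDesign A lam v u k) {X : Mat3}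
    (hX : X ∈ SO3) {q : ℕ} (hne : PhiU A k (nuMap u) X q ≠ 1) : ∃ D : Mat3 →L[ℝ] ℝ,
      HasFDerivAt (fun Y => PhiV A k (nuMap u) Y q) D X ∧ ∀ ω, D (X * skew ω) =
        2 * (((1 / √(1 - PhiU A k (nuMap u) X q)) • gradVec A k (nuMap u q) X) ⬝ᵥ ω) := by
  obtain ⟨D, hDer, hω⟩ := hasFDerivAt_warped A (sqNorm_nuMap hD.unit_u q) (h.gain_lt_one hD hX)
  have hle := h.PhiU_le_one hD hX q
  have hpos : 0 < 1 - PhiU A k (nuMap u) X q := sub_pos.2 (lt_of_le_of_ne hle hne)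
  have h1 : HasDerivAt (fun y : ℝ => 2 * (1 - √(1 - y))) (1 / √(1 - PhiU A k (nuMap u) X q))
      (PhiU A k (nuMap u) X q) := by
    have h2 := (((hasDerivAt_id (PhiU A k (nuMap u) X q)).const_sub 1).sqrt hpos.ne').const_sub 1
      |>.const_mul 2
    refine h2.congr_deriv ?_
    simp only [id]
    have := (Real.sqrt_pos.2 hpos).ne'
    field_simp
  have h3 := HasDerivAt.comp_hasFDerivAt (h₂ := fun y : ℝ => 2 * (1 - √(1 - y)))
    (f := fun Y => PhiU A k (nuMap u) Y q) X h1 hDer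
  refine ⟨(1 / √(1 - PhiU A k (nuMap u) X q)) • D, h3, fun ω => ?_⟩
  rw [_root_.smul_apply, hω, smul_dotProduct, smul_eq_mul, smul_eq_mul]
  ring

/-- On [0, 1] one has y ≤ 2 (1 - √(1 - y)) ≤ 2 y, which transfers the quadratic bounds from Φ_{U_A}.
The gradient is multiplied by 1/√(1 - y), which lies between 1 and 1/√m on the flow set. -/
theorem isHybridPotential_V (h : SpectralFrame A lam v) (hD : IsDesign A lam v u k) {δ : ℝ}
    (hδ : 0 < δ) (hδ' : δ < DeltaIV A lam k) : ∃ c₁ c₂ c₃ c₄, IsHybridPotential indexSet δ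
      (PhiV A k (nuMap u)) (fun X q => (1 / √(1 - PhiU A k (nuMap u) X q)) •
        gradVec A k (nuMap u q) X) c₁ c₂ c₃ c₄ := by
  have hk2 := h.gain_sq_lt hD.k_pos hD.k_lt
  have hL := h.sum_pos
  have hκ := contraction_pos hk2
  have hx := h.xi_pos
  obtain ⟨c, hc, hcle⟩ := h.exists_le_sqNorm_psi hD (continuous_PhiV A k (nuMap u))
    fun X q hz => h.no_critical_flowSet_V hD hδ' hz
  obtain ⟨m, hm, hmle⟩ := h.exists_PhiU_le_of_mem_flowSet hD hδ'
  have hV : ∀ X q, PhiV A k (nuMap u) X q = 2 * (1 - √(1 - PhiU A k (nuMap u) X q)) :=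
    fun _ _ => rfl
  have hsq : ∀ X ∈ SO3, ∀ q, √(1 - PhiU A k (nuMap u) X q) ^ 2 = 1 - PhiU A k (nuMap u) X q ∧
      √(1 - PhiU A k (nuMap u) X q) ≤ 1 := by
    intro X hX q
    have h1 := h.PhiU_le_one hD hX q
    have h0 := h.PhiU_nonneg hD hX q
    exact ⟨Real.sq_sqrt (by linarith), Real.sqrt_le_one.2 (by linarith)⟩
  refine ⟨xi A * (√(1 - k ^ 2) - k) ^ 2, 8, c / (12 * (lam 1 + lam 2)) ^ 2, 2 / √m,
    indexSet_nonempty, hδ, by positivity, by norm_num, by positivity, by positivity,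
    continuous_PhiV A k (nuMap u), fun X hX q _ => ?_, fun X hX q _ => ?_, fun X q hz => ?_,
    fun X q hz => ?_, fun X q hz => ?_, fun X q hz => ?_⟩
  · refine (h.PhiU_bounds hD hX q).1.trans ?_
    obtain ⟨h1, h2⟩ := hsq X hX q
    rw [hV]
    nlinarith [Real.sqrt_nonneg (1 - PhiU A k (nuMap u) X q)]
  · have h3 := (h.PhiU_bounds hD hX q).2
    obtain ⟨h1, h2⟩ := hsq X hX q
    rw [hV]
    nlinarith [Real.sqrt_nonneg (1 - PhiU A k (nuMap u) X q)]
  · have h1 := hcle X q hz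
    have h2 := (h.vnorm_gradVec_bounds hk2 (sqNorm_nuMap hD.unit_u q) hz.1).1
    have h3 := pow_le_pow_left₀ (vnorm_nonneg _) h2 2
    rw [vnorm_sq, mul_pow, vnorm_sq] at h3
    have h4 : c / (12 * (lam 1 + lam 2)) ^ 2 * attDist X ^ 2 ≤
        sqNorm (gradVec A k (nuMap u q) X) := by
      rw [div_mul_eq_mul_div, div_le_iff₀ (by positivity)]
      linarith [show c * attDist X ^ 2 ≤ sqNorm (psi (A * warp A k (nuMap u q) X)) from h1]
    refine h4.trans ?_
    have hmX := hmle X q hz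
    have hp : 0 < 1 - PhiU A k (nuMap u) X q := by linarith
    rw [sqNorm_smul, div_pow, Real.sq_sqrt hp.le, one_pow]
    have h5 : 1 ≤ 1 / (1 - PhiU A k (nuMap u) X q) := by
      rw [le_div_iff₀ hp]; linarith [h.PhiU_nonneg hD hz.1 q]
    exact le_mul_of_one_le_left (sqNorm_nonneg _) h5
  · have hmX := hmle X q hz
    have hs : √m ≤ √(1 - PhiU A k (nuMap u) X q) := Real.sqrt_le_sqrt hmX
    have hm0 : 0 < √m := Real.sqrt_pos.2 hm
    rw [vnorm_smul, abs_of_pos (one_div_pos.2 (hm0.trans_le hs))]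
    have h1 := h.vnorm_gradVec_le hD hz.1 q
    calc 1 / √(1 - PhiU A k (nuMap u) X q) * vnorm (gradVec A k (nuMap u q) X)
        ≤ 1 / √m * (2 * attDist X) :=
          mul_le_mul (one_div_le_one_div_of_le hm0 hs) h1 (vnorm_nonneg _) (by positivity)
      _ = 2 / √m * attDist X := by ring
  · exact h.hasFDerivAt_PhiV hD hz.1 (h.PhiU_ne_one_of_mem_flowSet hD hδ' hz)
  · have hmX := hmle X q hz
    have hp : 0 < 1 - PhiU A k (nuMap u) X q := by linarith
    have hid : ContDiffAt ℝ 1 (fun Y : Mat3 => Y) X := contDiffAt_id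
    have hlt := h.gain_lt_one hD hz.1
    have h1 : ContDiffAt ℝ 1 (fun Y => PhiU A k (nuMap u) Y q) X :=
      (hid.warp A (k := k) (nuMap u q) (by rwa [mul_pow])).2.UA A
    have h2 : ContDiffAt ℝ 1 (fun Y => 1 - PhiU A k (nuMap u) Y q) X := contDiffAt_const.sub h1
    have h3 : ContDiffAt ℝ 1 (fun Y => 1 / √(1 - PhiU A k (nuMap u) Y q)) X :=
      contDiffAt_const.div ((Real.contDiffAt_sqrt hp.ne').comp X h2) (Real.sqrt_pos.2 hp).ne'
    have h4 := contDiffAt_gradVec A (nuMap u q) hlt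
    exact h3.smul h4

end SpectralFrame
/-! ### Locally absolutely continuous functions -/

theorem sub_le_of_ae_deriv_le {f : ℝ → ℝ} {a b C : ℝ} (hab : a ≤ b)
    (hf : AbsolutelyContinuousOnInterval f a b)
    (hd : ∀ᵐ t : ℝ, t ∈ Ioo a b → ∃ d ≤ C, HasDerivAt f d t) : f b - f a ≤ C * (b - a) := by
  rw [← hf.integral_deriv_eq_sub]
  have h1 : ∫ x in a..b, deriv f x ≤ ∫ _ in a..b, C := by
    apply intervalIntegral.integral_mono_ae_restrict hab hf.intervalIntegrable_deriv
      intervalIntegrable_const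
    have hne : ∀ᵐ t : ℝ, t ≠ a ∧ t ≠ b := by
      filter_upwards [compl_mem_ae_iff.2 (measure_singleton (μ := (volume : Measure ℝ)) a),
        compl_mem_ae_iff.2 (measure_singleton (μ := (volume : Measure ℝ)) b)] with t h1 h2
      exact ⟨h1, h2⟩
    rw [Filter.EventuallyLE, ae_restrict_iff' measurableSet_Icc]
    filter_upwards [hd, hne] with t ht hne hmem
    obtain ⟨d, hd, hder⟩ := ht ⟨lt_of_le_of_ne hmem.1 hne.1.symm, lt_of_le_of_ne hmem.2 hne.2⟩
    rw [hder.deriv]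
    exact hd
  refine h1.trans_eq ?_
  rw [intervalIntegral.integral_const, smul_eq_mul, mul_comm]

theorem abs_sub_le_of_ae_abs_deriv_le {f : ℝ → ℝ} {a b C : ℝ} (hab : a ≤ b)
    (hf : AbsolutelyContinuousOnInterval f a b)
    (hd : ∀ᵐ t : ℝ, t ∈ Ioo a b → ∃ d, |d| ≤ C ∧ HasDerivAt f d t) :
    |f b - f a| ≤ C * (b - a) := by
  have h1 := sub_le_of_ae_deriv_le hab hf (C := C) <| by
    filter_upwards [hd] with t ht hmem
    obtain ⟨d, hd, hder⟩ := ht hmem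
    exact ⟨d, le_of_abs_le hd, hder⟩
  have h2 := sub_le_of_ae_deriv_le hab hf.neg (C := C) <| by
    filter_upwards [hd] with t ht hmem
    obtain ⟨d, hd, hder⟩ := ht hmem
    exact ⟨-d, by linarith [neg_le_of_abs_le hd], hder.neg⟩
  simp only [Pi.neg_apply] at h2
  rw [abs_le]
  constructor <;> linarith

theorem absolutelyContinuousOnInterval_of_deriv_bounded {f : ℝ → ℝ} {a b C : ℝ} (hab : a ≤ b)
    (hf : ContinuousOn f (Icc a b))
    (hd : ∀ t ∈ Ioo a b, ∃ d, |d| ≤ C ∧ HasDerivAt f d t) :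
    AbsolutelyContinuousOnInterval f a b := by
  have hC : ∀ t ∈ Ioo a b, 0 ≤ C := fun t ht => by
    obtain ⟨d, h, -⟩ := hd t ht
    exact (abs_nonneg d).trans h
  have hdiff : DifferentiableOn ℝ f (interior (Icc a b)) := by
    intro t ht
    rw [interior_Icc] at ht
    obtain ⟨d, -, h⟩ := hd t ht
    exact h.differentiableAt.differentiableWithinAt
  have hup : ∀ t ∈ interior (Icc a b), deriv f t ≤ |C| := by
    intro t ht
    rw [interior_Icc] at ht
    obtain ⟨d, h1, h⟩ := hd t ht
    rw [h.deriv]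
    exact (le_of_abs_le h1).trans (le_abs_self C)
  have hlo : ∀ t ∈ interior (Icc a b), -|C| ≤ deriv f t := by
    intro t ht
    rw [interior_Icc] at ht
    obtain ⟨d, h1, h⟩ := hd t ht
    rw [h.deriv]
    linarith [neg_le_of_abs_le h1, le_abs_self C]
  have key : ∀ x ∈ Icc a b, ∀ y ∈ Icc a b, x ≤ y → |f y - f x| ≤ |C| * (y - x) := by
    intro x hx y hy hxy
    have h1 := (convex_Icc a b).image_sub_le_mul_sub_of_deriv_le hf hdiff hup x hx y hy hxy
    have h2 := (convex_Icc a b).mul_sub_le_image_sub_of_le_deriv hf hdiff hlo x hx y hy hxy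
    rw [abs_le]
    constructor <;> linarith
  refine LipschitzOnWith.absolutelyContinuousOnInterval (K := ⟨|C|, abs_nonneg C⟩) ?_
  rw [uIcc_of_le hab]
  refine LipschitzOnWith.of_dist_le_mul fun x hx y hy => ?_
  rw [Real.dist_eq, Real.dist_eq]
  rcases le_total x y with h | h
  · rw [abs_sub_comm, abs_sub_comm x, abs_of_nonneg (sub_nonneg.2 h)]
    exact key x hx y hy h
  · rw [abs_of_nonneg (sub_nonneg.2 h)]
    exact key y hy x hx h

/-- On the whole interval f is a constant plus the integral of its derivative, which is integrable
because it is so on both pieces. -/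
theorem absolutelyContinuousOnInterval_glue {f : ℝ → ℝ} {a b c : ℝ} (hab : a ≤ b) (hbc : b ≤ c)
    (h1 : AbsolutelyContinuousOnInterval f a b) (h2 : AbsolutelyContinuousOnInterval f b c) :
    AbsolutelyContinuousOnInterval f a c := by
  have i1 := h1.intervalIntegrable_deriv
  have i2 := h2.intervalIntegrable_deriv
  have i3 := i1.trans i2
  have hI := i3.absolutelyContinuousOnInterval_intervalIntegral (c := a) left_mem_uIcc
  have hc : AbsolutelyContinuousOnInterval (fun _ : ℝ => f a) a c :=
    (LipschitzWith.const (f a)).lipschitzOnWith.absolutelyContinuousOnInterval (K := 0)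
  have hs := hI.add hc
  have heq : ∀ x ∈ Icc a c, f x = (∫ t in a..x, deriv f t) + f a := by
    intro x hx
    rcases le_total x b with h | h
    · have := (h1.mono (c := a) (d := x) (by
        rw [uIcc_of_le hab, uIcc_of_le hx.1]; exact Icc_subset_Icc_right h)).integral_deriv_eq_sub
      rw [this]; ring
    · have e2 := (h2.mono (c := b) (d := x) (by
        rw [uIcc_of_le hbc, uIcc_of_le h]; exact Icc_subset_Icc_right hx.2))
      rw [← intervalIntegral.integral_add_adjacent_intervals i1 e2.intervalIntegrable_deriv,
        h1.integral_deriv_eq_sub, e2.integral_deriv_eq_sub]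
      ring
  rw [absolutelyContinuousOnInterval_iff] at hs ⊢
  intro ε hε
  obtain ⟨δ, hδ, h⟩ := hs ε hε
  refine ⟨δ, hδ, fun E hE hlen => ?_⟩
  refine lt_of_le_of_lt (le_of_eq ?_) (h E hE hlen)
  refine Finset.sum_congr rfl fun i hi => ?_
  have hm := hE.1 i hi
  rw [uIcc_of_le (hab.trans hbc)] at hm
  rw [heq _ hm.1, heq _ hm.2]
  rfl

theorem absolutelyContinuousOnInterval_congr {f g : ℝ → ℝ} {a b : ℝ} (hab : a ≤ b)
    (hf : AbsolutelyContinuousOnInterval f a b) (h : ∀ t ∈ Icc a b, g t = f t) :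
    AbsolutelyContinuousOnInterval g a b := by
  rw [absolutelyContinuousOnInterval_iff] at hf ⊢
  intro ε hε
  obtain ⟨δ, hδ, h'⟩ := hf ε hε
  refine ⟨δ, hδ, fun E hE hlen => ?_⟩
  refine lt_of_le_of_lt (le_of_eq ?_) (h' E hE hlen)
  refine Finset.sum_congr rfl fun i hi => ?_
  have hm := hE.1 i hi
  rw [uIcc_of_le hab] at hm
  rw [h _ hm.1, h _ hm.2]

namespace LocAbsCont

variable {f g : ℝ → ℝ} {I : Set ℝ}

theorem add (hf : LocAbsCont f I) (hg : LocAbsCont g I) : LocAbsCont (fun t => f t + g t) I :=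
  fun a b hab h => (hf a b hab h).add (hg a b hab h)

theorem sub (hf : LocAbsCont f I) (hg : LocAbsCont g I) : LocAbsCont (fun t => f t - g t) I :=
  fun a b hab h => (hf a b hab h).sub (hg a b hab h)

theorem mul (hf : LocAbsCont f I) (hg : LocAbsCont g I) : LocAbsCont (fun t => f t * g t) I :=
  fun a b hab h => (hf a b hab h).mul (hg a b hab h)

theorem const (c : ℝ) : LocAbsCont (fun _ => c) I := fun _ _ _ _ =>
  (LipschitzWith.const c).lipschitzOnWith.absolutelyContinuousOnInterval (K := 0)

theorem sum {ι : Type*} (s : Finset ι) {F : ι → ℝ → ℝ} (h : ∀ i, LocAbsCont (F i) I) :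
    LocAbsCont (fun t => ∑ i ∈ s, F i t) I := by
  classical
  induction s using Finset.induction_on with
  | empty => simpa using const 0
  | insert i s hi ih => simpa only [Finset.sum_insert hi] using (h i).add ih

theorem mono {J : Set ℝ} (hf : LocAbsCont f I) (h : J ⊆ I) : LocAbsCont f J :=
  fun a b hab hJ => hf a b hab (hJ.trans h)

theorem continuousOn (hf : LocAbsCont f I) {a b : ℝ} (hab : a ≤ b) (h : Icc a b ⊆ I) :
    ContinuousOn f (Icc a b) := by
  have := (hf a b hab h).continuousOn
  rwa [uIcc_of_le hab] at this

theorem continuousAt (hf : LocAbsCont f I) {t : ℝ} (ht : t ∈ interior I) : ContinuousAt f t := by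
  obtain ⟨ε, hε, hb⟩ := Metric.isOpen_iff.1 isOpen_interior t ht
  have hsub : Icc (t - ε / 2) (t + ε / 2) ⊆ I := by
    refine Subset.trans ?_ (hb.trans interior_subset)
    rw [Real.ball_eq_Ioo]
    exact Icc_subset_Ioo (by linarith) (by linarith)
  exact (hf.continuousOn (by linarith) hsub).continuousAt
    (Icc_mem_nhds (by linarith) (by linarith))

/-- An absolutely continuous function is the integral of its derivative; if that derivative agrees
almost everywhere with a continuous g, the fundamental theorem gives the derivative at every point.
This makes the error equations hold classically during flows. -/
theorem hasDerivAt (hf : LocAbsCont f I)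
    (hd : ∀ᵐ t : ℝ, t ∈ interior I → HasDerivAt f (g t) t)
    (hg : ∀ t ∈ interior I, ContinuousAt g t) {t : ℝ} (ht : t ∈ interior I) :
    HasDerivAt f (g t) t := by
  obtain ⟨ε, hε, hb⟩ := Metric.isOpen_iff.1 isOpen_interior t ht
  have hsub : Icc (t - ε / 2) (t + ε / 2) ⊆ interior I := by
    refine Subset.trans ?_ hb
    rw [Real.ball_eq_Ioo]
    exact Icc_subset_Ioo (by linarith) (by linarith)
  set a := t - ε / 2
  have hat : a < t := by simp only [a]; linarith
  have hgc : ContinuousOn g (Icc a (t + ε / 2)) := fun s hs =>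
    (hg s (hsub hs)).continuousWithinAt
  have key : ∀ s ∈ Icc a (t + ε / 2), f s = f a + ∫ x in a..s, g x := by
    intro s hs
    have hsub' : Icc a s ⊆ interior I := (Icc_subset_Icc_right hs.2).trans hsub
    have h1 := (hf a s hs.1 (hsub'.trans interior_subset)).integral_deriv_eq_sub
    have h2 : ∫ x in a..s, deriv f x = ∫ x in a..s, g x := by
      apply intervalIntegral.integral_congr_ae
      filter_upwards [hd] with x hx hmem
      rw [uIoc_of_le hs.1] at hmem
      exact (hx (hsub' (Ioc_subset_Icc_self hmem))).deriv
    rw [← h2, h1]; ring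
  have hint : IntervalIntegrable g volume a t :=
    (hgc.mono (Icc_subset_Icc_right (by linarith))).intervalIntegrable_of_Icc hat.le
  have hmeas : StronglyMeasurableAtFilter g (𝓝 t) := by
    have : ContinuousOn g (interior I) := fun s hs => (hg s hs).continuousWithinAt
    exact this.stronglyMeasurableAtFilter isOpen_interior t ht
  have h3 := (intervalIntegral.integral_hasDerivAt_right hint hmeas (hg t ht)).const_add (f a)
  refine h3.congr_of_eventuallyEq ?_
  filter_upwards [Icc_mem_nhds hat (show t < t + ε / 2 by linarith)] with s hs
  exact key s hs

end LocAbsCont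

/-! ### Hybrid time domains -/

/-- A form of the definition that does not depend on the shape of the last interval: below a given
point of the domain only completed intervals and an initial piece of the current one matter. -/
theorem IsHybridTimeDomain.exists_jumps {t0 : ℝ} {E : Set (ℝ × ℕ)} (h : IsHybridTimeDomain t0 E) :
    ∃ τ : ℕ → ℝ, τ 0 = t0 ∧ Monotone τ ∧ ∀ t j, (t, j) ∈ E → τ j ≤ t ∧ Icc (τ j) t ⊆ slice E j ∧
      ∀ i < j, Icc (τ i) (τ (i + 1)) ⊆ slice E i := by
  obtain ⟨τ, h0, hm, rfl | ⟨N, L, hL, rfl⟩⟩ := h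
  · refine ⟨τ, h0, hm, fun t j ht => ⟨ht.1, fun s hs => ⟨hs.1, hs.2.trans ht.2⟩, fun i _ s hs => hs⟩⟩
  · have hL1 : ∀ t ∈ L, τ N ≤ t ∧ Icc (τ N) t ⊆ L := by
      intro t ht
      rcases hL with rfl | ⟨-, rfl⟩ | rfl
      · exact ⟨ht.1, fun s hs => ⟨hs.1, hs.2.trans ht.2⟩⟩
      · exact ⟨ht.1, fun s hs => ⟨hs.1, hs.2.trans_lt ht.2⟩⟩
      · exact ⟨ht, fun s hs => hs.1⟩
    refine ⟨τ, h0, hm, fun t j ht => ?_⟩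
    rcases ht with ⟨hj, ht⟩ | ⟨hj, ht⟩
    · exact ⟨ht.1, fun s hs => Or.inl ⟨hj, hs.1, hs.2.trans ht.2⟩,
        fun i hi s hs => Or.inl ⟨hi.trans hj, hs⟩⟩
    · simp only at hj ht
      subst hj
      exact ⟨(hL1 t ht).1, fun s hs => Or.inr ⟨rfl, (hL1 t ht).2 hs⟩,
        fun i hi s hs => Or.inl ⟨hi, hs⟩⟩

theorem IsHybridTimeDomain.Icc_subset_slice {t0 : ℝ} {E : Set (ℝ × ℕ)}
    (h : IsHybridTimeDomain t0 E) {j : ℕ} {s t : ℝ} (hs : (s, j) ∈ E) (ht : (t, j) ∈ E) :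
    Icc s t ⊆ slice E j := by
  obtain ⟨τ, -, -, hτ⟩ := h.exists_jumps
  exact (Icc_subset_Icc_left (hτ s j hs).1).trans (hτ t j ht).2.1

theorem IsHybridTimeDomain.le {t0 : ℝ} {E : Set (ℝ × ℕ)} (h : IsHybridTimeDomain t0 E) {j : ℕ}
    {t : ℝ} (ht : (t, j) ∈ E) : t0 ≤ t := by
  obtain ⟨τ, h0, hm, hτ⟩ := h.exists_jumps
  exact h0 ▸ (hm (Nat.zero_le j)).trans (hτ t j ht).1

theorem IsHybridTimeDomain.start_mem {t0 : ℝ} {E : Set (ℝ × ℕ)} (h : IsHybridTimeDomain t0 E) :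
    (t0, 0) ∈ E := by
  obtain ⟨τ, rfl, hm, rfl | ⟨N, L, hL, rfl⟩⟩ := h
  · exact ⟨le_rfl, hm (Nat.zero_le 1)⟩
  · rcases Nat.eq_zero_or_pos N with rfl | hN
    · refine Or.inr ⟨rfl, ?_⟩
      rcases hL with rfl | ⟨h1, rfl⟩ | rfl
      · exact ⟨le_rfl, hm (Nat.zero_le 1)⟩
      · exact ⟨le_rfl, h1⟩
      · exact self_mem_Ici
    · exact Or.inl ⟨hN, le_rfl, hm (Nat.zero_le 1)⟩

/-- Induction over the jump times. With the hysteresis gap as δ it counts jumps; with δ = 0 it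
propagates exponential decay through them. -/
theorem IsHybridTimeDomain.le_of_decreasing {t0 : ℝ} {E : Set (ℝ × ℕ)}
    (h : IsHybridTimeDomain t0 E) {f : ℝ → ℕ → ℝ} {δ : ℝ}
    (hflow : ∀ j s t, s ≤ t → (s, j) ∈ E → (t, j) ∈ E → f t j ≤ f s j)
    (hjump : ∀ t j, (t, j) ∈ E → (t, j + 1) ∈ E → f t (j + 1) + δ ≤ f t j) {t : ℝ} {j : ℕ}
    (ht : (t, j) ∈ E) : f t j + j * δ ≤ f t0 0 := by
  obtain ⟨τ, h0, hm, hτ⟩ := h.exists_jumps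
  have key : ∀ j, (τ j, j) ∈ E → f (τ j) j + j * δ ≤ f t0 0 := by
    intro j
    induction j with
    | zero => intro _; simp [h0]
    | succ j ih =>
      intro hj
      have hI := (hτ _ _ hj).2.2 j (Nat.lt_succ_self j)
      have h1 : (τ j, j) ∈ E := hI (left_mem_Icc.2 (hm (Nat.le_succ j)))
      have h2 : (τ (j + 1), j) ∈ E := hI (right_mem_Icc.2 (hm (Nat.le_succ j)))
      have h3 := hflow j _ _ (hm (Nat.le_succ j)) h1 h2
      have h4 := hjump _ _ h2 hj
      have h5 := ih h1
      push_cast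
      linarith
  have hmem : (τ j, j) ∈ E := (hτ t j ht).2.1 (left_mem_Icc.2 (hτ t j ht).1)
  have h1 := hflow j _ _ (hτ t j ht).1 hmem ht
  linarith [key j hmem]

/-! ### The error dynamics -/

/-- The observer `O` with the measurement `y = h(R)` evaluates the hybrid potential `P` and its
gradient field `G` at the attitude error. -/
structure Realizes {Y : Type} (O : HybridObserver Y) (h : Mat3 → Y) (P : Mat3 → ℕ → ℝ)
    (G : Mat3 → ℕ → Vec3) (c₁ c₂ c₃ c₄ : ℝ) : Prop where
  potential : IsHybridPotential O.Q O.δ P G c₁ c₂ c₃ c₄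
  γP_pos : 0 < O.γP
  γI_pos : 0 < O.γI
  pot_eq : ∀ R ∈ SO3, ∀ Rhat ∈ SO3, ∀ q ∈ O.Q, O.pot (h R) Rhat q = P (R * Rhatᵀ) q
  inj_eq : ∀ R ∈ SO3, ∀ Rhat ∈ SO3, ∀ q ∈ O.Q, O.inj (h R) Rhat q = Rhatᵀ *ᵥ G (R * Rhatᵀ) q

section Dynamics

variable {Y : Type} {O : HybridObserver Y} {h : Mat3 → Y} {P : Mat3 → ℕ → ℝ}
  {G : Mat3 → ℕ → Vec3} {c₁ c₂ c₃ c₄ : ℝ}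

theorem Realizes.gap_eq (hO : Realizes O h P G c₁ c₂ c₃ c₄) {R Rhat : Mat3} (hR : R ∈ SO3)
    (hRh : Rhat ∈ SO3) {q : ℕ} (hq : q ∈ O.Q) :
    O.gap (h R) Rhat q = P (R * Rhatᵀ) q - sInf (P (R * Rhatᵀ) '' O.Q) := by
  rw [HybridObserver.gap, hO.pot_eq R hR Rhat hRh q hq]
  congr 2
  exact image_congr fun p hp => hO.pot_eq R hR Rhat hRh p hp

/-- The attitude error along a solution. -/
noncomputable def attErr (R : ℝ → Mat3) (x : HybridArc) (t : ℝ) (j : ℕ) : Mat3 :=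
  R t * (x.Rhat t j)ᵀ

/-- The bias error along a solution. -/
noncomputable def biasErr (bω : Vec3) (x : HybridArc) (t : ℝ) (j : ℕ) : Vec3 := bω - x.bhat t j

/-- The velocity of the attitude error. -/
noncomputable def errVel (O : HybridObserver Y) (G : Mat3 → ℕ → Vec3) (R : ℝ → Mat3) (bω : Vec3)
    (x : HybridArc) (t : ℝ) (j : ℕ) : Vec3 :=
  -(x.Rhat t j *ᵥ biasErr bω x t j + O.γP • G (attErr R x t j) (x.q t j))

/-- The Lyapunov function `P + ‖b̃‖² / γ_I`. -/
noncomputable def lyap (O : HybridObserver Y) (P : Mat3 → ℕ → ℝ) (R : ℝ → Mat3) (bω : Vec3)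
    (x : HybridArc) (t : ℝ) (j : ℕ) : ℝ :=
  P (attErr R x t j) (x.q t j) + sqNorm (biasErr bω x t j) / O.γI

variable {t0 : ℝ} {R : ℝ → Mat3} {ω : ℝ → Vec3} {bω : Vec3} {x : HybridArc}

namespace IsSolution

section

variable (hx : IsSolution O (fun t => h (R t)) (fun t => ω t + bω) t0 x)
  (hR : IsAttitudeTrajectory t0 R ω)

include hx

theorem slice_subset (j : ℕ) : slice x.dom j ⊆ Ici t0 := fun _ ht => hx.dom_hybrid.le ht

theorem biasErr_ac (j : ℕ) (i : Fin 3) :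
    LocAbsCont (fun t => biasErr bω x t j i) (slice x.dom j) :=
  (LocAbsCont.const (bω i)).sub (hx.bhat_ac j i)

theorem jump_attErr {t : ℝ} {j : ℕ} (h1 : (t, j) ∈ x.dom) (h2 : (t, j + 1) ∈ x.dom) :
    attErr R x t (j + 1) = attErr R x t j := by
  rw [attErr, hx.jump_Rhat t j h1 h2, attErr]

theorem jump_biasErr {t : ℝ} {j : ℕ} (h1 : (t, j) ∈ x.dom) (h2 : (t, j + 1) ∈ x.dom) :
    biasErr bω x t (j + 1) = biasErr bω x t j := by
  rw [biasErr, hx.jump_bhat t j h1 h2, biasErr]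

theorem continuousAt_Rhat {t : ℝ} {j : ℕ} (ht : t ∈ interior (slice x.dom j)) :
    ContinuousAt (fun s => x.Rhat s j) t :=
  continuousAt_pi.2 fun i => continuousAt_pi.2 fun l => (hx.Rhat_ac j i l).continuousAt ht

include hR

theorem attErr_mem {t : ℝ} {j : ℕ} (ht : (t, j) ∈ x.dom) : attErr R x t j ∈ SO3 :=
  SO3_mul (hR.1 t (hx.dom_hybrid.le ht)) (SO3_transpose (hx.Rhat_mem t j ht))

theorem attErr_ac (j : ℕ) (i l : Fin 3) :
    LocAbsCont (fun t => attErr R x t j i l) (slice x.dom j) := by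
  simp only [attErr, Matrix.mul_apply, transpose_apply]
  exact LocAbsCont.sum _ fun m =>
    ((hR.2.1 i m).mono (hx.slice_subset j)).mul (hx.Rhat_ac j l m)

end

section

variable (hO : Realizes O h P G c₁ c₂ c₃ c₄)
  (hx : IsSolution O (fun t => h (R t)) (fun t => ω t + bω) t0 x)
  (hR : IsAttitudeTrajectory t0 R ω)

include hO hx hR

theorem mem_flowSet {t : ℝ} {j : ℕ} (ht : t ∈ interior (slice x.dom j)) :
    (attErr R x t j, x.q t j) ∈ flowSet P O.Q O.δ := by
  have hm : (t, j) ∈ x.dom := interior_subset (s := slice x.dom j) ht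
  refine ⟨hx.attErr_mem hR hm, hx.q_mem t j hm, ?_⟩
  have h1 := hx.flow_set j t ht
  rwa [hO.gap_eq (hR.1 t (hx.dom_hybrid.le hm)) (hx.Rhat_mem t j hm) (hx.q_mem t j hm)] at h1

theorem continuousAt_field {t : ℝ} {j : ℕ} (ht : t ∈ interior (slice x.dom j)) :
    ContinuousAt (fun s => G (attErr R x s j) (x.q s j)) t := by
  have hm : (t, j) ∈ x.dom := interior_subset (s := slice x.dom j) ht
  have hX : ContinuousAt (fun s => attErr R x s j) t :=
    continuousAt_pi.2 fun i => continuousAt_pi.2 fun l => (hx.attErr_ac hR j i l).continuousAt ht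
  have h1 : ContinuousAt (fun Y => G Y (x.q t j)) (attErr R x t j) :=
    (hO.potential.smooth _ _ (hx.mem_flowSet hO hR ht)).continuousAt
  have h2 : ContinuousAt (fun s => G (attErr R x s j) (x.q t j)) t :=
    ContinuousAt.comp (g := fun Y => G Y (x.q t j)) (f := fun s => attErr R x s j) h1 hX
  refine h2.congr ?_
  filter_upwards [mem_interior_iff_mem_nhds.1 ht] with s hs
  rw [hx.q_const j t s hm hs]

theorem continuousAt_errVel {t : ℝ} {j : ℕ} (ht : t ∈ interior (slice x.dom j)) :
    ContinuousAt (fun s => errVel O G R bω x s j) t := by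
  have h1 := hx.continuousAt_Rhat ht
  have h2 : ContinuousAt (fun s => biasErr bω x s j) t :=
    continuousAt_pi.2 fun i => (hx.biasErr_ac j i).continuousAt ht
  have h3 := hx.continuousAt_field hO hR ht
  have hc : Continuous fun z : Mat3 × Vec3 × Vec3 => -(z.1 *ᵥ z.2.1 + O.γP • z.2.2) := by
    have : Continuous fun z : Mat3 × Vec3 × Vec3 => z.1 *ᵥ z.2.1 :=
      continuous_fst.matrix_mulVec continuous_snd.fst
    exact (this.add (continuous_snd.snd.const_smul O.γP)).neg
  exact ContinuousAt.comp (g := fun z : Mat3 × Vec3 × Vec3 => -(z.1 *ᵥ z.2.1 + O.γP • z.2.2))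
    (f := fun s => (x.Rhat s j, biasErr bω x s j, G (attErr R x s j) (x.q s j)))
    hc.continuousAt (h1.prodMk (h2.prodMk h3))

/-- The measured velocity contains ω, which cancels against the motion of R, leaving R̃' = R̃
[errVel]_×. Since `errVel` is continuous, the equation holds at every interior time even if ω is
irregular. -/
theorem hasDerivAt_attErr {t : ℝ} {j : ℕ} (ht : t ∈ interior (slice x.dom j)) (i l : Fin 3) :
    HasDerivAt (fun s => attErr R x s j i l)
      ((attErr R x t j * skew (errVel O G R bω x t j)) i l) t := by
  refine (hx.attErr_ac hR j i l).hasDerivAt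
    (g := fun t => (attErr R x t j * skew (errVel O G R bω x t j)) i l) ?_ ?_ ht
  · filter_upwards [hR.2.2, hx.flow_Rhat j] with s hs1 hs2 hs
    have hm : (s, j) ∈ x.dom := interior_subset (s := slice x.dom j) hs
    have ht0 := hx.dom_hybrid.le hm
    have hRs := hR.1 s ht0
    have hRh := hx.Rhat_mem s j hm
    have h1 := hs1 ht0
    have h2 := hs2 hs
    rw [hO.inj_eq _ hRs _ hRh _ (hx.q_mem s j hm)] at h2
    have h3 : HasDerivAt (fun s => attErr R x s j i l)
        (∑ m, ((R s * skew (ω s)) i m * x.Rhat s j l m + R s i m *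
          (x.Rhat s j * skew (ω s + bω - x.bhat s j +
            O.γP • ((x.Rhat s j)ᵀ *ᵥ G (R s * (x.Rhat s j)ᵀ) (x.q s j)))) l m)) s := by
      simp only [attErr, Matrix.mul_apply, transpose_apply]
      exact HasDerivAt.fun_sum fun m _ => (h1 i m).mul (h2 l m)
    refine h3.congr_deriv ?_
    have hsum : ∀ A B C D : Mat3, ∑ m, (A i m * B l m + C i m * D l m) =
        (A * Bᵀ + C * Dᵀ) i l := by
      intro A B C D
      rw [Matrix.add_apply, Matrix.mul_apply, Matrix.mul_apply, Finset.sum_add_distrib]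
      rfl
    rw [hsum]
    have e1 : ω s + bω - x.bhat s j + O.γP • ((x.Rhat s j)ᵀ *ᵥ G (R s * (x.Rhat s j)ᵀ) (x.q s j)) =
        ω s + (x.Rhat s j)ᵀ *ᵥ -errVel O G R bω x s j := by
      rw [errVel, neg_neg, mulVec_add, mulVec_mulVec, SO3_transpose_mul hRh, one_mulVec,
        mulVec_smul, biasErr, attErr]
      abel
    rw [e1, skew_add, Matrix.mul_add, transpose_add, transpose_mul, transpose_mul, skew_transpose,
      skew_transpose, mulVec_neg, skew_neg, neg_neg, attErr]
    have e2 : skew ((x.Rhat s j)ᵀ *ᵥ errVel O G R bω x s j) =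
        (x.Rhat s j)ᵀ * skew (errVel O G R bω x s j) * x.Rhat s j := by
      have := SO3_conj_skew (SO3_transpose hRh) (errVel O G R bω x s j)
      rw [transpose_transpose] at this
      exact this.symm
    rw [e2, Matrix.mul_assoc _ (x.Rhat s j), SO3_mul_transpose hRh, Matrix.mul_one]
    simp only [Matrix.neg_mul, Matrix.mul_add, Matrix.mul_neg, Matrix.mul_assoc]
    rw [add_neg_cancel_left]
  · intro s hs
    have h1 := hx.continuousAt_errVel hO hR hs
    have hX : ContinuousAt (fun s => attErr R x s j) s :=
      continuousAt_pi.2 fun i => continuousAt_pi.2 fun l =>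
        (hx.attErr_ac hR j i l).continuousAt hs
    have hskew : Continuous skew := by
      refine continuous_pi fun a => continuous_pi fun b => ?_
      fin_cases a <;> fin_cases b <;> simp [skew] <;> fun_prop
    have hc : Continuous fun z : Mat3 × Vec3 => (z.1 * skew z.2) i l := by
      have : Continuous fun z : Mat3 × Vec3 => z.1 * skew z.2 :=
        continuous_fst.matrix_mul (hskew.comp continuous_snd)
      exact this.matrix_elem i l
    exact ContinuousAt.comp (g := fun z : Mat3 × Vec3 => (z.1 * skew z.2) i l)
      (f := fun s => (attErr R x s j, errVel O G R bω x s j)) hc.continuousAt (hX.prodMk h1)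

theorem hasDerivAt_biasErr {t : ℝ} {j : ℕ} (ht : t ∈ interior (slice x.dom j)) (i : Fin 3) :
    HasDerivAt (fun s => biasErr bω x s j i)
      (O.γI * ((x.Rhat t j)ᵀ *ᵥ G (attErr R x t j) (x.q t j)) i) t := by
  refine (hx.biasErr_ac j i).hasDerivAt
    (g := fun t => O.γI * ((x.Rhat t j)ᵀ *ᵥ G (attErr R x t j) (x.q t j)) i) ?_ ?_ ht
  · filter_upwards [hx.flow_bhat j] with s hs1 hs
    have hm : (s, j) ∈ x.dom := interior_subset (s := slice x.dom j) hs
    have h2 := hs1 hs i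
    rw [hO.inj_eq _ (hR.1 s (hx.dom_hybrid.le hm)) _ (hx.Rhat_mem s j hm) _ (hx.q_mem s j hm)] at h2
    refine (h2.const_sub (bω i)).congr_deriv ?_
    rw [Pi.neg_apply, Pi.smul_apply, neg_neg, smul_eq_mul, attErr]
  · intro s hs
    have h1 := hx.continuousAt_Rhat hs
    have h3 := hx.continuousAt_field hO hR hs
    have hc : Continuous fun z : Mat3 × Vec3 => O.γI * (z.1ᵀ *ᵥ z.2) i := by
      have : Continuous fun z : Mat3 × Vec3 => z.1ᵀ *ᵥ z.2 :=
        continuous_fst.matrix_transpose.matrix_mulVec continuous_snd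
      exact continuous_const.mul ((continuous_apply i).comp this)
    exact ContinuousAt.comp (g := fun z : Mat3 × Vec3 => O.γI * (z.1ᵀ *ᵥ z.2) i)
      (f := fun s => (x.Rhat s j, G (attErr R x s j) (x.q s j))) hc.continuousAt (h1.prodMk h3)

/-- The potential contributes -2 G·(R̂ b̃) - 2 γ_P |G|², and the bias term, weighted by 1/γ_I,
cancels the indefinite part. -/
theorem hasDerivAt_lyap {t : ℝ} {j : ℕ} (ht : t ∈ interior (slice x.dom j)) :
    HasDerivAt (fun s => lyap O P R bω x s j)
      (-(2 * O.γP * sqNorm (G (attErr R x t j) (x.q t j)))) t := by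
  have hm : (t, j) ∈ x.dom := interior_subset (s := slice x.dom j) ht
  obtain ⟨D, hD, hDω⟩ := hO.potential.deriv _ _ (hx.mem_flowSet hO hR ht)
  have hX : HasDerivAt (fun s => attErr R x s j)
      (attErr R x t j * skew (errVel O G R bω x t j)) t :=
    hasDerivAt_pi.2 fun i => hasDerivAt_pi.2 fun l => hx.hasDerivAt_attErr hO hR ht i l
  have h1 : HasDerivAt (fun s => P (attErr R x s j) (x.q t j))
      (D (attErr R x t j * skew (errVel O G R bω x t j))) t :=
    HasFDerivAt.comp_hasDerivAt (f := fun s => attErr R x s j) t hD hX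
  rw [hDω] at h1
  have hb := hx.hasDerivAt_biasErr hO hR ht
  have h2 : HasDerivAt (fun s => sqNorm (biasErr bω x s j) / O.γI)
      (2 * (biasErr bω x t j ⬝ᵥ ((x.Rhat t j)ᵀ *ᵥ G (attErr R x t j) (x.q t j)))) t := by
    simp only [sqNorm_eq]
    have h3 := ((((hb 0).pow 2).add ((hb 1).pow 2)).add ((hb 2).pow 2)).div_const O.γI
    refine h3.congr_deriv ?_
    have := hO.γI_pos.ne'
    rw [dot_eq]
    field_simp
    norm_num
    ring
  have h4 := h1.add h2
  refine (h4.congr_of_eventuallyEq ?_).congr_deriv ?_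
  · filter_upwards [mem_interior_iff_mem_nhds.1 ht] with s hs
    rw [lyap, hx.q_const j s t hs hm]
    rfl
  · have e : biasErr bω x t j ⬝ᵥ ((x.Rhat t j)ᵀ *ᵥ G (attErr R x t j) (x.q t j)) =
        G (attErr R x t j) (x.q t j) ⬝ᵥ (x.Rhat t j *ᵥ biasErr bω x t j) := by
      rw [dot_mulVec_eq, transpose_transpose, dotProduct_comm]
    rw [e, errVel, dotProduct_neg, dotProduct_add, dotProduct_smul, smul_eq_mul, sqNorm]
    ring

theorem continuousOn_lyap {j : ℕ} {a b : ℝ} (hab : a ≤ b) (hI : Icc a b ⊆ slice x.dom j) :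
    ContinuousOn (fun s => lyap O P R bω x s j) (Icc a b) := by
  have hX : ContinuousOn (fun s => attErr R x s j) (Icc a b) :=
    continuousOn_pi.2 fun i => continuousOn_pi.2 fun l =>
      (hx.attErr_ac hR j i l).continuousOn hab hI
  have hb : ContinuousOn (fun s => biasErr bω x s j) (Icc a b) :=
    continuousOn_pi.2 fun i => (hx.biasErr_ac j i).continuousOn hab hI
  have h1 : ContinuousOn (fun s => P (attErr R x s j) (x.q a j)) (Icc a b) :=
    (hO.potential.cont (x.q a j)).comp_continuousOn hX
  have h2 : ContinuousOn (fun s => sqNorm (biasErr bω x s j) / O.γI) (Icc a b) :=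
    (continuous_sqNorm.comp_continuousOn hb).div_const _
  refine (h1.add h2).congr fun s hs => ?_
  simp only [lyap, Pi.add_apply, hx.q_const j s a (hI hs) (hI (left_mem_Icc.2 hab))]

theorem lyap_le {j : ℕ} {a b : ℝ} (hab : a ≤ b) (ha : (a, j) ∈ x.dom) (hb : (b, j) ∈ x.dom) :
    lyap O P R bω x b j ≤ lyap O P R bω x a j := by
  have hI := hx.dom_hybrid.Icc_subset_slice ha hb
  have hder : ∀ t ∈ interior (Icc a b), HasDerivAt (fun s => lyap O P R bω x s j)
      (-(2 * O.γP * sqNorm (G (attErr R x t j) (x.q t j)))) t := fun t ht =>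
    hx.hasDerivAt_lyap hO hR (interior_mono hI ht)
  refine antitoneOn_of_deriv_nonpos (convex_Icc a b) (hx.continuousOn_lyap hO hR hab hI)
    (fun t ht => (hder t ht).differentiableAt.differentiableWithinAt) (fun t ht => ?_)
    (left_mem_Icc.2 hab) (right_mem_Icc.2 hab) hab
  rw [(hder t ht).deriv]
  have := sqNorm_nonneg (G (attErr R x t j) (x.q t j))
  have := hO.γP_pos
  have : 0 ≤ 2 * O.γP * sqNorm (G (attErr R x t j) (x.q t j)) := by positivity
  linarith

theorem vnorm_field_le {t : ℝ} {j : ℕ} (ht : t ∈ interior (slice x.dom j)) :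
    vnorm (G (attErr R x t j) (x.q t j)) ≤ c₄ :=
  (hO.potential.grad_le _ _ (hx.mem_flowSet hO hR ht)).trans
    (mul_le_of_le_one_right hO.potential.c₄_pos.le
      (attDist_le_one (hx.attErr_mem hR (interior_subset (s := slice x.dom j) ht))))

/-- Membership in the flow set, hence differentiability, is known only at interior times; continuity
up to the end points and the bounded derivative suffice. -/
theorem lyap_ac (j : ℕ) : LocAbsCont (fun s => lyap O P R bω x s j) (slice x.dom j) := by
  intro a b hab hI
  refine absolutelyContinuousOnInterval_of_deriv_bounded (C := 2 * O.γP * c₄ ^ 2) hab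
    (hx.continuousOn_lyap hO hR hab hI) fun t ht => ?_
  have hti : t ∈ interior (slice x.dom j) := interior_mono hI (by rwa [interior_Icc])
  refine ⟨_, ?_, hx.hasDerivAt_lyap hO hR hti⟩
  have hg := hx.vnorm_field_le hO hR hti
  have h2 := pow_le_pow_left₀ (vnorm_nonneg _) hg 2
  rw [vnorm_sq] at h2
  have h3 := sqNorm_nonneg (G (attErr R x t j) (x.q t j))
  have h4 := hO.γP_pos
  rw [abs_neg, abs_of_nonneg (by positivity)]
  exact mul_le_mul_of_nonneg_left h2 (by positivity)

theorem jump_lyap {t : ℝ} {j : ℕ} (h1 : (t, j) ∈ x.dom) (h2 : (t, j + 1) ∈ x.dom) :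
    lyap O P R bω x t (j + 1) + O.δ ≤ lyap O P R bω x t j := by
  rw [lyap, hx.jump_attErr h1 h2, hx.jump_biasErr h1 h2, lyap]
  have hRt := hR.1 t (hx.dom_hybrid.le h1)
  have hRh := hx.Rhat_mem t j h1
  have h3 := hx.jump_set t j h1 h2
  rw [hO.gap_eq hRt hRh (hx.q_mem t j h1), le_sub_sInf_iff _ hO.potential.nonempty] at h3
  obtain ⟨p, hp, h4⟩ := h3
  have h5 := hx.jump_q t j h1 h2 p hp
  rw [hO.pot_eq _ hRt _ hRh _ (hx.q_mem t _ h2), hO.pot_eq _ hRt _ hRh _ hp] at h5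
  simp only [attErr]
  linarith

end

end IsSolution

end Dynamics

/-! ### Estimates for the cross term -/

theorem vnorm_skew_mulVec_le (x y : Vec3) : vnorm (skew x *ᵥ y) ≤ vnorm x * vnorm y := by
  apply vnorm_le_of_sqNorm_le (mul_nonneg (vnorm_nonneg x) (vnorm_nonneg y))
  rw [mul_pow, vnorm_sq, vnorm_sq, skew_mulVec]
  have hc : ∀ i, crossProduct x y i =
      ![x 1 * y 2 - x 2 * y 1, x 2 * y 0 - x 0 * y 2, x 0 * y 1 - x 1 * y 0] i := fun i => by
    rw [cross_apply]
  rw [sqNorm_eq, sqNorm_eq, sqNorm_eq, hc, hc, hc]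
  simp only [Matrix.cons_val]
  nlinarith [sq_nonneg (x 0 * y 0 + x 1 * y 1 + x 2 * y 2)]

theorem sqNorm_mulVec_le (M : Mat3) (z : Vec3) :
    sqNorm (M *ᵥ z) ≤ frobInner M M * sqNorm z := by
  have h : ∀ i, (M *ᵥ z) i ^ 2 ≤ sqNorm (M i) * sqNorm z := fun i => dot_sq_le (M i) z
  have hf : frobInner M M = sqNorm (M 0) + sqNorm (M 1) + sqNorm (M 2) := by
    simp only [frobInner, Matrix.trace, Matrix.diag, Fin.sum_univ_three, mul_eq, transpose_apply,
      sqNorm_eq]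
    ring
  rw [sqNorm_eq, hf]
  nlinarith [h 0, h 1, h 2]

/-- The Frobenius norm of I - X is √8 |X|_I, and √8 ≤ 3. -/
theorem vnorm_sub_mulVec_le (X : Mat3) (z : Vec3) :
    vnorm (z - X *ᵥ z) ≤ 3 * attDist X * vnorm z := by
  have hd := attDist_nonneg X
  have hz := vnorm_nonneg z
  apply vnorm_le_of_sqNorm_le (by positivity)
  have h1 : z - X *ᵥ z = (1 - X) *ᵥ z := by rw [sub_mulVec, one_mulVec]
  have h2 : frobInner (1 - X) (1 - X) = 8 * attDist X ^ 2 := by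
    rw [attDist, Real.sq_sqrt (by positivity), frobNorm_sq]; ring
  rw [h1, mul_pow, mul_pow, vnorm_sq]
  refine (sqNorm_mulVec_le _ z).trans ?_
  rw [h2]
  exact mul_le_mul_of_nonneg_right (by nlinarith [sq_nonneg (attDist X)]) (sqNorm_nonneg z)

theorem attDist_transpose {X : Mat3} (hX : X ∈ SO3) : attDist Xᵀ = attDist X := by
  have h : attDist Xᵀ ^ 2 = attDist X ^ 2 := by
    rw [attDist_sq hX, attDist_sq (SO3_transpose hX), trace_sub, trace_sub, trace_transpose]
  exact (pow_left_inj₀ (attDist_nonneg _) (attDist_nonneg _) two_ne_zero).1 h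

theorem vnorm_psi_le (X : Mat3) : vnorm (psi X) ≤ 2 * attDist X := by
  apply vnorm_le_of_sqNorm_le (by have := attDist_nonneg X; positivity)
  have h1 : 4 * sqNorm (psi X) ≤ 2 * frobInner (1 - X) (1 - X) := by
    obtain ⟨h0, h1, h2⟩ := psi_apply X
    rw [sqNorm_eq, h0, h1, h2]
    simp only [frobInner, Matrix.trace, Matrix.diag, Fin.sum_univ_three, mul_eq, transpose_apply,
      Matrix.sub_apply]
    simp only [Matrix.one_apply, Fin.isValue, ↓reduceIte, Fin.reduceEq, one_ne_zero, zero_ne_one]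
    nlinarith [sq_nonneg (X 2 1 + X 1 2), sq_nonneg (X 0 2 + X 2 0), sq_nonneg (X 1 0 + X 0 1),
      sq_nonneg (1 - X 0 0), sq_nonneg (1 - X 1 1), sq_nonneg (1 - X 2 2)]
  have h2 : frobInner (1 - X) (1 - X) = 8 * attDist X ^ 2 := by
    rw [attDist, Real.sq_sqrt (by positivity), frobNorm_sq]; ring
  rw [h2] at h1
  rw [mul_pow]
  linarith

/-- At R̃ = I the bias part of the velocity gives exactly -‖b‖². Replacing R̃ by I costs (3 + 2 +
3/2) d ‖b‖² and (1 + 2 + 3/2) γ_P c₄ d ‖b‖ with d = |R̃|_I ≤ 1; the bound ‖b‖ ≤ B makes the first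
bilinear in d and ‖b‖, and the constants are rounded up to 7 and 5. The term 2 c comes from ω. -/
theorem cross_term_le {R Rhat : Mat3} (hR : R ∈ SO3) (hRh : Rhat ∈ SO3) {b g w : Vec3}
    {γP γI c c₄ B : ℝ} (hγP : 0 < γP) (hγI : 0 < γI) (hc₄ : 0 < c₄)
    (hg : vnorm g ≤ c₄ * attDist (R * Rhatᵀ)) (hw : vnorm w ≤ c) (hb : vnorm b ≤ B) :
    (R *ᵥ (skew w *ᵥ b) + γI • ((R * Rhatᵀ) *ᵥ g)) ⬝ᵥ psi (R * Rhatᵀ) +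
        (R *ᵥ b) ⬝ᵥ psi (R * Rhatᵀ * skew (-(Rhat *ᵥ b + γP • g))) ≤
      -sqNorm b + (2 * c + 7 * B + 5 * γP * c₄) * attDist (R * Rhatᵀ) * vnorm b +
        2 * γI * c₄ * attDist (R * Rhatᵀ) ^ 2 := by
  have hX : R * Rhatᵀ ∈ SO3 := SO3_mul hR (SO3_transpose hRh)
  have hXt := SO3_transpose hX
  have hRhb : Rhat *ᵥ b = (R * Rhatᵀ)ᵀ *ᵥ (R *ᵥ b) := by
    rw [transpose_mul, transpose_transpose, mulVec_mulVec, Matrix.mul_assoc, SO3_transpose_mul hR,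
      Matrix.mul_one]
  have hT1 : (R *ᵥ (skew w *ᵥ b)) ⬝ᵥ psi (R * Rhatᵀ) ≤
      c * vnorm b * (2 * attDist (R * Rhatᵀ)) := by
    refine (dot_le _ _).trans ?_
    rw [SO3_vnorm hR]
    refine mul_le_mul ((vnorm_skew_mulVec_le w b).trans
      (mul_le_mul_of_nonneg_right hw (vnorm_nonneg b))) (vnorm_psi_le _) (vnorm_nonneg _)
      (mul_nonneg ((vnorm_nonneg w).trans hw) (vnorm_nonneg b))
  have hT2 : ((R * Rhatᵀ) *ᵥ g) ⬝ᵥ psi (R * Rhatᵀ) ≤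
      c₄ * attDist (R * Rhatᵀ) * (2 * attDist (R * Rhatᵀ)) := by
    refine (dot_le _ _).trans ?_
    rw [SO3_vnorm hX]
    exact mul_le_mul hg (vnorm_psi_le _) (vnorm_nonneg _) ((vnorm_nonneg g).trans hg)
  have htr : (R * Rhatᵀ).trace = 3 - 4 * attDist (R * Rhatᵀ) ^ 2 := by
    rw [attDist_sq hX, trace_sub, trace_one]; simp; ring
  have hzn : vnorm (R *ᵥ b) = vnorm b := SO3_vnorm hR b
  rw [hRhb, psi_mul_skew, add_dotProduct, smul_dotProduct, smul_eq_mul, dotProduct_smul, smul_eq_mul,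
    dotProduct_sub, dotProduct_smul, smul_eq_mul, htr]
  set X := R * Rhatᵀ
  set z := R *ᵥ b
  set d := attDist X
  set y := -(Xᵀ *ᵥ z + γP • g)
  have hd0 : 0 ≤ d := attDist_nonneg X
  have hd1 : d ≤ 1 := attDist_le_one hX
  have hs0 := vnorm_nonneg b
  have hB0 : 0 ≤ B := hs0.trans hb
  have hy : vnorm y ≤ vnorm b + γP * c₄ * d := by
    rw [vnorm_neg]
    refine (vnorm_add_le _ _).trans ?_
    rw [SO3_vnorm hXt, hzn, vnorm_smul, abs_of_pos hγP]
    nlinarith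
  have hzz : z ⬝ᵥ z = sqNorm b := by rw [← SO3_sqNorm hR b]; rfl
  have hT3 : z ⬝ᵥ y ≤ -sqNorm b + 3 * d * vnorm b ^ 2 + γP * c₄ * d * vnorm b := by
    have e1 : z ⬝ᵥ y = -sqNorm b + z ⬝ᵥ (z - Xᵀ *ᵥ z) - γP * (z ⬝ᵥ g) := by
      rw [dotProduct_neg, dotProduct_add, dotProduct_smul, dotProduct_sub, hzz, smul_eq_mul]; ring
    have h1 := (dot_le z (z - Xᵀ *ᵥ z)).trans
      (mul_le_mul_of_nonneg_left (vnorm_sub_mulVec_le Xᵀ z) (vnorm_nonneg z))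
    rw [attDist_transpose hX, hzn] at h1
    have h2 : -(z ⬝ᵥ g) ≤ vnorm b * (c₄ * d) := by
      refine (neg_le_abs _).trans ((abs_dot_le z g).trans ?_)
      rw [hzn]
      exact mul_le_mul_of_nonneg_left hg hs0
    rw [e1]
    nlinarith [mul_le_mul_of_nonneg_left h2 hγP.le]
  have hT4 : |z ⬝ᵥ y| ≤ vnorm b * (vnorm b + γP * c₄ * d) := by
    refine (abs_dot_le z y).trans ?_
    rw [hzn]
    exact mul_le_mul_of_nonneg_left hy hs0
  have hT5 : z ⬝ᵥ (y - Xᵀ *ᵥ y) ≤ vnorm b * (3 * d * (vnorm b + γP * c₄ * d)) := by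
    refine (dot_le _ _).trans ?_
    rw [hzn]
    refine mul_le_mul_of_nonneg_left ((vnorm_sub_mulVec_le Xᵀ y).trans ?_) hs0
    rw [attDist_transpose hX]
    exact mul_le_mul_of_nonneg_left hy (by positivity)
  have hT6 : -(2 * d ^ 2 * (z ⬝ᵥ y)) ≤ 2 * d * (vnorm b * (vnorm b + γP * c₄ * d)) := by
    have h1 : -(z ⬝ᵥ y) ≤ vnorm b * (vnorm b + γP * c₄ * d) := (neg_le_abs _).trans hT4
    have h2 : 0 ≤ vnorm b * (vnorm b + γP * c₄ * d) := (abs_nonneg _).trans hT4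
    calc -(2 * d ^ 2 * (z ⬝ᵥ y)) = 2 * d ^ 2 * -(z ⬝ᵥ y) := by ring
      _ ≤ 2 * d ^ 2 * (vnorm b * (vnorm b + γP * c₄ * d)) :=
        mul_le_mul_of_nonneg_left h1 (by positivity)
      _ ≤ 2 * d * (vnorm b * (vnorm b + γP * c₄ * d)) :=
        mul_le_mul_of_nonneg_right (by nlinarith) h2
  have hT7 : d * vnorm b * vnorm b ≤ B * d * vnorm b := by
    have := mul_le_mul_of_nonneg_left hb (mul_nonneg hd0 hs0)
    linarith
  have hT8 : γP * c₄ * (d * (d * vnorm b)) ≤ γP * c₄ * (d * vnorm b) :=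
    mul_le_mul_of_nonneg_left (mul_le_of_le_one_left (mul_nonneg hd0 hs0) hd1) (by positivity)
  have e2 : 1 / 2 * ((3 - 4 * d ^ 2) * (z ⬝ᵥ y) - z ⬝ᵥ Xᵀ *ᵥ y) =
      z ⬝ᵥ y + -(2 * d ^ 2 * (z ⬝ᵥ y)) + 1 / 2 * (z ⬝ᵥ (y - Xᵀ *ᵥ y)) := by
    rw [dotProduct_sub]; ring
  rw [e2]
  have hT2' := mul_le_mul_of_nonneg_left hT2 hγI.le
  have hP : 0 ≤ γP * c₄ * (d * vnorm b) := by positivity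
  have hBd : 0 ≤ B * d * vnorm b := by positivity
  nlinarith

/-! ### Exponential stability -/

section Stability

variable {Y : Type} {O : HybridObserver Y} {h : Mat3 → Y} {P : Mat3 → ℕ → ℝ}
  {G : Mat3 → ℕ → Vec3} {c₁ c₂ c₃ c₄ : ℝ}
  {t0 : ℝ} {R : ℝ → Mat3} {ω : ℝ → Vec3} {bω : Vec3} {x : HybridArc}

/-- The cross term `b̃ᵀ Rᵀ ψ(R̃)`. -/
noncomputable def crossTerm (R : ℝ → Mat3) (bω : Vec3) (x : HybridArc) (t : ℝ) (j : ℕ) : ℝ :=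
  (R t *ᵥ biasErr bω x t j) ⬝ᵥ psi (attErr R x t j)

theorem errNorm_sq (t : ℝ) (j : ℕ) : errNorm R bω x t j ^ 2 =
    attDist (attErr R x t j) ^ 2 + sqNorm (biasErr bω x t j) := by
  rw [errNorm, Real.sq_sqrt (by positivity), vnorm_sq]
  rfl

theorem errNorm_nonneg (t : ℝ) (j : ℕ) : 0 ≤ errNorm R bω x t j := Real.sqrt_nonneg _

theorem hasDerivAt_psi {Z : ℝ → Mat3} {Z' : Mat3} {t : ℝ}
    (hZ : ∀ i l, HasDerivAt (fun s => Z s i l) (Z' i l) t) (i : Fin 3) :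
    HasDerivAt (fun s => psi (Z s) i) (psi Z' i) t := by
  fin_cases i
  · exact ((hZ 2 1).sub (hZ 1 2)).const_mul (1 / 2 : ℝ)
  · exact ((hZ 0 2).sub (hZ 2 0)).const_mul (1 / 2 : ℝ)
  · exact ((hZ 1 0).sub (hZ 0 1)).const_mul (1 / 2 : ℝ)

theorem LocAbsCont.psi {Z : ℝ → Mat3} {I : Set ℝ}
    (hZ : ∀ i l, LocAbsCont (fun s => Z s i l) I) (i : Fin 3) :
    LocAbsCont (fun s => psi (Z s) i) I := by
  fin_cases i
  · exact (LocAbsCont.const (1 / 2 : ℝ)).mul ((hZ 2 1).sub (hZ 1 2))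
  · exact (LocAbsCont.const (1 / 2 : ℝ)).mul ((hZ 0 2).sub (hZ 2 0))
  · exact (LocAbsCont.const (1 / 2 : ℝ)).mul ((hZ 1 0).sub (hZ 0 1))

namespace IsSolution

section

variable (hx : IsSolution O (fun t => h (R t)) (fun t => ω t + bω) t0 x)
  (hR : IsAttitudeTrajectory t0 R ω)

include hx hR

theorem crossTerm_ac (j : ℕ) : LocAbsCont (fun t => crossTerm R bω x t j) (slice x.dom j) := by
  have hz : ∀ i, LocAbsCont (fun t => (R t *ᵥ biasErr bω x t j) i) (slice x.dom j) := by
    intro i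
    simp only [mulVec_eq]
    have hRa := fun l => (hR.2.1 i l).mono (hx.slice_subset j)
    exact (((hRa 0).mul (hx.biasErr_ac j 0)).add ((hRa 1).mul (hx.biasErr_ac j 1))).add
      ((hRa 2).mul (hx.biasErr_ac j 2))
  have hp := LocAbsCont.psi (hx.attErr_ac hR j)
  simp only [crossTerm, dot_eq]
  exact (((hz 0).mul (hp 0)).add ((hz 1).mul (hp 1))).add ((hz 2).mul (hp 2))

theorem abs_crossTerm_le {t : ℝ} {j : ℕ} (ht : (t, j) ∈ x.dom) :
    |crossTerm R bω x t j| ≤ errNorm R bω x t j ^ 2 := by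
  have h1 := abs_dot_le (R t *ᵥ biasErr bω x t j) (psi (attErr R x t j))
  rw [SO3_vnorm (hR.1 t (hx.dom_hybrid.le ht))] at h1
  have h2 := vnorm_psi_le (attErr R x t j)
  have h3 := mul_le_mul_of_nonneg_left h2 (vnorm_nonneg (biasErr bω x t j))
  rw [crossTerm, errNorm_sq, ← vnorm_sq]
  nlinarith [sq_nonneg (vnorm (biasErr bω x t j) - attDist (attErr R x t j))]

end

section

variable (hO : Realizes O h P G c₁ c₂ c₃ c₄)
  (hx : IsSolution O (fun t => h (R t)) (fun t => ω t + bω) t0 x)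
  (hR : IsAttitudeTrajectory t0 R ω)

include hO hx hR

theorem le_lyap {t : ℝ} {j : ℕ} (ht : (t, j) ∈ x.dom) :
    min c₁ (1 / O.γI) * errNorm R bω x t j ^ 2 ≤ lyap O P R bω x t j := by
  have h1 := hO.potential.le_pot _ (hx.attErr_mem hR ht) _ (hx.q_mem t j ht)
  rw [errNorm_sq, lyap, mul_add, div_eq_mul_one_div (sqNorm _), mul_comm (sqNorm _)]
  exact add_le_add ((mul_le_mul_of_nonneg_right (min_le_left _ _) (sq_nonneg _)).trans h1)
    (mul_le_mul_of_nonneg_right (min_le_right _ _) (sqNorm_nonneg _))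

theorem lyap_le_errNorm {t : ℝ} {j : ℕ} (ht : (t, j) ∈ x.dom) :
    lyap O P R bω x t j ≤ max c₂ (1 / O.γI) * errNorm R bω x t j ^ 2 := by
  have h1 := hO.potential.pot_le _ (hx.attErr_mem hR ht) _ (hx.q_mem t j ht)
  rw [errNorm_sq, lyap, mul_add, div_eq_mul_one_div (sqNorm _), mul_comm (sqNorm _)]
  exact add_le_add (h1.trans (mul_le_mul_of_nonneg_right (le_max_left _ _) (sq_nonneg _)))
    (mul_le_mul_of_nonneg_right (le_max_right _ _) (sqNorm_nonneg _))

theorem lyap_add_le {t : ℝ} {j : ℕ} (ht : (t, j) ∈ x.dom) :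
    lyap O P R bω x t j + j * O.δ ≤ lyap O P R bω x t0 0 :=
  hx.dom_hybrid.le_of_decreasing (f := fun t j => lyap O P R bω x t j)
    (fun _ _ _ hst hs ht => hx.lyap_le hO hR hst hs ht)
    (fun _ _ h1 h2 => hx.jump_lyap hO hR h1 h2) ht

theorem sqNorm_biasErr_le {t : ℝ} {j : ℕ} (ht : (t, j) ∈ x.dom) {r : ℝ}
    (hr : errNorm R bω x t0 0 ≤ r) :
    sqNorm (biasErr bω x t j) ≤ O.γI * max c₂ (1 / O.γI) * r ^ 2 := by
  have h1 := hx.lyap_add_le hO hR ht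
  have h2 := hx.lyap_le_errNorm hO hR hx.dom_hybrid.start_mem
  have h3 := hO.potential.le_pot _ (hx.attErr_mem hR ht) _ (hx.q_mem t j ht)
  have hγ := hO.γI_pos
  have h4 : errNorm R bω x t0 0 ^ 2 ≤ r ^ 2 := pow_le_pow_left₀ (errNorm_nonneg _ _) hr 2
  have h5 : 0 ≤ c₁ * attDist (attErr R x t j) ^ 2 :=
    mul_nonneg hO.potential.c₁_pos.le (sq_nonneg _)
  have h6 : 0 ≤ (j : ℝ) * O.δ := mul_nonneg (Nat.cast_nonneg j) hO.potential.δ_pos.le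
  have h7 : max c₂ (1 / O.γI) * errNorm R bω x t0 0 ^ 2 ≤ max c₂ (1 / O.γI) * r ^ 2 :=
    mul_le_mul_of_nonneg_left h4 (hO.potential.c₂_pos.le.trans (le_max_left _ _))
  have h8 : sqNorm (biasErr bω x t j) / O.γI ≤ max c₂ (1 / O.γI) * r ^ 2 := by
    rw [lyap] at h1
    linarith
  rw [div_le_iff₀ hγ] at h8
  linarith

/-- R itself is differentiated here, so ω appears and the formula holds only almost everywhere. -/
theorem hasDerivAt_crossTerm (j : ℕ) : ∀ᵐ t : ℝ, t ∈ interior (slice x.dom j) →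
    HasDerivAt (fun s => crossTerm R bω x s j)
      ((R t *ᵥ (skew (ω t) *ᵥ biasErr bω x t j) +
          O.γI • (attErr R x t j *ᵥ G (attErr R x t j) (x.q t j))) ⬝ᵥ psi (attErr R x t j) +
        (R t *ᵥ biasErr bω x t j) ⬝ᵥ
          psi (attErr R x t j * skew (errVel O G R bω x t j))) t := by
  filter_upwards [hR.2.2] with t ht1 ht
  have hm : (t, j) ∈ x.dom := interior_subset (s := slice x.dom j) ht
  have hRd := ht1 (hx.dom_hybrid.le hm)
  have hb := hx.hasDerivAt_biasErr hO hR ht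
  have hX := hx.hasDerivAt_attErr hO hR ht
  have hp := hasDerivAt_psi hX
  have hz : ∀ i, HasDerivAt (fun s => (R s *ᵥ biasErr bω x s j) i)
      ((R t *ᵥ (skew (ω t) *ᵥ biasErr bω x t j) +
          O.γI • (attErr R x t j *ᵥ G (attErr R x t j) (x.q t j))) i) t := by
    intro i
    have h1 : HasDerivAt (fun s => ∑ m, R s i m * biasErr bω x s j m)
        (∑ m, ((R t * skew (ω t)) i m * biasErr bω x t j m + R t i m *
          (O.γI * ((x.Rhat t j)ᵀ *ᵥ G (attErr R x t j) (x.q t j)) m))) t :=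
      HasDerivAt.fun_sum fun m _ => (hRd i m).mul (hb m)
    refine h1.congr_deriv ?_
    have e : attErr R x t j *ᵥ G (attErr R x t j) (x.q t j) =
        R t *ᵥ ((x.Rhat t j)ᵀ *ᵥ G (attErr R x t j) (x.q t j)) := by
      rw [mulVec_mulVec]; rfl
    rw [e, mulVec_mulVec, ← mulVec_smul, Finset.sum_add_distrib]
    rfl
  simp only [crossTerm, dot_eq]
  have := (((hz 0).mul (hp 0)).add ((hz 1).mul (hp 1))).add ((hz 2).mul (hp 2))
  refine this.congr_deriv ?_
  ring

end

end IsSolution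

/-- The local exponential estimate along flows for the Lyapunov function with the cross term. -/
theorem Realizes.exists_strict_lyapunov (hO : Realizes O h P G c₁ c₂ c₃ c₄) (r c : ℝ)
    (hc : 0 < c) : ∃ ε ν : ℝ, 0 < ε ∧ 0 < ν ∧ ε ≤ min c₁ (1 / O.γI) / 2 ∧
    ∀ (t0 : ℝ) (R : ℝ → Mat3) (ω : ℝ → Vec3) (bω : Vec3) (x : HybridArc),
      IsAttitudeTrajectory t0 R ω → (∀ t, t0 ≤ t → vnorm (ω t) ≤ c) →
      IsSolution O (fun t => h (R t)) (fun t => ω t + bω) t0 x →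
      errNorm R bω x t0 0 ≤ r → ∀ j, ∀ᵐ t : ℝ, t ∈ interior (slice x.dom j) →
        ∃ D, D ≤ -ν * (lyap O P R bω x t j + ε * crossTerm R bω x t j) ∧
          HasDerivAt (fun s => lyap O P R bω x s j + ε * crossTerm R bω x s j) D t := by
  have hγP := hO.γP_pos
  have hγI := hO.γI_pos
  have hc₃ := hO.potential.c₃_pos
  have hc₄ := hO.potential.c₄_pos
  have hc₁ := hO.potential.c₁_pos
  have hc₂ := hO.potential.c₂_pos
  set m₁ := min c₁ (1 / O.γI) with hm₁
  set m₂ := max c₂ (1 / O.γI) with hm₂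
  have hm₁0 : 0 < m₁ := lt_min hc₁ (by positivity)
  have hm₂0 : 0 < m₂ := lt_max_of_lt_left hc₂
  have hm₁₂ : m₁ ≤ m₂ := (min_le_right _ _).trans (le_max_right _ _)
  -- A bound for the bias error along the whole solution, from the monotonicity of `lyap`.
  set B := √(O.γI * m₂ * r ^ 2)
  have hB : 0 ≤ B := Real.sqrt_nonneg _
  set M := 2 * c + 7 * B + 5 * O.γP * c₄
  set κ := O.γP * c₃
  have hκ : 0 < κ := mul_pos hγP hc₃
  set C := M ^ 2 / 2 + 2 * O.γI * c₄
  have hC : 0 < C := by positivity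
  -- The first bound lets the dissipation -2 κ d² absorb ε C d² and retain half of itself; the
  -- second keeps the modified function comparable with the squared error.
  set ε := min (κ / C) (m₁ / 2)
  have hε : 0 < ε := lt_min (by positivity) (by positivity)
  have hεm : ε ≤ m₁ / 2 := min_le_right _ _
  have hεC : ε * C ≤ κ := (le_div_iff₀ hC).1 (min_le_left _ _)
  refine ⟨ε, min κ (ε / 2) / (2 * m₂), hε, div_pos (lt_min hκ (by positivity)) (by positivity),
    hεm, fun t0 R ω bω x hR hω hx hr j => ?_⟩
  filter_upwards [hx.hasDerivAt_crossTerm hO hR j] with t hχ ht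
  have hm : (t, j) ∈ x.dom := interior_subset (s := slice x.dom j) ht
  have ht0 := hx.dom_hybrid.le hm
  have hV := hx.hasDerivAt_lyap hO hR ht
  refine ⟨_, ?_, hV.add ((hχ ht).const_mul ε)⟩
  have hfl := hx.mem_flowSet hO hR ht
  have h1 := hO.potential.le_grad _ _ hfl
  have h2 := hO.potential.grad_le _ _ hfl
  have hb : vnorm (biasErr bω x t j) ≤ B :=
    Real.sqrt_le_sqrt (hx.sqNorm_biasErr_le hO hR hm hr)
  have h3 := cross_term_le (hR.1 t ht0) (hx.Rhat_mem t j hm) hγP hγI hc₄ h2 (hω t ht0) hb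
  have h4 := hx.lyap_le_errNorm hO hR hm
  have h5 := le_of_abs_le (hx.abs_crossTerm_le hR hm)
  rw [errNorm_sq] at h4 h5
  have h3' : (R t *ᵥ (skew (ω t) *ᵥ biasErr bω x t j) +
          O.γI • (attErr R x t j *ᵥ G (attErr R x t j) (x.q t j))) ⬝ᵥ psi (attErr R x t j) +
        (R t *ᵥ biasErr bω x t j) ⬝ᵥ
          psi (attErr R x t j * skew (errVel O G R bω x t j)) ≤
      -sqNorm (biasErr bω x t j) + M * attDist (attErr R x t j) * vnorm (biasErr bω x t j) +
        2 * O.γI * c₄ * attDist (attErr R x t j) ^ 2 := h3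
  have hs := vnorm_sq (biasErr bω x t j)
  have hs0 := sqNorm_nonneg (biasErr bω x t j)
  set χ' := (R t *ᵥ (skew (ω t) *ᵥ biasErr bω x t j) +
          O.γI • (attErr R x t j *ᵥ G (attErr R x t j) (x.q t j))) ⬝ᵥ psi (attErr R x t j) +
        (R t *ᵥ biasErr bω x t j) ⬝ᵥ
          psi (attErr R x t j * skew (errVel O G R bω x t j))
  set d := attDist (attErr R x t j)
  set s := vnorm (biasErr bω x t j)
  set S := sqNorm (biasErr bω x t j)
  -- Young's inequality for the mixed term M d ‖b̃‖, which uses up half of -‖b̃‖².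
  have h6 : χ' ≤ -(1 / 2) * S + C * d ^ 2 := by
    have := sq_nonneg (s - M * d)
    have e : C * d ^ 2 = M ^ 2 / 2 * d ^ 2 + 2 * O.γI * c₄ * d ^ 2 := by ring
    rw [e]
    nlinarith
  have h7 : ε * χ' ≤ -(ε / 2) * S + κ * d ^ 2 := by
    have := mul_le_mul_of_nonneg_left h6 hε.le
    nlinarith [mul_le_mul_of_nonneg_right hεC (sq_nonneg d)]
  have h8 : -(2 * O.γP * sqNorm (G (attErr R x t j) (x.q t j))) ≤ -(2 * (κ * d ^ 2)) := by
    have := mul_le_mul_of_nonneg_left h1 hγP.le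
    have e : κ * d ^ 2 = O.γP * (c₃ * d ^ 2) := by ring
    rw [e]; linarith
  have h9 : lyap O P R bω x t j + ε * crossTerm R bω x t j ≤ 2 * m₂ * (d ^ 2 + S) := by
    have a1 := mul_le_mul_of_nonneg_left h5 hε.le
    have a2 := mul_le_mul_of_nonneg_right (hεm.trans (by linarith : m₁ / 2 ≤ m₂))
      (add_nonneg (sq_nonneg d) hs0)
    linarith
  have h10 : min κ (ε / 2) / (2 * m₂) * (lyap O P R bω x t j + ε * crossTerm R bω x t j) ≤
      min κ (ε / 2) * (d ^ 2 + S) := by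
    have := mul_le_mul_of_nonneg_left h9
      (show 0 ≤ min κ (ε / 2) / (2 * m₂) from
        div_nonneg (le_min hκ.le (by positivity)) (by positivity))
    refine this.trans_eq ?_
    field_simp
  have h11 : min κ (ε / 2) * (d ^ 2 + S) ≤ κ * d ^ 2 + ε / 2 * S := by
    rw [mul_add]
    exact add_le_add (mul_le_mul_of_nonneg_right (min_le_left _ _) (sq_nonneg d))
      (mul_le_mul_of_nonneg_right (min_le_right _ _) hs0)
  rw [neg_mul]
  linarith

/-- The exponentially weighted function is absolutely continuous with nonpositive derivative almost
everywhere along flows. Jumps do not change the cross term and lower the potential, so the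
monotonicity passes through them. -/
theorem IsSolution.strict_lyapunov_decay (hO : Realizes O h P G c₁ c₂ c₃ c₄)
    (hx : IsSolution O (fun t => h (R t)) (fun t => ω t + bω) t0 x)
    (hR : IsAttitudeTrajectory t0 R ω) {ε ν : ℝ}
    (hd : ∀ j, ∀ᵐ t : ℝ, t ∈ interior (slice x.dom j) →
        ∃ D, D ≤ -ν * (lyap O P R bω x t j + ε * crossTerm R bω x t j) ∧
          HasDerivAt (fun s => lyap O P R bω x s j + ε * crossTerm R bω x s j) D t)
    {t : ℝ} {j : ℕ} (ht : (t, j) ∈ x.dom) :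
    Real.exp (ν * (t - t0)) * (lyap O P R bω x t j + ε * crossTerm R bω x t j) ≤
      lyap O P R bω x t0 0 + ε * crossTerm R bω x t0 0 := by
  have key := hx.dom_hybrid.le_of_decreasing (δ := 0)
    (f := fun t j => Real.exp (ν * (t - t0)) * (lyap O P R bω x t j + ε * crossTerm R bω x t j))
    (fun j s t hst hs ht => ?_) (fun t j h1 h2 => ?_) ht
  · simpa using key
  · have hI := hx.dom_hybrid.Icc_subset_slice hs ht
    have hexp : LocAbsCont (fun t => Real.exp (ν * (t - t0))) (slice x.dom j) := fun a b _ _ =>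
      ContDiffOn.absolutelyContinuousOnInterval (ContDiff.contDiffOn (by fun_prop))
    have hac := hexp.mul ((hx.lyap_ac hO hR j).add
      ((LocAbsCont.const ε).mul (hx.crossTerm_ac hR j)))
    have := sub_le_of_ae_deriv_le (C := 0) hst (hac s t hst hI) <| by
      filter_upwards [hd j] with a ha hmem
      obtain ⟨D, hD, hder⟩ := ha (interior_mono hI (by rwa [interior_Icc]))
      have he : HasDerivAt (fun t => Real.exp (ν * (t - t0)))
          (Real.exp (ν * (a - t0)) * (ν * 1)) a :=
        (((hasDerivAt_id a).sub_const t0).const_mul ν).exp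
      refine ⟨_, ?_, he.mul hder⟩
      have := mul_le_mul_of_nonneg_left hD (Real.exp_pos (ν * (a - t0))).le
      linarith
    linarith
  · have h3 := hx.jump_lyap hO hR h1 h2
    have h4 : crossTerm R bω x t (j + 1) = crossTerm R bω x t j := by
      rw [crossTerm, hx.jump_attErr h1 h2, hx.jump_biasErr h1 h2, crossTerm]
    have h5 := hO.potential.δ_pos
    rw [add_zero, h4]
    exact mul_le_mul_of_nonneg_left (by linarith) (Real.exp_pos _).le

theorem Realizes.exists_exponential_bound (hO : Realizes O h P G c₁ c₂ c₃ c₄) :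
    ∃ K : ℝ, 0 < K ∧ ∀ r c : ℝ, 0 < r → 0 < c → ∃ (N : ℕ) (μ : ℝ), 0 < μ ∧
    ∀ (t0 : ℝ) (R : ℝ → Mat3) (ω : ℝ → Vec3) (bω : Vec3) (x : HybridArc),
      IsAttitudeTrajectory t0 R ω → (∀ t, t0 ≤ t → vnorm (ω t) ≤ c) →
      IsSolution O (fun t => h (R t)) (fun t => ω t + bω) t0 x →
      errNorm R bω x t0 0 ≤ r →
      ∀ t j, (t, j) ∈ x.dom → j ≤ N ∧
        errNorm R bω x t j ≤ K * Real.exp (-μ * (t - t0 + (j : ℝ))) * errNorm R bω x t0 0 := by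
  have hγI := hO.γI_pos
  have hδ := hO.potential.δ_pos
  have hm₁0 : 0 < min c₁ (1 / O.γI) := lt_min hO.potential.c₁_pos (by positivity)
  have hm₂0 : 0 < max c₂ (1 / O.γI) := lt_max_of_lt_left hO.potential.c₂_pos
  have hm₁₂ : min c₁ (1 / O.γI) ≤ max c₂ (1 / O.γI) := (min_le_right _ _).trans (le_max_right _ _)
  set m₁ := min c₁ (1 / O.γI)
  set m₂ := max c₂ (1 / O.γI)
  -- The root compares the upper bound 2 m₂ e² at the start with the lower bound m₁ e² / 2 later;
  -- the factor exp 1 pays for counting jumps in the exponent. Neither involves r or c.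
  refine ⟨√(4 * m₂ / m₁) * Real.exp 1, by positivity, fun r c hr hc => ?_⟩
  obtain ⟨ε, ν, hε, hν, hεm, hdec⟩ := hO.exists_strict_lyapunov r c hc
  change ε ≤ m₁ / 2 at hεm
  -- `lyap` starts below m₂ r², stays nonnegative and loses at least δ per jump.
  set N := ⌈m₂ * r ^ 2 / O.δ⌉₊
  have hN1 : (0 : ℝ) < N + 1 := by positivity
  -- The first bound is half of ν because the Lyapunov function is quadratic in the error. The
  -- second gives μ j ≤ 1 for every j ≤ N.
  refine ⟨N, min (ν / 2) (1 / (N + 1)), lt_min (by positivity) (by positivity),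
    fun t0 R ω bω x hR hω hx h0 t j ht => ?_⟩
  set μ := min (ν / 2) (1 / ((N : ℝ) + 1))
  have hμ : 0 < μ := lt_min (by positivity) (by positivity)
  have hst := hx.dom_hybrid.start_mem
  have ht0 := hx.dom_hybrid.le ht
  have he0 := errNorm_nonneg (R := R) (bω := bω) (x := x) t0 0
  have het := errNorm_nonneg (R := R) (bω := bω) (x := x) t j
  have hj : j ≤ N := by
    have h1 := hx.lyap_add_le hO hR ht
    have h2 := hx.le_lyap hO hR ht
    have h3 := hx.lyap_le_errNorm hO hR hst
    have h4 : m₂ * errNorm R bω x t0 0 ^ 2 ≤ m₂ * r ^ 2 :=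
      mul_le_mul_of_nonneg_left (pow_le_pow_left₀ he0 h0 2) hm₂0.le
    have h5 : (j : ℝ) ≤ m₂ * r ^ 2 / O.δ := by
      rw [le_div_iff₀ hδ]
      have : 0 ≤ m₁ * errNorm R bω x t j ^ 2 := by positivity
      linarith
    exact_mod_cast h5.trans (Nat.le_ceil _)
  refine ⟨hj, ?_⟩
  have h1 := hx.strict_lyapunov_decay hO hR (hdec t0 R ω bω x hR hω hx h0) ht
  have h2 := hx.le_lyap hO hR ht
  have h3 := hx.lyap_le_errNorm hO hR hst
  have h4 := hx.abs_crossTerm_le hR ht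
  have h5 := hx.abs_crossTerm_le hR hst
  have h6 : m₁ / 2 * errNorm R bω x t j ^ 2 ≤
      lyap O P R bω x t j + ε * crossTerm R bω x t j := by
    have := mul_le_mul_of_nonneg_left (neg_le_of_abs_le h4) hε.le
    nlinarith [mul_le_mul_of_nonneg_right hεm (sq_nonneg (errNorm R bω x t j))]
  have h7 : lyap O P R bω x t0 0 + ε * crossTerm R bω x t0 0 ≤
      2 * m₂ * errNorm R bω x t0 0 ^ 2 := by
    have := mul_le_mul_of_nonneg_left (le_of_abs_le h5) hε.le
    nlinarith [mul_le_mul_of_nonneg_right (hεm.trans (by linarith : m₁ / 2 ≤ m₂))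
      (sq_nonneg (errNorm R bω x t0 0))]
  have hE := Real.exp_pos (ν * (t - t0))
  have h8 : errNorm R bω x t j ^ 2 ≤
      4 * m₂ / m₁ * (Real.exp (-(ν / 2) * (t - t0)) * errNorm R bω x t0 0) ^ 2 := by
    have h9 := (mul_le_mul_of_nonneg_left h6 hE.le).trans (h1.trans h7)
    have e : Real.exp (-(ν / 2) * (t - t0)) ^ 2 = (Real.exp (ν * (t - t0)))⁻¹ := by
      rw [← Real.exp_neg, sq, ← Real.exp_add]; congr 1; ring
    rw [mul_pow, e]
    field_simp
    linarith
  have h10 : errNorm R bω x t j ≤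
      √(4 * m₂ / m₁) * (Real.exp (-(ν / 2) * (t - t0)) * errNorm R bω x t0 0) := by
    apply le_of_sq_le_sq _ (by positivity)
    rw [mul_pow, Real.sq_sqrt (by positivity)]
    exact h8
  refine h10.trans ?_
  have h11 : Real.exp (-(ν / 2) * (t - t0)) ≤
      Real.exp 1 * Real.exp (-μ * (t - t0 + (j : ℝ))) := by
    rw [← Real.exp_add, Real.exp_le_exp]
    have a1 : μ * (t - t0) ≤ ν / 2 * (t - t0) :=
      mul_le_mul_of_nonneg_right (min_le_left _ _) (by linarith)
    have a2 : μ * j ≤ 1 := by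
      have b1 : μ ≤ 1 / ((N : ℝ) + 1) := min_le_right _ _
      have b2 : (j : ℝ) ≤ N + 1 := by
        have : (j : ℝ) ≤ N := by exact_mod_cast hj
        linarith
      calc μ * j ≤ 1 / ((N : ℝ) + 1) * (N + 1) :=
            mul_le_mul b1 b2 (Nat.cast_nonneg j) (by positivity)
        _ = 1 := by field_simp
    linarith
  calc √(4 * m₂ / m₁) * (Real.exp (-(ν / 2) * (t - t0)) * errNorm R bω x t0 0)
      ≤ √(4 * m₂ / m₁) * ((Real.exp 1 * Real.exp (-μ * (t - t0 + (j : ℝ)))) *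
        errNorm R bω x t0 0) := by gcongr
    _ = _ := by ring

end Stability

/-! ### Extension of solutions -/

section Extension

variable {Y : Type} {O : HybridObserver Y} {y : ℝ → Y} {ωy : ℝ → Vec3} {t0 : ℝ} {x : HybridArc}

/-- The hybrid time domain with jump times `τ 1, …, τ N` and last interval `L`. -/
def finiteDomain (τ : ℕ → ℝ) (N : ℕ) (L : Set ℝ) : Set (ℝ × ℕ) :=
  {z | (z.2 < N ∧ z.1 ∈ Icc (τ z.2) (τ (z.2 + 1))) ∨ (z.2 = N ∧ z.1 ∈ L)}

theorem mem_finiteDomain_of_lt {τ : ℕ → ℝ} {N : ℕ} {L : Set ℝ} {t : ℝ} {j : ℕ} (hj : j < N) :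
    (t, j) ∈ finiteDomain τ N L ↔ t ∈ Icc (τ j) (τ (j + 1)) := by
  simp [finiteDomain, hj, hj.ne]

theorem mem_finiteDomain_self {τ : ℕ → ℝ} {N : ℕ} {L : Set ℝ} {t : ℝ} :
    (t, N) ∈ finiteDomain τ N L ↔ t ∈ L := by
  simp [finiteDomain]

theorem le_of_mem_finiteDomain {τ : ℕ → ℝ} {N : ℕ} {L : Set ℝ} {t : ℝ} {j : ℕ}
    (h : (t, j) ∈ finiteDomain τ N L) : j ≤ N := by
  rcases h with h | h
  · exact h.1.le
  · exact h.1.le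

open Classical in
/-- Continuation of the flow on the last interval of a solution. -/
theorem IsSolution.extend_flow (hx : IsSolution O y ωy t0 x) {τ : ℕ → ℝ} {N : ℕ} {L : Set ℝ}
    (hdom : x.dom = finiteDomain τ N L) (h0 : τ 0 = t0) (hτ : Monotone τ) (hL0 : τ N ∈ L)
    {T : ℝ} (hLT : L ⊆ Icc (τ N) T) {ρ : ℝ → Mat3} {b : ℝ → Vec3}
    (hρL : ∀ t ∈ L, ρ t = x.Rhat t N) (hbL : ∀ t ∈ L, b t = x.bhat t N)
    (hρ : ∀ t ∈ Icc (τ N) T, ρ t ∈ SO3)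
    (hρac : ∀ i l, LocAbsCont (fun t => ρ t i l) (Icc (τ N) T))
    (hbac : ∀ i, LocAbsCont (fun t => b t i) (Icc (τ N) T))
    (hgap : ∀ t ∈ Ioo (τ N) T, O.gap (y t) (ρ t) (x.q (τ N) N) ≤ O.δ)
    (hρd : ∀ᵐ t : ℝ, t ∈ Ioo (τ N) T → ∀ i l, HasDerivAt (fun s => ρ s i l)
      ((ρ t * skew (ωy t - b t + O.γP • O.inj (y t) (ρ t) (x.q (τ N) N))) i l) t)
    (hbd : ∀ᵐ t : ℝ, t ∈ Ioo (τ N) T → ∀ i, HasDerivAt (fun s => b s i)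
      ((-(O.γI • O.inj (y t) (ρ t) (x.q (τ N) N))) i) t) :
    ∃ x' : HybridArc, IsSolution O y ωy t0 x' ∧ x.dom ⊆ x'.dom ∧
      (∀ t j, (t, j) ∈ x.dom →
        x'.Rhat t j = x.Rhat t j ∧ x'.bhat t j = x.bhat t j ∧ x'.q t j = x.q t j) ∧
      (T, N) ∈ x'.dom := by
  have hNT : τ N ≤ T := (hLT hL0).2
  -- Freezing the sequence at T after index N makes [τ N, T] the closed last interval of the new
  -- domain.
  set τ' : ℕ → ℝ := fun j => if j ≤ N then τ j else T with hτ'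
  have hτ'1 : ∀ j ≤ N, τ' j = τ j := fun j hj => by simp [hτ', hj]
  have hτ'2 : τ' (N + 1) = T := by simp [hτ']
  have hτ'm : Monotone τ' := by
    intro i j hij
    simp only [hτ']
    split_ifs with h1 h2 h2
    · exact hτ hij
    · exact (hτ h1).trans hNT
    · omega
    · exact le_rfl
  have hN : (τ N, N) ∈ x.dom := by rw [hdom]; exact mem_finiteDomain_self.2 hL0
  let x' : HybridArc :=
    { dom := finiteDomain τ' N (Icc (τ N) T)
      Rhat := fun t j => if j = N then ρ t else x.Rhat t j
      bhat := fun t j => if j = N then b t else x.bhat t j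
      q := fun t j => if j = N then x.q (τ N) N else x.q t j }
  have hlt : ∀ {j : ℕ}, j < N → ∀ t, (t, j) ∈ x'.dom ↔ (t, j) ∈ x.dom := by
    intro j hj t
    change (t, j) ∈ finiteDomain τ' N _ ↔ _
    rw [mem_finiteDomain_of_lt hj, hτ'1 j hj.le, hτ'1 (j + 1) hj, hdom, mem_finiteDomain_of_lt hj]
  have hNmem : ∀ t, (t, N) ∈ x'.dom ↔ t ∈ Icc (τ N) T := fun t => mem_finiteDomain_self
  have hsl : ∀ {j : ℕ}, j < N → slice x'.dom j = slice x.dom j := fun hj => by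
    ext t; exact hlt hj t
  have hslN : slice x'.dom N = Icc (τ N) T := by ext t; exact hNmem t
  have hle : ∀ {t : ℝ} {j : ℕ}, (t, j) ∈ x'.dom → j ≤ N := fun h => le_of_mem_finiteDomain h
  have hslg : ∀ {j : ℕ}, N < j → slice x'.dom j = ∅ := fun hj => by
    ext t
    simp only [mem_empty_iff_false, iff_false]
    exact fun h => absurd (hle h) (by omega)
  have hRlt : ∀ {j : ℕ}, j < N → ∀ t, x'.Rhat t j = x.Rhat t j := fun hj t => if_neg hj.ne
  have hblt : ∀ {j : ℕ}, j < N → ∀ t, x'.bhat t j = x.bhat t j := fun hj t => if_neg hj.ne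
  have hqlt : ∀ {j : ℕ}, j < N → ∀ t, x'.q t j = x.q t j := fun hj t => if_neg hj.ne
  have hRN : ∀ t, x'.Rhat t N = ρ t := fun t => if_pos rfl
  have hbN : ∀ t, x'.bhat t N = b t := fun t => if_pos rfl
  have hqN : ∀ t, x'.q t N = x.q (τ N) N := fun t => if_pos rfl
  have hagree : ∀ t j, (t, j) ∈ x.dom →
      x'.Rhat t j = x.Rhat t j ∧ x'.bhat t j = x.bhat t j ∧ x'.q t j = x.q t j := by
    intro t j ht
    have hj : j ≤ N := by rw [hdom] at ht; exact le_of_mem_finiteDomain ht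
    rcases hj.lt_or_eq with hj | rfl
    · exact ⟨hRlt hj t, hblt hj t, hqlt hj t⟩
    · have htL : t ∈ L := by rw [hdom] at ht; exact mem_finiteDomain_self.1 ht
      exact ⟨(hRN t).trans (hρL t htL), (hbN t).trans (hbL t htL),
        (hqN t).trans (hx.q_const _ _ _ hN ht)⟩
  have hsub : x.dom ⊆ x'.dom := by
    rintro ⟨t, j⟩ ht
    have hj : j ≤ N := by rw [hdom] at ht; exact le_of_mem_finiteDomain ht
    rcases hj.lt_or_eq with hj | rfl
    · exact (hlt hj t).2 ht
    · rw [hdom] at ht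
      exact (hNmem t).2 (hLT (mem_finiteDomain_self.1 ht))
  have hjump : ∀ t j, (t, j) ∈ x'.dom → (t, j + 1) ∈ x'.dom →
      j < N ∧ (t, j) ∈ x.dom ∧ (t, j + 1) ∈ x.dom := by
    intro t j h1 h2
    have hj : j < N := hle h2
    refine ⟨hj, (hlt hj t).1 h1, ?_⟩
    rcases Nat.lt_or_eq_of_le hj with h | h
    · exact (hlt h t).1 h2
    · have h3 : t ≤ τ N := by
        have := (mem_finiteDomain_of_lt hj).1 h1
        rw [hτ'1 (j + 1) hj] at this
        rw [← h]
        exact this.2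
      have h4 : τ N ≤ t := by
        rw [← Nat.succ_eq_add_one, h] at h2
        exact ((hNmem t).1 h2).1
      rw [← Nat.succ_eq_add_one, h, le_antisymm h3 h4]
      exact hN
  refine ⟨x', ?_, hsub, hagree, (hNmem T).2 ⟨hNT, le_rfl⟩⟩
  refine ⟨⟨τ', by rw [hτ'1 0 (Nat.zero_le N), h0], hτ'm, Or.inr ⟨N, Icc (τ N) T, Or.inl ?_, rfl⟩⟩,
    ?_, ?_, ?_, ?_, ?_, ?_, ?_, ?_, ?_, ?_, ?_, ?_⟩
  · rw [hτ'1 N le_rfl, hτ'2]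
  · intro t j ht
    rcases (hle ht).lt_or_eq with hj | rfl
    · rw [hRlt hj]; exact hx.Rhat_mem t j ((hlt hj t).1 ht)
    · rw [hRN]; exact hρ t ((hNmem t).1 ht)
  · intro t j ht
    rcases (hle ht).lt_or_eq with hj | rfl
    · rw [hqlt hj]; exact hx.q_mem t j ((hlt hj t).1 ht)
    · rw [hqN]; exact hx.q_mem _ _ hN
  · intro j i l
    rcases lt_trichotomy j N with hj | rfl | hj
    · rw [hsl hj]; simp only [hRlt hj]; exact hx.Rhat_ac j i l
    · rw [hslN]; simp only [hRN]; exact hρac i l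
    · rw [hslg hj]; exact fun a b hab h => absurd (h (left_mem_Icc.2 hab)) (notMem_empty a)
  · intro j i
    rcases lt_trichotomy j N with hj | rfl | hj
    · rw [hsl hj]; simp only [hblt hj]; exact hx.bhat_ac j i
    · rw [hslN]; simp only [hbN]; exact hbac i
    · rw [hslg hj]; exact fun a b hab h => absurd (h (left_mem_Icc.2 hab)) (notMem_empty a)
  · intro j t s ht hs
    rcases (hle ht).lt_or_eq with hj | rfl
    · rw [hqlt hj, hqlt hj]; exact hx.q_const j t s ((hlt hj t).1 ht) ((hlt hj s).1 hs)
    · rw [hqN, hqN]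
  · intro j t ht
    rcases lt_trichotomy j N with hj | rfl | hj
    · rw [hsl hj] at ht; rw [hRlt hj, hqlt hj]; exact hx.flow_set j t ht
    · rw [hslN, interior_Icc] at ht; rw [hRN, hqN]; exact hgap t ht
    · rw [hslg hj, interior_empty] at ht; exact ht.elim
  · intro j
    rcases lt_trichotomy j N with hj | rfl | hj
    · rw [hsl hj]; simp only [hRlt hj, hblt hj, hqlt hj]; exact hx.flow_Rhat j
    · rw [hslN, interior_Icc]; simp only [hRN, hbN, hqN]; exact hρd
    · rw [hslg hj, interior_empty]; exact Eventually.of_forall fun t ht => ht.elim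
  · intro j
    rcases lt_trichotomy j N with hj | rfl | hj
    · rw [hsl hj]; simp only [hRlt hj, hblt hj, hqlt hj]; exact hx.flow_bhat j
    · rw [hslN, interior_Icc]; simp only [hRN, hbN, hqN]; exact hbd
    · rw [hslg hj, interior_empty]; exact Eventually.of_forall fun t ht => ht.elim
  · intro t j h1 h2
    obtain ⟨hj, h3, h4⟩ := hjump t j h1 h2
    rw [(hagree t j h3).1, (hagree t j h3).2.2]
    exact hx.jump_set t j h3 h4
  · intro t j h1 h2
    obtain ⟨hj, h3, h4⟩ := hjump t j h1 h2
    rw [(hagree t j h3).1, (hagree t _ h4).1]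
    exact hx.jump_Rhat t j h3 h4
  · intro t j h1 h2
    obtain ⟨hj, h3, h4⟩ := hjump t j h1 h2
    rw [(hagree t j h3).2.1, (hagree t _ h4).2.1]
    exact hx.jump_bhat t j h3 h4
  · intro t j h1 h2
    obtain ⟨hj, h3, h4⟩ := hjump t j h1 h2
    rw [(hagree t j h3).1, (hagree t _ h4).2.2]
    exact hx.jump_q t j h3 h4

/-- Continuation of a solution by a jump at the end of its last interval. -/
theorem IsSolution.extend_jump (hx : IsSolution O y ωy t0 x) {τ : ℕ → ℝ} {N : ℕ}
    (hdom : x.dom = finiteDomain τ N (Icc (τ N) (τ (N + 1)))) (h0 : τ 0 = t0) (hτ : Monotone τ)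
    (hQ : O.Q.Nonempty)
    (hgap : O.δ ≤ O.gap (y (τ (N + 1))) (x.Rhat (τ (N + 1)) N) (x.q (τ (N + 1)) N)) :
    ∃ x' : HybridArc, IsSolution O y ωy t0 x' ∧ x.dom ⊆ x'.dom ∧
      (∀ t j, (t, j) ∈ x.dom →
        x'.Rhat t j = x.Rhat t j ∧ x'.bhat t j = x.bhat t j ∧ x'.q t j = x.q t j) ∧
      (τ (N + 1), N + 1) ∈ x'.dom := by
  obtain ⟨p, hp, hpmin⟩ := O.Q.exists_min_image
    (O.pot (y (τ (N + 1))) (x.Rhat (τ (N + 1)) N)) hQ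
  set T := τ (N + 1) with hT
  set τ' : ℕ → ℝ := fun j => if j ≤ N + 1 then τ j else T with hτ'
  have hτ'1 : ∀ j ≤ N + 1, τ' j = τ j := fun j hj => by simp [hτ', hj]
  have hτ'2 : τ' (N + 2) = T := by simp [hτ']
  have hτ'm : Monotone τ' := by
    intro i j hij
    simp only [hτ']
    split_ifs with h1 h2 h2
    · exact hτ hij
    · exact hτ h1
    · omega
    · exact le_rfl
  -- After the jump the domain contains the single time T, an interval with empty interior, so the
  -- flow conditions at index N + 1 are void.
  let x' : HybridArc :=
    { dom := finiteDomain τ' (N + 1) (Icc T T)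
      Rhat := fun t j => if j = N + 1 then x.Rhat T N else x.Rhat t j
      bhat := fun t j => if j = N + 1 then x.bhat T N else x.bhat t j
      q := fun t j => if j = N + 1 then p else x.q t j }
  have hxle : ∀ {t : ℝ} {j : ℕ}, (t, j) ∈ x.dom → j < N + 1 := fun h => by
    rw [hdom] at h; exact Nat.lt_succ_of_le (le_of_mem_finiteDomain h)
  have hlt : ∀ {j : ℕ}, j < N + 1 → ∀ t, (t, j) ∈ x'.dom ↔ (t, j) ∈ x.dom := by
    intro j hj t
    change (t, j) ∈ finiteDomain τ' (N + 1) _ ↔ _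
    rw [mem_finiteDomain_of_lt hj, hτ'1 j hj.le, hτ'1 (j + 1) hj, hdom]
    rcases Nat.lt_succ_iff_lt_or_eq.1 hj with h | rfl
    · rw [mem_finiteDomain_of_lt h]
    · rw [mem_finiteDomain_self]
  have hNmem : ∀ t, (t, N + 1) ∈ x'.dom ↔ t ∈ Icc T T := fun t => mem_finiteDomain_self
  have hTN : (T, N) ∈ x.dom := by
    rw [hdom]; exact mem_finiteDomain_self.2 ⟨hτ (Nat.le_succ N), le_rfl⟩
  have hsl : ∀ {j : ℕ}, j < N + 1 → slice x'.dom j = slice x.dom j := fun hj => by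
    ext t; exact hlt hj t
  have hle : ∀ {t : ℝ} {j : ℕ}, (t, j) ∈ x'.dom → j ≤ N + 1 := fun h => le_of_mem_finiteDomain h
  have hslg : ∀ {j : ℕ}, N < j → slice x'.dom j ⊆ {T} := fun {j} hj t ht => by
    have h1 : j = N + 1 := le_antisymm (hle ht) hj
    rw [h1] at ht
    have := (hNmem t).1 ht
    exact le_antisymm this.2 this.1
  have hint : ∀ {j : ℕ}, N < j → interior (slice x'.dom j) = ∅ := fun hj =>
    subset_empty_iff.1 ((interior_mono (hslg hj)).trans (interior_singleton T).subset)
  have hac : ∀ {j : ℕ}, N < j → ∀ f : ℝ → ℝ, LocAbsCont f (slice x'.dom j) := by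
    intro j hj f a b hab hI
    have ha := hslg hj (hI (left_mem_Icc.2 hab))
    have hb := hslg hj (hI (right_mem_Icc.2 hab))
    have hab' : a = b := ha.trans hb.symm
    subst hab'
    refine LipschitzOnWith.absolutelyContinuousOnInterval (K := 0) ?_
    rw [uIcc_self]
    intro s hs t ht
    rw [mem_singleton_iff.1 hs, mem_singleton_iff.1 ht]
    simp
  have hRlt : ∀ {j : ℕ}, j < N + 1 → ∀ t, x'.Rhat t j = x.Rhat t j := fun hj t => if_neg hj.ne
  have hblt : ∀ {j : ℕ}, j < N + 1 → ∀ t, x'.bhat t j = x.bhat t j := fun hj t => if_neg hj.ne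
  have hqlt : ∀ {j : ℕ}, j < N + 1 → ∀ t, x'.q t j = x.q t j := fun hj t => if_neg hj.ne
  have hRN : ∀ t, x'.Rhat t (N + 1) = x.Rhat T N := fun t => if_pos rfl
  have hbN : ∀ t, x'.bhat t (N + 1) = x.bhat T N := fun t => if_pos rfl
  have hqN : ∀ t, x'.q t (N + 1) = p := fun t => if_pos rfl
  have hjump : ∀ t j, (t, j) ∈ x'.dom → (t, j + 1) ∈ x'.dom →
      (j < N ∧ (t, j) ∈ x.dom ∧ (t, j + 1) ∈ x.dom) ∨ (j = N ∧ t = T) := by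
    intro t j h1 h2
    rcases Nat.lt_or_eq_of_le (Nat.succ_le_succ_iff.1 (hle h2)) with h | rfl
    · exact Or.inl ⟨h, (hlt (by omega) t).1 h1, (hlt (by omega) t).1 h2⟩
    · have := (hNmem t).1 h2
      exact Or.inr ⟨rfl, le_antisymm this.2 this.1⟩
  refine ⟨x', ?_, ?_, fun t j ht => ⟨hRlt (hxle ht) t, hblt (hxle ht) t, hqlt (hxle ht) t⟩,
    (hNmem T).2 ⟨le_rfl, le_rfl⟩⟩
  swap
  · rintro ⟨t, j⟩ ht
    exact (hlt (hxle ht) t).2 ht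
  refine ⟨⟨τ', by rw [hτ'1 0 (Nat.zero_le _), h0], hτ'm,
    Or.inr ⟨N + 1, Icc T T, Or.inl ?_, rfl⟩⟩, ?_, ?_, ?_, ?_, ?_, ?_, ?_, ?_, ?_, ?_, ?_, ?_⟩
  · rw [hτ'1 (N + 1) le_rfl, hτ'2]
  · intro t j ht
    rcases (hle ht).lt_or_eq with hj | rfl
    · rw [hRlt hj]; exact hx.Rhat_mem t j ((hlt hj t).1 ht)
    · rw [hRN]; exact hx.Rhat_mem T N hTN
  · intro t j ht
    rcases (hle ht).lt_or_eq with hj | rfl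
    · rw [hqlt hj]; exact hx.q_mem t j ((hlt hj t).1 ht)
    · rw [hqN]; exact hp
  · intro j i l
    rcases lt_or_ge j (N + 1) with hj | hj
    · rw [hsl hj]; simp only [hRlt hj]; exact hx.Rhat_ac j i l
    · exact hac hj _
  · intro j i
    rcases lt_or_ge j (N + 1) with hj | hj
    · rw [hsl hj]; simp only [hblt hj]; exact hx.bhat_ac j i
    · exact hac hj _
  · intro j t s ht hs
    rcases (hle ht).lt_or_eq with hj | rfl
    · rw [hqlt hj, hqlt hj]; exact hx.q_const j t s ((hlt hj t).1 ht) ((hlt hj s).1 hs)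
    · rw [hqN, hqN]
  · intro j t ht
    rcases lt_or_ge j (N + 1) with hj | hj
    · rw [hsl hj] at ht; rw [hRlt hj, hqlt hj]; exact hx.flow_set j t ht
    · rw [hint hj] at ht; exact ht.elim
  · intro j
    rcases lt_or_ge j (N + 1) with hj | hj
    · rw [hsl hj]; simp only [hRlt hj, hblt hj, hqlt hj]; exact hx.flow_Rhat j
    · rw [hint hj]; exact Eventually.of_forall fun t ht => ht.elim
  · intro j
    rcases lt_or_ge j (N + 1) with hj | hj
    · rw [hsl hj]; simp only [hRlt hj, hblt hj, hqlt hj]; exact hx.flow_bhat j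
    · rw [hint hj]; exact Eventually.of_forall fun t ht => ht.elim
  · intro t j h1 h2
    rcases hjump t j h1 h2 with ⟨hj, h3, h4⟩ | ⟨rfl, rfl⟩
    · rw [hRlt (by omega), hqlt (by omega)]
      exact hx.jump_set t j h3 h4
    · rw [hRlt (Nat.lt_succ_self _), hqlt (Nat.lt_succ_self _)]
      exact hgap
  · intro t j h1 h2
    rcases hjump t j h1 h2 with ⟨hj, h3, h4⟩ | ⟨rfl, rfl⟩
    · rw [hRlt (by omega), hRlt (by omega)]
      exact hx.jump_Rhat t j h3 h4
    · rw [hRlt (Nat.lt_succ_self _), hRN]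
  · intro t j h1 h2
    rcases hjump t j h1 h2 with ⟨hj, h3, h4⟩ | ⟨rfl, rfl⟩
    · rw [hblt (by omega), hblt (by omega)]
      exact hx.jump_bhat t j h3 h4
    · rw [hblt (Nat.lt_succ_self _), hbN]
  · intro t j h1 h2
    rcases hjump t j h1 h2 with ⟨hj, h3, h4⟩ | ⟨rfl, rfl⟩
    · rw [hRlt (by omega), hqlt (by omega)]
      exact hx.jump_q t j h3 h4
    · rw [hRlt (Nat.lt_succ_self _), hqN]
      exact hpmin

end Extension

/-! ### Local existence of flows -/

/-- Local existence for an ordinary differential equation whose right-hand side depends on time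
through a continuous parameter `p`. -/
theorem exists_solution_of_contDiffAt {W E : Type*} [NormedAddCommGroup W] [NormedSpace ℝ W]
    [NormedAddCommGroup E] [NormedSpace ℝ E] [CompleteSpace E] {F : W × E → E} {p : ℝ → W} {T : ℝ}
    (hp : ContinuousOn p (Ici T)) {e₀ : E} (hF : ContDiffAt ℝ 1 F (p T, e₀)) :
    ∃ ε > 0, ∃ C : ℝ, ∃ α : ℝ → E, α T = e₀ ∧ ∀ t ∈ Icc T (T + ε),
      HasDerivWithinAt α (F (p t, α t)) (Icc T (T + ε)) t ∧ ‖F (p t, α t)‖ ≤ C := by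
  obtain ⟨K, s, hs, hl⟩ := hF.exists_lipschitzOnWith
  obtain ⟨a, ha, has⟩ := Metric.mem_nhds_iff.1 hs
  have hpT : ContinuousWithinAt p (Ici T) T := hp T self_mem_Ici
  obtain ⟨η, hη, hpη⟩ := Metric.continuousWithinAt_iff.1 hpT a ha
  have hball : ∀ t ∈ Icc T (T + η / 2), ∀ z ∈ Metric.closedBall e₀ (a / 2), (p t, z) ∈ s := by
    intro t ht z hz
    apply has
    rw [Metric.mem_ball, Prod.dist_eq]
    refine max_lt (hpη ht.1 ?_) ((Metric.mem_closedBall.1 hz).trans_lt (half_lt_self ha))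
    rw [Real.dist_eq, abs_of_nonneg (by linarith [ht.1])]
    linarith [ht.2]
  -- A bound for the right-hand side near the initial point, from the Lipschitz constant; the
  -- summand 1 makes it positive.
  set C : ℝ := K * a + ‖F (p T, e₀)‖ + 1 with hC
  have hC0 : 0 < C := by positivity
  have hT : T ∈ Icc T (T + η / 2) := ⟨le_rfl, by linarith⟩
  have he : e₀ ∈ Metric.closedBall e₀ (a / 2) := Metric.mem_closedBall_self (by positivity)
  have hbd : ∀ t ∈ Icc T (T + η / 2), ∀ z ∈ Metric.closedBall e₀ (a / 2), ‖F (p t, z)‖ ≤ C := by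
    intro t ht z hz
    have h1 := hl.dist_le_mul _ (hball t ht z hz) _ (hball T hT e₀ he)
    have h2 : dist (p t, z) (p T, e₀) ≤ a := by
      rw [Prod.dist_eq]
      refine max_le (hpη ht.1 ?_).le ((Metric.mem_closedBall.1 hz).trans (half_le_self ha.le))
      rw [Real.dist_eq, abs_of_nonneg (by linarith [ht.1])]
      linarith [ht.2]
    have h3 : ‖F (p t, z)‖ ≤ dist (F (p t, z)) (F (p T, e₀)) + ‖F (p T, e₀)‖ := by
      rw [dist_eq_norm]
      exact norm_le_norm_sub_add _ _
    have h4 : (K : ℝ) * dist (p t, z) (p T, e₀) ≤ K * a :=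
      mul_le_mul_of_nonneg_left h2 K.coe_nonneg
    linarith
  set ε := min (η / 2) (a / 2 / C)
  have hε : 0 < ε := lt_min (by positivity) (by positivity)
  have hsub : Icc T (T + ε) ⊆ Icc T (T + η / 2) :=
    Icc_subset_Icc_right (by linarith [min_le_left (η / 2) (a / 2 / C)])
  have hPL : IsPicardLindelof (fun t z => F (p t, z)) (tmin := T) (tmax := T + ε)
      ⟨T, le_rfl, by linarith⟩ e₀ ⟨a / 2, by positivity⟩ 0 ⟨C, hC0.le⟩ K := by
    refine ⟨fun t ht => ?_, fun z hz => ?_, fun t ht z hz => hbd t (hsub ht) z hz, ?_⟩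
    · refine LipschitzOnWith.of_dist_le_mul fun z hz w hw => ?_
      have := hl.dist_le_mul _ (hball t (hsub ht) z hz) _ (hball t (hsub ht) w hw)
      rwa [Prod.dist_eq, dist_self, max_eq_right dist_nonneg] at this
    · have h1 : ContinuousOn (fun t => (p t, z)) (Icc T (T + ε)) :=
        (hp.mono Icc_subset_Ici_self).prodMk continuousOn_const
      exact hl.continuousOn.comp h1 fun t ht => hball t (hsub ht) z hz
    · change C * max (T + ε - T) (T - T) ≤ a / 2 - 0
      rw [add_sub_cancel_left, sub_self, max_eq_left hε.le, sub_zero]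
      calc C * ε ≤ C * (a / 2 / C) := mul_le_mul_of_nonneg_left (min_le_right _ _) hC0.le
        _ = a / 2 := by field_simp
  obtain ⟨α, hα0, hα⟩ := hPL.exists_eq_forall_mem_Icc_hasDerivWithinAt₀
  change α T = e₀ at hα0
  have hcont : ContinuousWithinAt α (Icc T (T + ε)) T :=
    (hα T ⟨le_rfl, by linarith⟩).continuousWithinAt
  -- On a possibly shorter interval continuity keeps the curve in the ball where C bounds the
  -- right-hand side. That bound is what makes the components absolutely continuous.
  obtain ⟨ζ, hζ, hαζ⟩ := Metric.continuousWithinAt_iff.1 hcont (a / 2) (by positivity)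
  have hsub2 : Icc T (T + min ε (ζ / 2)) ⊆ Icc T (T + ε) :=
    Icc_subset_Icc_right (by linarith [min_le_left ε (ζ / 2)])
  refine ⟨min ε (ζ / 2), lt_min hε (by positivity), C, α, hα0, fun t ht =>
    ⟨(hα t (hsub2 ht)).mono hsub2, hbd t (hsub (hsub2 ht)) _ ?_⟩⟩
  rw [Metric.mem_closedBall, ← hα0]
  refine (hαζ (hsub2 ht) ?_).le
  rw [Real.dist_eq, abs_of_nonneg (by linarith [ht.1])]
  linarith [ht.2, min_le_right ε (ζ / 2)]

/-- A curve with `X' = X [w]_×` that starts in `SO(3)` stays in `SO(3)`. -/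
theorem mem_SO3_of_hasDerivWithinAt {X : ℝ → Mat3} {w : ℝ → Vec3} {T T' : ℝ} (h0 : X T ∈ SO3)
    (hX : ∀ t ∈ Icc T T', ∀ i l,
      HasDerivWithinAt (fun s => X s i l) ((X t * skew (w t)) i l) (Icc T T') t) :
    ∀ t ∈ Icc T T', X t ∈ SO3 := by
  have hc : ContinuousOn X (Icc T T') := continuousOn_pi.2 fun i => continuousOn_pi.2 fun l =>
    fun t ht => (hX t ht i l).continuousWithinAt
  have hgram : ∀ t ∈ Icc T T', X t * (X t)ᵀ = 1 := by
    intro t ht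
    ext i l
    have hder : ∀ s ∈ Icc T T', HasDerivWithinAt (fun s => (X s * (X s)ᵀ) i l) 0 (Icc T T') s := by
      intro s hs
      have h1 : HasDerivWithinAt (fun s => ∑ m, X s i m * X s l m)
          (∑ m, ((X s * skew (w s)) i m * X s l m + X s i m * (X s * skew (w s)) l m))
          (Icc T T') s :=
        HasDerivWithinAt.fun_sum fun m _ => (hX s hs i m).mul (hX s hs l m)
      have h2 : (∑ m, ((X s * skew (w s)) i m * X s l m + X s i m * (X s * skew (w s)) l m)) =
          (X s * skew (w s) * (X s)ᵀ + X s * (X s * skew (w s))ᵀ) i l := by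
        rw [Matrix.add_apply, Matrix.mul_apply, Matrix.mul_apply (M := X s),
          Finset.sum_add_distrib]
        rfl
      have h3 : X s * skew (w s) * (X s)ᵀ + X s * (X s * skew (w s))ᵀ = 0 := by
        rw [transpose_mul, skew_transpose, Matrix.neg_mul, Matrix.mul_neg, Matrix.mul_assoc]
        exact add_neg_cancel _
      rw [h2, h3] at h1
      simpa only [Matrix.mul_apply, transpose_apply, Matrix.zero_apply] using h1
    have hconst : (X t * (X t)ᵀ) i l = (X T * (X T)ᵀ) i l :=
      constant_of_has_deriv_right_zero (f := fun s => (X s * (X s)ᵀ) i l)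
      (a := T) (b := T') (fun s hs => (hder s hs).continuousWithinAt)
      (fun s hs => ((hder s ⟨hs.1, hs.2.le⟩).mono_of_mem_nhdsWithin
        (Icc_mem_nhdsGE_of_mem ⟨hs.1, hs.2⟩))) t ht
    rw [hconst, SO3_mul_transpose h0]
  -- Orthogonality leaves only the determinants 1 and -1, and a continuous determinant cannot pass
  -- between them.
  have hdet : ∀ t ∈ Icc T T', (X t).det = 1 := by
    have hsq : ∀ t ∈ Icc T T', (X t).det = 1 ∨ (X t).det = -1 := by
      intro t ht
      have := congrArg Matrix.det (hgram t ht)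
      rw [Matrix.det_mul, Matrix.det_transpose, Matrix.det_one] at this
      exact mul_self_eq_one_iff.1 this
    have hdc : ContinuousOn (fun t => (X t).det) (Icc T T') :=
      (continuous_id.matrix_det).comp_continuousOn hc
    intro t ht
    rcases hsq t ht with h | h
    · exact h
    · exfalso
      have hT : T ∈ Icc T T' := ⟨le_rfl, ht.1.trans ht.2⟩
      have h1 : (X T).det = 1 := (mem_SO3.1 h0).2
      have hpre : IsPreconnected ((fun t => (X t).det) '' Icc T T') :=
        isPreconnected_Icc.image _ hdc
      have hmem : (0 : ℝ) ∈ (fun t => (X t).det) '' Icc T T' := by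
        refine hpre.ordConnected.out (mem_image_of_mem _ ht) (mem_image_of_mem _ hT) ?_
        simp only [h, h1]
        constructor <;> norm_num
      obtain ⟨s, hs, hs0⟩ := hmem
      simp only at hs0
      rcases hsq s hs with h2 | h2 <;> rw [h2] at hs0 <;> norm_num at hs0
  intro t ht
  exact mem_SO3.2 ⟨hgram t ht, hdet t ht⟩

/-! ### Completeness of maximal solutions -/

theorem abs_mul_skew_apply_le {M : Mat3} (hM : M ∈ SO3) (v : Vec3) (i l : Fin 3) :
    |(M * skew v) i l| ≤ 3 * vnorm v := by
  have hs : ∀ m, |skew v m l| ≤ vnorm v := by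
    intro m
    have h0 := abs_apply_le_vnorm v 0
    have h1 := abs_apply_le_vnorm v 1
    have h2 := abs_apply_le_vnorm v 2
    have h3 := vnorm_nonneg v
    fin_cases m <;> fin_cases l <;> simpa [skew]
  have hm : ∀ m, |M i m * skew v m l| ≤ vnorm v := fun m => by
    rw [abs_mul]
    calc |M i m| * |skew v m l| ≤ 1 * vnorm v :=
          mul_le_mul (abs_apply_le_one hM i m) (hs m) (abs_nonneg _) zero_le_one
      _ = vnorm v := one_mul _
  rw [mul_eq]
  refine (abs_add_three _ _ _).trans ?_
  linarith [hm 0, hm 1, hm 2]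

theorem locAbsCont_Icc {f : ℝ → ℝ} {a b : ℝ} (hab : a ≤ b)
    (h : AbsolutelyContinuousOnInterval f a b) : LocAbsCont f (Icc a b) := fun c d hcd hI =>
  h.mono (by rwa [uIcc_of_le hab, uIcc_of_le hcd])

theorem LocAbsCont.continuousOn_Ici {f : ℝ → ℝ} {a : ℝ} (h : LocAbsCont f (Ici a)) :
    ContinuousOn f (Ici a) := by
  intro t ht
  have h1 := h.continuousOn (b := t + 1) (show a ≤ t + 1 by linarith [mem_Ici.1 ht])
    Icc_subset_Ici_self t ⟨ht, by linarith⟩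
  refine h1.mono_of_mem_nhdsWithin ?_
  rw [← Ici_inter_Iic]
  exact inter_mem_nhdsWithin _ (Iic_mem_nhds (by linarith))

section Completeness

variable {Y : Type} {O : HybridObserver Y} {h : Mat3 → Y} {P : Mat3 → ℕ → ℝ}
  {G : Mat3 → ℕ → Vec3} {c₁ c₂ c₃ c₄ : ℝ}
  {t0 : ℝ} {R : ℝ → Mat3} {ω : ℝ → Vec3} {bω : Vec3} {x : HybridArc}

/-- The right-hand side of the error dynamics, as a function of the attitude `R` and of the errors
`(R̃, b̃)`. -/
noncomputable def errField (O : HybridObserver Y) (G : Mat3 → ℕ → Vec3) (q : ℕ)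
    (z : Mat3 × Mat3 × Vec3) : Mat3 × Vec3 :=
  (z.2.1 * skew (-(z.2.1ᵀ *ᵥ (z.1 *ᵥ z.2.2) + O.γP • G z.2.1 q)),
    O.γI • (z.1ᵀ *ᵥ (z.2.1 *ᵥ G z.2.1 q)))

theorem contDiffAt_errField {q : ℕ} {z : Mat3 × Mat3 × Vec3}
    (hG : ContDiffAt ℝ 1 (fun X => G X q) z.2.1) : ContDiffAt ℝ 1 (errField O G q) z := by
  have h1 : ContDiffAt ℝ 1 (fun z : Mat3 × Mat3 × Vec3 => z.1) z := contDiffAt_fst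
  have h2 : ContDiffAt ℝ 1 (fun z : Mat3 × Mat3 × Vec3 => z.2.1) z :=
    contDiffAt_fst.comp z contDiffAt_snd
  have h3 : ContDiffAt ℝ 1 (fun z : Mat3 × Mat3 × Vec3 => z.2.2) z :=
    contDiffAt_snd.comp z contDiffAt_snd
  have h4 : ContDiffAt ℝ 1 (fun z : Mat3 × Mat3 × Vec3 => G z.2.1 q) z :=
    ContDiffAt.comp (g := fun X => G X q) (f := fun z : Mat3 × Mat3 × Vec3 => z.2.1) z hG h2
  have h5 := ((h2.matrixTranspose.matrixMulVec (h1.matrixMulVec h3)).add (h4.const_smul O.γP)).neg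
  exact (h2.matrixMul h5.skew).prodMk
    ((h1.matrixTranspose.matrixMulVec (h2.matrixMulVec h4)).const_smul O.γI)

/-- The observer equation contains ω, which need not be continuous, so Picard–Lindelöf is applied to
the error equations, where time enters only through the continuous R(t). The estimate is then
recovered from the error as R̃ᵀ R. A gap strictly below δ persists for a short time by continuity.
-/
theorem Realizes.exists_local_flow (hO : Realizes O h P G c₁ c₂ c₃ c₄)
    (hR : IsAttitudeTrajectory t0 R ω) (bω : Vec3) {T : ℝ} (hT : t0 ≤ T) {Q : Mat3} (hQ : Q ∈ SO3)
    (b₀ : Vec3) {q : ℕ} (hq : q ∈ O.Q) (hgap : O.gap (h (R T)) Q q < O.δ) :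
    ∃ T' > T, ∃ (ρ : ℝ → Mat3) (b : ℝ → Vec3), ρ T = Q ∧ b T = b₀ ∧
      (∀ t ∈ Icc T T', ρ t ∈ SO3 ∧ O.gap (h (R t)) (ρ t) q ≤ O.δ) ∧
      (∀ i l, AbsolutelyContinuousOnInterval (fun t => ρ t i l) T T') ∧
      (∀ i, AbsolutelyContinuousOnInterval (fun t => b t i) T T') ∧
      (∀ᵐ t : ℝ, t ∈ Ioo T T' → ∀ i l, HasDerivAt (fun s => ρ s i l)
        ((ρ t * skew (ω t + bω - b t + O.γP • O.inj (h (R t)) (ρ t) q)) i l) t) ∧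
      (∀ᵐ t : ℝ, t ∈ Ioo T T' → ∀ i, HasDerivAt (fun s => b s i)
        ((-(O.γI • O.inj (h (R t)) (ρ t) q)) i) t) := by
  have hRT := hR.1 T hT
  rw [hO.gap_eq hRT hQ hq] at hgap
  have hX₀ : R T * Qᵀ ∈ SO3 := SO3_mul hRT (SO3_transpose hQ)
  set X₀ := R T * Qᵀ with hX₀d
  have hfl : (X₀, q) ∈ flowSet P O.Q O.δ := ⟨hX₀, hq, hgap.le⟩
  have hF : ContDiffAt ℝ 1 (errField O G q) (R T, X₀, bω - b₀) :=
    contDiffAt_errField (hO.potential.smooth _ _ hfl)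
  have hRc : ContinuousOn R (Ici T) := continuousOn_pi.2 fun i => continuousOn_pi.2 fun l =>
    ((hR.2.1 i l).mono (Ici_subset_Ici.2 hT)).continuousOn_Ici
  obtain ⟨ε, hε, C, α, hα0, hα⟩ := exists_solution_of_contDiffAt (E := Mat3 × Vec3) hRc hF
  -- the flow set is not left immediately
  have hopen : ∀ᶠ X in 𝓝 X₀, ∀ p ∈ O.Q, P X q - P X p < O.δ := by
    rw [Filter.eventually_all_finset]
    intro p hp
    have h1 : P X₀ q - P X₀ p < O.δ :=
      lt_of_le_of_lt ((sub_sInf_le_iff (P X₀) hO.potential.nonempty q _).1 le_rfl p hp) hgap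
    have h2 : Continuous fun X => P X q - P X p :=
      (hO.potential.cont q).sub (hO.potential.cont p)
    exact h2.continuousAt.eventually_lt continuousAt_const h1
  have hαc : ContinuousOn α (Icc T (T + ε)) := fun t ht => (hα t ht).1.continuousWithinAt
  have hXc : ContinuousOn (fun t => (α t).1) (Icc T (T + ε)) :=
    continuous_fst.comp_continuousOn hαc
  have hTm : T ∈ Icc T (T + ε) := ⟨le_rfl, by linarith⟩
  have hXT : (α T).1 = X₀ := by rw [hα0]
  have hev : ∀ᶠ t in 𝓝[Icc T (T + ε)] T, ∀ p ∈ O.Q, P (α t).1 q - P (α t).1 p < O.δ := by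
    have h1 : Tendsto (fun t => (α t).1) (𝓝[Icc T (T + ε)] T) (𝓝 X₀) := by
      rw [← hXT]; exact hXc T hTm
    exact h1.eventually hopen
  obtain ⟨ζ, hζ, hζb⟩ := Metric.mem_nhdsWithin_iff.1 hev
  set T' := T + min ε (ζ / 2) with hT'
  have hTT' : T < T' := by have : 0 < min ε (ζ / 2) := lt_min hε (by positivity); linarith
  have hsub : Icc T T' ⊆ Icc T (T + ε) :=
    Icc_subset_Icc_right (by linarith [min_le_left ε (ζ / 2)])
  have hXd : ∀ t ∈ Icc T T', ∀ i l, HasDerivWithinAt (fun s => (α s).1 i l)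
      ((errField O G q (R t, α t)).1 i l) (Icc T T') t := by
    intro t ht i l
    have h1 : HasDerivWithinAt (fun s => (α s).1) (errField O G q (R t, α t)).1 (Icc T T') t :=
      (ContinuousLinearMap.fst ℝ Mat3 Vec3).hasFDerivAt.comp_hasDerivWithinAt t
        ((hα t (hsub ht)).1.mono hsub)
    exact hasDerivWithinAt_pi.1 (hasDerivWithinAt_pi.1 h1 i) l
  have hbd : ∀ t ∈ Icc T T', ∀ i, HasDerivWithinAt (fun s => (α s).2 i)
      ((errField O G q (R t, α t)).2 i) (Icc T T') t := by
    intro t ht i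
    have h1 : HasDerivWithinAt (fun s => (α s).2) (errField O G q (R t, α t)).2 (Icc T T') t :=
      (ContinuousLinearMap.snd ℝ Mat3 Vec3).hasFDerivAt.comp_hasDerivWithinAt t
        ((hα t (hsub ht)).1.mono hsub)
    exact hasDerivWithinAt_pi.1 h1 i
  have hXm : ∀ t ∈ Icc T T', (α t).1 ∈ SO3 :=
    mem_SO3_of_hasDerivWithinAt (X := fun t => (α t).1) (by rw [hXT]; exact hX₀) hXd
  have hXac : ∀ i l, AbsolutelyContinuousOnInterval (fun t => (α t).1 i l) T T' := by
    intro i l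
    refine absolutelyContinuousOnInterval_of_deriv_bounded (C := C) hTT'.le
      (fun t ht => (hXd t ht i l).continuousWithinAt) fun t ht => ?_
    refine ⟨_, ?_, (hXd t (Ioo_subset_Icc_self ht) i l).hasDerivAt (Icc_mem_nhds ht.1 ht.2)⟩
    exact (Matrix.norm_entry_le_entrywise_sup_norm _).trans
      ((norm_fst_le _).trans (hα t (hsub (Ioo_subset_Icc_self ht))).2)
  have hbac : ∀ i, AbsolutelyContinuousOnInterval (fun t => (α t).2 i) T T' := by
    intro i
    refine absolutelyContinuousOnInterval_of_deriv_bounded (C := C) hTT'.le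
      (fun t ht => (hbd t ht i).continuousWithinAt) fun t ht => ?_
    refine ⟨_, ?_, (hbd t (Ioo_subset_Icc_self ht) i).hasDerivAt (Icc_mem_nhds ht.1 ht.2)⟩
    exact (norm_le_pi_norm (errField O G q (R t, α t)).2 i).trans
      ((norm_snd_le _).trans (hα t (hsub (Ioo_subset_Icc_self ht))).2)
  have hRac : ∀ i l, AbsolutelyContinuousOnInterval (fun t => R t i l) T T' := fun i l =>
    hR.2.1 i l T T' hTT'.le fun s hs => hT.trans hs.1
  have hρm : ∀ t ∈ Icc T T', (α t).1ᵀ * R t ∈ SO3 := fun t ht =>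
    SO3_mul (SO3_transpose (hXm t ht)) (hR.1 t (hT.trans ht.1))
  have herr : ∀ t ∈ Icc T T', R t * ((α t).1ᵀ * R t)ᵀ = (α t).1 := fun t ht => by
    rw [transpose_mul, transpose_transpose, ← Matrix.mul_assoc,
      SO3_mul_transpose (hR.1 t (hT.trans ht.1)), Matrix.one_mul]
  have hinj : ∀ t ∈ Icc T T', O.inj (h (R t)) ((α t).1ᵀ * R t) q =
      ((α t).1ᵀ * R t)ᵀ *ᵥ G (α t).1 q := fun t ht => by
    rw [hO.inj_eq _ (hR.1 t (hT.trans ht.1)) _ (hρm t ht) q hq, herr t ht]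
  refine ⟨T', hTT', fun t => (α t).1ᵀ * R t, fun t => bω - (α t).2, ?_, ?_,
    fun t ht => ⟨hρm t ht, ?_⟩, fun i l => ?_, fun i => ?_, ?_, ?_⟩
  · change (α T).1ᵀ * R T = Q
    rw [hXT, hX₀d, transpose_mul, transpose_transpose, Matrix.mul_assoc, SO3_transpose_mul hRT,
      Matrix.mul_one]
  · change bω - (α T).2 = b₀
    rw [hα0]; exact sub_sub_cancel _ _
  · rw [hO.gap_eq (hR.1 t (hT.trans ht.1)) (hρm t ht) hq, herr t ht,
      sub_sInf_le_iff _ hO.potential.nonempty]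
    intro p hp
    refine (hζb (show t ∈ Metric.ball T ζ ∩ Icc T (T + ε) from ⟨?_, hsub ht⟩) p hp).le
    rw [Metric.mem_ball, Real.dist_eq, abs_of_nonneg (by linarith [ht.1])]
    linarith [ht.2, min_le_right ε (ζ / 2)]
  · simp only [mul_eq, transpose_apply]
    exact (((hXac 0 i).mul (hRac 0 l)).add ((hXac 1 i).mul (hRac 1 l))).add
      ((hXac 2 i).mul (hRac 2 l))
  · exact ((LocAbsCont.const (I := univ) (bω i)) T T' hTT'.le (subset_univ _)).sub (hbac i)
  · filter_upwards [hR.2.2] with t hRd ht i l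
    have htm := Ioo_subset_Icc_self ht
    have h1 := hRd (hT.trans ht.1.le)
    have h2 : ∀ i l, HasDerivAt (fun s => (α s).1 i l) ((errField O G q (R t, α t)).1 i l) t :=
      fun i l => (hXd t htm i l).hasDerivAt (Icc_mem_nhds ht.1 ht.2)
    have h3 : HasDerivAt (fun s => ∑ m, (α s).1 m i * R s m l)
        (∑ m, ((errField O G q (R t, α t)).1 m i * R t m l +
          (α t).1 m i * (R t * skew (ω t)) m l)) t :=
      HasDerivAt.fun_sum fun m _ => (h2 m i).mul (h1 m l)
    have h4 : (∑ m, ((errField O G q (R t, α t)).1 m i * R t m l +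
          (α t).1 m i * (R t * skew (ω t)) m l)) =
        ((errField O G q (R t, α t)).1ᵀ * R t + (α t).1ᵀ * (R t * skew (ω t))) i l := by
      rw [Matrix.add_apply, Matrix.mul_apply, Matrix.mul_apply (M := (α t).1ᵀ),
        Finset.sum_add_distrib]
      rfl
    rw [h4] at h3
    have h5 : (errField O G q (R t, α t)).1ᵀ * R t + (α t).1ᵀ * (R t * skew (ω t)) =
        (α t).1ᵀ * R t * skew (ω t + bω - (bω - (α t).2) +
          O.γP • O.inj (h (R t)) ((α t).1ᵀ * R t) q) := by
      have hρ := hρm t htm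
      have hv : ω t + bω - (bω - (α t).2) + O.γP • O.inj (h (R t)) ((α t).1ᵀ * R t) q =
          ω t + ((α t).1ᵀ * R t)ᵀ *ᵥ
            ((α t).1ᵀ *ᵥ (R t *ᵥ (α t).2) + O.γP • G (α t).1 q) := by
        rw [hinj t htm, mulVec_add, mulVec_mulVec (α t).2, mulVec_mulVec (α t).2,
          SO3_transpose_mul hρ, one_mulVec, mulVec_smul]
        abel
      rw [hv, skew_add, Matrix.mul_add, SO3_mul_skew hρ (((α t).1ᵀ * R t)ᵀ *ᵥ _), mulVec_mulVec,
        SO3_mul_transpose hρ, one_mulVec, add_comm]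
      congr 1
      · rw [Matrix.mul_assoc]
      · simp only [errField]
        rw [transpose_mul, skew_transpose, skew_neg, neg_neg, Matrix.mul_assoc]
    rw [h5] at h3
    simpa only [Matrix.mul_apply (M := (α _).1ᵀ), transpose_apply] using h3
  · refine Eventually.of_forall fun t ht i => ?_
    have htm := Ioo_subset_Icc_self ht
    have h2 := ((hbd t htm i).hasDerivAt (Icc_mem_nhds ht.1 ht.2)).const_sub (bω i)
    refine h2.congr_deriv ?_
    rw [hinj t htm, transpose_mul, transpose_transpose, ← mulVec_mulVec]
    rfl

end Completeness

/-- A locally absolutely continuous function with bounded derivative on `[a, b)` extends to a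
Lipschitz function. -/
theorem LocAbsCont.exists_lipschitz_extension {f : ℝ → ℝ} {a b C : ℝ}
    (hf : LocAbsCont f (Ico a b))
    (hd : ∀ᵐ t : ℝ, t ∈ Ioo a b → ∃ d, |d| ≤ C ∧ HasDerivAt f d t) :
    ∃ g : ℝ → ℝ, (∃ K, LipschitzWith K g) ∧ ∀ t ∈ Ico a b, g t = f t := by
  have key : ∀ s ∈ Ico a b, ∀ t ∈ Ico a b, s ≤ t → |f t - f s| ≤ |C| * (t - s) := by
    intro s hs t ht hst
    have hI : Icc s t ⊆ Ico a b := fun r hr => ⟨hs.1.trans hr.1, hr.2.trans_lt ht.2⟩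
    refine (abs_sub_le_of_ae_abs_deriv_le (C := C) hst (hf s t hst hI) ?_).trans
      (mul_le_mul_of_nonneg_right (le_abs_self C) (sub_nonneg.2 hst))
    filter_upwards [hd] with r hr hm
    exact hr ⟨hs.1.trans_lt hm.1, hm.2.trans ht.2⟩
  have hL : LipschitzOnWith ⟨|C|, abs_nonneg C⟩ f (Ico a b) := by
    refine LipschitzOnWith.of_dist_le_mul fun s hs t ht => ?_
    rw [Real.dist_eq, Real.dist_eq]
    rcases le_total s t with hst | hst
    · rw [abs_sub_comm, abs_sub_comm s, abs_of_nonneg (sub_nonneg.2 hst)]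
      exact key s hs t ht hst
    · rw [abs_of_nonneg (sub_nonneg.2 hst)]
      exact key t ht s hs hst
  obtain ⟨g, hg, hgf⟩ := hL.extend_real
  exact ⟨g, ⟨_, hg⟩, fun t ht => (hgf ht).symm⟩

theorem _root_.LipschitzWith.locAbsCont {g : ℝ → ℝ} {K : NNReal} (hg : LipschitzWith K g)
    (I : Set ℝ) : LocAbsCont g I := fun _ _ _ _ =>
  hg.lipschitzOnWith.absolutelyContinuousOnInterval

/-! ### Continuation past the end of a bounded time domain -/

section Completeness

variable {Y : Type} {O : HybridObserver Y} {h : Mat3 → Y} {P : Mat3 → ℕ → ℝ}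
  {G : Mat3 → ℕ → Vec3} {c₁ c₂ c₃ c₄ : ℝ}
  {t0 : ℝ} {R : ℝ → Mat3} {ω : ℝ → Vec3} {bω : Vec3} {x : HybridArc}

/-- The bias error is bounded by monotonicity of `lyap`, the injection by c₄, the angular velocity
by assumption, and entries of rotations by 1. -/
theorem IsSolution.exists_deriv_bounds (hO : Realizes O h P G c₁ c₂ c₃ c₄)
    (hR : IsAttitudeTrajectory t0 R ω) {c : ℝ} (hω : ∀ t, t0 ≤ t → vnorm (ω t) ≤ c)
    (hx : IsSolution O (fun t => h (R t)) (fun t => ω t + bω) t0 x) :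
    ∃ C : ℝ, ∀ j, (∀ i l, ∀ᵐ t : ℝ, t ∈ interior (slice x.dom j) →
        ∃ d, |d| ≤ C ∧ HasDerivAt (fun s => x.Rhat s j i l) d t) ∧
      ∀ i, ∀ᵐ t : ℝ, t ∈ interior (slice x.dom j) →
        ∃ d, |d| ≤ C ∧ HasDerivAt (fun s => x.bhat s j i) d t := by
  set r := errNorm R bω x t0 0
  set B := √(O.γI * max c₂ (1 / O.γI) * r ^ 2)
  have hγP := hO.γP_pos
  have hγI := hO.γI_pos
  refine ⟨max (3 * (c + B + O.γP * c₄)) (O.γI * c₄), fun j => ?_⟩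
  have hinj : ∀ t ∈ interior (slice x.dom j),
      vnorm (O.inj (h (R t)) (x.Rhat t j) (x.q t j)) ≤ c₄ := by
    intro t ht
    have hm : (t, j) ∈ x.dom := interior_subset (s := slice x.dom j) ht
    have hRh := hx.Rhat_mem t j hm
    rw [hO.inj_eq _ (hR.1 t (hx.dom_hybrid.le hm)) _ hRh _ (hx.q_mem t j hm),
      SO3_vnorm (SO3_transpose hRh)]
    exact hx.vnorm_field_le hO hR ht
  constructor
  · intro i l
    filter_upwards [hx.flow_Rhat j] with t hd ht
    have hm : (t, j) ∈ x.dom := interior_subset (s := slice x.dom j) ht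
    refine ⟨_, ?_, hd ht i l⟩
    refine (abs_mul_skew_apply_le (hx.Rhat_mem t j hm) _ i l).trans (le_max_of_le_left ?_)
    refine mul_le_mul_of_nonneg_left ?_ (by norm_num)
    have e : ω t + bω - x.bhat t j = ω t + biasErr bω x t j := by rw [biasErr]; abel
    rw [e]
    refine (vnorm_add_le _ _).trans (add_le_add ((vnorm_add_le _ _).trans (add_le_add
      (hω t (hx.dom_hybrid.le hm))
      (Real.sqrt_le_sqrt (hx.sqNorm_biasErr_le hO hR hm le_rfl)))) ?_)
    rw [vnorm_smul, abs_of_pos hγP]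
    exact mul_le_mul_of_nonneg_left (hinj t ht) hγP.le
  · intro i
    filter_upwards [hx.flow_bhat j] with t hd ht
    refine ⟨_, ?_, hd ht i⟩
    refine (abs_apply_le_vnorm _ i).trans (le_max_of_le_right ?_)
    rw [vnorm_neg, vnorm_smul, abs_of_pos hγI]
    exact mul_le_mul_of_nonneg_left (hinj t ht) hγI.le

/-- Bounded velocities make the state Lipschitz on the half-open interval, so it extends to the end
point; SO(3) is closed, and the differential equations involve interior times only. -/
theorem Realizes.exists_extension_Ico (hO : Realizes O h P G c₁ c₂ c₃ c₄)
    (hR : IsAttitudeTrajectory t0 R ω) {c : ℝ} (hω : ∀ t, t0 ≤ t → vnorm (ω t) ≤ c)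
    (hx : IsSolution O (fun t => h (R t)) (fun t => ω t + bω) t0 x) {τ : ℕ → ℝ} {N : ℕ} {T : ℝ}
    (hdom : x.dom = finiteDomain τ N (Ico (τ N) T)) (h0 : τ 0 = t0) (hτ : Monotone τ)
    (hT : τ N < T) :
    ∃ x' : HybridArc, IsSolution O (fun t => h (R t)) (fun t => ω t + bω) t0 x' ∧
      x.dom ⊆ x'.dom ∧ (∀ t j, (t, j) ∈ x.dom →
        x'.Rhat t j = x.Rhat t j ∧ x'.bhat t j = x.bhat t j ∧ x'.q t j = x.q t j) ∧
      (T, N) ∈ x'.dom := by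
  have hsl : slice x.dom N = Ico (τ N) T := by
    ext t
    rw [hdom]
    exact mem_finiteDomain_self
  have hint : interior (slice x.dom N) = Ioo (τ N) T := by rw [hsl, interior_Ico]
  have hmem : ∀ {t}, t ∈ Ico (τ N) T → (t, N) ∈ x.dom := fun {t} ht => by
    have : t ∈ slice x.dom N := by rw [hsl]; exact ht
    exact this
  obtain ⟨C, hC⟩ := hx.exists_deriv_bounds hO hR hω
  have hρ : ∀ i l, ∃ g : ℝ → ℝ, (∃ K, LipschitzWith K g) ∧
      ∀ t ∈ Ico (τ N) T, g t = x.Rhat t N i l := fun i l =>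
    LocAbsCont.exists_lipschitz_extension (C := C) (by rw [← hsl]; exact hx.Rhat_ac N i l)
      (by rw [← hint]; exact (hC N).1 i l)
  have hb : ∀ i, ∃ g : ℝ → ℝ, (∃ K, LipschitzWith K g) ∧
      ∀ t ∈ Ico (τ N) T, g t = x.bhat t N i := fun i =>
    LocAbsCont.exists_lipschitz_extension (C := C) (by rw [← hsl]; exact hx.bhat_ac N i)
      (by rw [← hint]; exact (hC N).2 i)
  choose ρ hρK hρeq using hρ
  choose b hbK hbeq using hb
  have hρeq' : ∀ t ∈ Ico (τ N) T, (fun i l => ρ i l t : Mat3) = x.Rhat t N := fun t ht => by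
    ext i l; exact hρeq i l t ht
  have hbeq' : ∀ t ∈ Ico (τ N) T, (fun i => b i t : Vec3) = x.bhat t N := fun t ht => by
    ext i; exact hbeq i t ht
  have hρm : ∀ t ∈ Icc (τ N) T, (fun i l => ρ i l t : Mat3) ∈ SO3 := by
    let Z : ℝ → Mat3 := fun t => (fun i l => ρ i l t : Mat3)
    have hcont : Continuous Z :=
      continuous_pi fun i => continuous_pi fun l => (hρK i l).choose_spec.continuous
    have hmaps : MapsTo Z (Ico (τ N) T) SO3 := fun t ht => by
      rw [show Z t = x.Rhat t N from hρeq' t ht]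
      exact hx.Rhat_mem t N (hmem ht)
    have hcl := hmaps.closure hcont
    rw [closure_Ico hT.ne, isClosed_SO3.closure_eq] at hcl
    exact hcl
  have hq : ∀ t ∈ Ioo (τ N) T, x.q (τ N) N = x.q t N := fun t ht =>
    hx.q_const N _ _ (hmem ⟨le_rfl, hT⟩) (hmem (Ioo_subset_Ico_self ht))
  refine hx.extend_flow hdom h0 hτ ⟨le_rfl, hT⟩ Ico_subset_Icc_self hρeq' hbeq' hρm
    (fun i l => (hρK i l).choose_spec.locAbsCont _) (fun i => (hbK i).choose_spec.locAbsCont _)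
    (fun t ht => ?_) ?_ ?_
  · rw [hρeq' t (Ioo_subset_Ico_self ht), hq t ht]
    exact hx.flow_set N t (by rwa [hint])
  · filter_upwards [hx.flow_Rhat N] with t hd ht i l
    rw [hρeq' t (Ioo_subset_Ico_self ht), hbeq' t (Ioo_subset_Ico_self ht), hq t ht]
    refine (hd (by rwa [hint]) i l).congr_of_eventuallyEq ?_
    filter_upwards [Ioo_mem_nhds ht.1 ht.2] with s hs
    exact hρeq i l s (Ioo_subset_Ico_self hs)
  · filter_upwards [hx.flow_bhat N] with t hd ht i
    rw [hρeq' t (Ioo_subset_Ico_self ht), hq t ht]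
    refine (hd (by rwa [hint]) i).congr_of_eventuallyEq ?_
    filter_upwards [Ioo_mem_nhds ht.1 ht.2] with s hs
    exact hbeq i s (Ioo_subset_Ico_self hs)

-- The local flow started at the end point is concatenated with the solution, without a jump and
-- with the same q.
open Classical in
theorem Realizes.exists_extension_Icc (hO : Realizes O h P G c₁ c₂ c₃ c₄)
    (hR : IsAttitudeTrajectory t0 R ω)
    (hx : IsSolution O (fun t => h (R t)) (fun t => ω t + bω) t0 x) {τ : ℕ → ℝ} {N : ℕ} {T : ℝ}
    (hdom : x.dom = finiteDomain τ N (Icc (τ N) T)) (h0 : τ 0 = t0) (hτ : Monotone τ)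
    (hT : τ N ≤ T) (hgap : O.gap (h (R T)) (x.Rhat T N) (x.q T N) < O.δ) :
    ∃ T' > T, ∃ x' : HybridArc, IsSolution O (fun t => h (R t)) (fun t => ω t + bω) t0 x' ∧
      x.dom ⊆ x'.dom ∧ (∀ t j, (t, j) ∈ x.dom →
        x'.Rhat t j = x.Rhat t j ∧ x'.bhat t j = x.bhat t j ∧ x'.q t j = x.q t j) ∧
      (T', N) ∈ x'.dom := by
  have hsl : slice x.dom N = Icc (τ N) T := by
    ext t
    rw [hdom]
    exact mem_finiteDomain_self
  have hint : interior (slice x.dom N) = Ioo (τ N) T := by rw [hsl, interior_Icc]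
  have hmem : ∀ {t}, t ∈ Icc (τ N) T → (t, N) ∈ x.dom := fun {t} ht => by
    have : t ∈ slice x.dom N := by rw [hsl]; exact ht
    exact this
  have hTm : (T, N) ∈ x.dom := hmem ⟨hT, le_rfl⟩
  have hq : ∀ t ∈ Icc (τ N) T, x.q t N = x.q (τ N) N := fun t ht =>
    hx.q_const N _ _ (hmem ht) (hmem ⟨le_rfl, hT⟩)
  rw [hq T ⟨hT, le_rfl⟩] at hgap
  obtain ⟨T', hTT', ρ, b, hρT, hbT, hρm, hρac, hbac, hρd, hbd⟩ := hO.exists_local_flow hR bω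
    (hx.dom_hybrid.le hTm) (hx.Rhat_mem T N hTm) (x.bhat T N) (hx.q_mem _ _ (hmem ⟨le_rfl, hT⟩))
    hgap
  refine ⟨T', hTT', ?_⟩
  -- The junction is a null set, so no derivative has to be matched there.
  have hne : ∀ᵐ t : ℝ, t ≠ T :=
    compl_mem_ae_iff.2 (measure_singleton (μ := (volume : Measure ℝ)) T)
  set ρ' : ℝ → Mat3 := fun t => if t ≤ T then x.Rhat t N else ρ t with hρ'
  set b' : ℝ → Vec3 := fun t => if t ≤ T then x.bhat t N else b t with hb'
  have hρ1 : ∀ t, t ≤ T → ρ' t = x.Rhat t N := fun t ht => if_pos ht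
  have hb1 : ∀ t, t ≤ T → b' t = x.bhat t N := fun t ht => if_pos ht
  have hρ2 : ∀ t, T ≤ t → ρ' t = ρ t := fun t ht => by
    rcases ht.eq_or_lt with rfl | ht
    · rw [hρ1 _ le_rfl, hρT]
    · exact if_neg (not_le.2 ht)
  have hb2 : ∀ t, T ≤ t → b' t = b t := fun t ht => by
    rcases ht.eq_or_lt with rfl | ht
    · rw [hb1 _ le_rfl, hbT]
    · exact if_neg (not_le.2 ht)
  have hT'N : τ N ≤ T' := hT.trans hTT'.le
  refine hx.extend_flow (ρ := ρ') (b := b') hdom h0 hτ ⟨le_rfl, hT⟩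
    (Icc_subset_Icc_right hTT'.le) (fun t ht => hρ1 t ht.2) (fun t ht => hb1 t ht.2)
    (fun t ht => ?_) (fun i l => locAbsCont_Icc hT'N ?_) (fun i => locAbsCont_Icc hT'N ?_)
    (fun t ht => ?_) ?_ ?_
  · rcases le_total t T with h1 | h1
    · rw [hρ1 t h1]; exact hx.Rhat_mem t N (hmem ⟨ht.1, h1⟩)
    · rw [hρ2 t h1]; exact (hρm t ⟨h1, ht.2⟩).1
  · refine absolutelyContinuousOnInterval_glue hT hTT'.le
      (absolutelyContinuousOnInterval_congr hT
        (hx.Rhat_ac N i l _ _ hT hsl.symm.subset) fun t ht => ?_)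
      (absolutelyContinuousOnInterval_congr hTT'.le (hρac i l) fun t ht => ?_)
    · rw [hρ1 t ht.2]
    · rw [hρ2 t ht.1]
  · refine absolutelyContinuousOnInterval_glue hT hTT'.le
      (absolutelyContinuousOnInterval_congr hT
        (hx.bhat_ac N i _ _ hT hsl.symm.subset) fun t ht => ?_)
      (absolutelyContinuousOnInterval_congr hTT'.le (hbac i) fun t ht => ?_)
    · rw [hb1 t ht.2]
    · rw [hb2 t ht.1]
  · rcases lt_or_ge t T with h1 | h1
    · rw [hρ1 t h1.le, ← hq t ⟨ht.1.le, h1.le⟩]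
      exact hx.flow_set N t (by rw [hint]; exact ⟨ht.1, h1⟩)
    · rw [hρ2 t h1]; exact (hρm t ⟨h1, ht.2.le⟩).2
  · filter_upwards [hx.flow_Rhat N, hρd, hne] with t hd1 hd2 htT ht i l
    rcases lt_or_gt_of_ne htT with h1 | h1
    · rw [hρ1 t h1.le, hb1 t h1.le, ← hq t ⟨ht.1.le, h1.le⟩]
      refine (hd1 (by rw [hint]; exact ⟨ht.1, h1⟩) i l).congr_of_eventuallyEq ?_
      filter_upwards [Iio_mem_nhds h1] with s hs
      rw [hρ1 s (le_of_lt hs)]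
    · rw [hρ2 t h1.le, hb2 t h1.le]
      refine (hd2 ⟨h1, ht.2⟩ i l).congr_of_eventuallyEq ?_
      filter_upwards [Ioi_mem_nhds h1] with s hs
      rw [hρ2 s (le_of_lt hs)]
  · filter_upwards [hx.flow_bhat N, hbd, hne] with t hd1 hd2 htT ht i
    rcases lt_or_gt_of_ne htT with h1 | h1
    · rw [hρ1 t h1.le, ← hq t ⟨ht.1.le, h1.le⟩]
      refine (hd1 (by rw [hint]; exact ⟨ht.1, h1⟩) i).congr_of_eventuallyEq ?_
      filter_upwards [Iio_mem_nhds h1] with s hs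
      rw [hb1 s (le_of_lt hs)]
    · rw [hρ2 t h1.le]
      refine (hd2 ⟨h1, ht.2⟩ i).congr_of_eventuallyEq ?_
      filter_upwards [Ioi_mem_nhds h1] with s hs
      rw [hb2 s (le_of_lt hs)]

/-- An infinite jump sequence makes t + j unbounded, and so does an unbounded last interval. In the
other two shapes of the domain a proper extension contradicts maximality: an open end is closed, and
at a closed end the gap is either at least δ, allowing a jump, or below δ, allowing a flow. -/
theorem Realizes.isComplete (hO : Realizes O h P G c₁ c₂ c₃ c₄)
    (hR : IsAttitudeTrajectory t0 R ω) {c : ℝ} (hω : ∀ t, t0 ≤ t → vnorm (ω t) ≤ c)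
    (hx : IsMaximalSolution O (fun t => h (R t)) (fun t => ω t + bω) t0 x) : x.IsComplete := by
  obtain ⟨hsol, hmax⟩ := hx
  by_contra hnc
  rw [HybridArc.IsComplete] at hnc
  push Not at hnc
  obtain ⟨M, hM⟩ := hnc
  obtain ⟨τ, h0, hτ, hdom | ⟨N, L, hL, hdom⟩⟩ := hsol.dom_hybrid
  · obtain ⟨n, hn⟩ := exists_nat_ge (M - t0)
    have h1 := hM (τ n) n (by rw [hdom]; exact ⟨le_rfl, hτ (Nat.le_succ n)⟩)
    have h2 : t0 ≤ τ n := h0 ▸ hτ (Nat.zero_le n)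
    linarith
  · change x.dom = finiteDomain τ N L at hdom
    rcases hL with rfl | ⟨hlt, rfl⟩ | rfl
    · have hTN := hτ (Nat.le_succ N)
      rcases le_or_gt O.δ (O.gap (h (R (τ (N + 1)))) (x.Rhat (τ (N + 1)) N)
        (x.q (τ (N + 1)) N)) with hg | hg
      · obtain ⟨x', hx', hsub, hag, hm⟩ := hsol.extend_jump hdom h0 hτ hO.potential.nonempty hg
        rw [hmax x' hx' hsub hag, hdom] at hm
        exact absurd (le_of_mem_finiteDomain hm) (Nat.not_succ_le_self N)
      · obtain ⟨T', hT', x', hx', hsub, hag, hm⟩ :=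
          hO.exists_extension_Icc hR hsol hdom h0 hτ hTN hg
        rw [hmax x' hx' hsub hag, hdom, mem_finiteDomain_self] at hm
        exact absurd hm.2 (not_le.2 hT')
    · obtain ⟨x', hx', hsub, hag, hm⟩ := hO.exists_extension_Ico hR hω hsol hdom h0 hτ hlt
      rw [hmax x' hx' hsub hag, hdom, mem_finiteDomain_self] at hm
      exact lt_irrefl (τ (N + 1)) hm.2
    · have h1 := hM (max (τ N) M) N (by rw [hdom, mem_finiteDomain_self]; exact mem_Ici.2 (le_max_left _ _))
      have h2 := le_max_right (τ N) M
      have h3 : (0 : ℝ) ≤ N := Nat.cast_nonneg N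
      linarith

theorem Realizes.ensuresExpStability (hO : Realizes O h P G c₁ c₂ c₃ c₄) :
    EnsuresExpStability O h := by
  refine ⟨fun t0 R ω bω x _ hR ⟨c, hω⟩ hx => hO.isComplete hR hω hx, ?_⟩
  obtain ⟨K, hK, hKb⟩ := hO.exists_exponential_bound
  refine ⟨K, hK, fun r c hr hc => ?_⟩
  obtain ⟨N, μ, hμ, hb⟩ := hKb r c hr hc
  exact ⟨N, μ, hμ, fun t0 R ω bω x _ hR hω hx he => hb t0 R ω bω x hR hω hx he⟩

end Completeness

/-! ### The two observers -/

section Observers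

variable {n : ℕ} {a : Fin n → Vec3} {ρ : Fin n → ℝ} {lam : Fin 3 → ℝ} {v : Fin 3 → Vec3} {u : Vec3}
  {k : ℝ}

theorem realizes_observerIII (h : SpectralFrame (weightMat ρ a) lam v)
    (hD : IsDesign (weightMat ρ a) lam v u k) {δ γP γI : ℝ} (hγP : 0 < γP) (hγI : 0 < γI)
    (hδ : 0 < δ) (hδ' : δ < DeltaIII (weightMat ρ a) lam k) :
    ∃ c₁ c₂ c₃ c₄, Realizes (observerIII ρ a k u δ γP γI) (bodyMeas a)
      (PhiU (weightMat ρ a) k (nuMap u)) (fun X q => gradVec (weightMat ρ a) k (nuMap u q) X)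
      c₁ c₂ c₃ c₄ := by
  obtain ⟨c₁, c₂, c₃, c₄, hP⟩ := h.isHybridPotential_U hD hδ hδ'
  exact ⟨c₁, c₂, c₃, c₄, hP, hγP, hγI,
    fun R hR Rhat hRh q _ => PhiBar_bodyMeas ρ a hR hRh k (sqNorm_nuMap hD.unit_u q),
    fun R hR Rhat hRh q _ => betaBar_bodyMeas ρ a hR hRh k (sqNorm_nuMap hD.unit_u q)⟩

theorem realizes_observerIV (h : SpectralFrame (weightMat ρ a) lam v)
    (hD : IsDesign (weightMat ρ a) lam v u k) {δ γP γI : ℝ} (hγP : 0 < γP) (hγI : 0 < γI)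
    (hδ : 0 < δ) (hδ' : δ < DeltaIV (weightMat ρ a) lam k) :
    ∃ c₁ c₂ c₃ c₄, Realizes (observerIV ρ a k u δ γP γI) (bodyMeas a)
      (PhiV (weightMat ρ a) k (nuMap u))
      (fun X q => (1 / √(1 - PhiU (weightMat ρ a) k (nuMap u) X q)) •
        gradVec (weightMat ρ a) k (nuMap u q) X) c₁ c₂ c₃ c₄ := by
  obtain ⟨c₁, c₂, c₃, c₄, hP⟩ := h.isHybridPotential_V hD hδ hδ'
  refine ⟨c₁, c₂, c₃, c₄, hP, hγP, hγI, fun R hR Rhat hRh q _ => ?_,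
    fun R hR Rhat hRh q _ => ?_⟩
  · change 2 * (1 - √(1 - PhiBar ρ a k (nuMap u) (bodyMeas a R) Rhat q)) = _
    rw [PhiBar_bodyMeas ρ a hR hRh k (sqNorm_nuMap hD.unit_u q)]
    rfl
  · change (1 / √(1 - PhiBar ρ a k (nuMap u) (bodyMeas a R) Rhat q)) •
      betaBar ρ a k (nuMap u) (bodyMeas a R) Rhat q = _
    rw [PhiBar_bodyMeas ρ a hR hRh k (sqNorm_nuMap hD.unit_u q),
      betaBar_bodyMeas ρ a hR hRh k (sqNorm_nuMap hD.unit_u q), mulVec_smul]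

theorem isGradSO3_PhiU (h : SpectralFrame (weightMat ρ a) lam v)
    (hD : IsDesign (weightMat ρ a) lam v u k) {X : Mat3} (hX : X ∈ SO3) (q : ℕ) :
    IsGradSO3 (fun Y => PhiU (weightMat ρ a) k (nuMap u) Y q) X
      (X * skew (gradVec (weightMat ρ a) k (nuMap u q) X)) := by
  obtain ⟨D, hDer, hω⟩ := hasFDerivAt_warped (weightMat ρ a) (sqNorm_nuMap hD.unit_u q)
    (h.gain_lt_one hD hX)
  exact isGradSO3_of_hasFDerivAt hX hDer hω

theorem isGradSO3_PhiV (h : SpectralFrame (weightMat ρ a) lam v)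
    (hD : IsDesign (weightMat ρ a) lam v u k) {X : Mat3} (hX : X ∈ SO3) {q : ℕ}
    (hne : PhiU (weightMat ρ a) k (nuMap u) X q ≠ 1) :
    IsGradSO3 (fun Y => PhiV (weightMat ρ a) k (nuMap u) Y q) X
      (X * skew ((1 / √(1 - PhiU (weightMat ρ a) k (nuMap u) X q)) •
        gradVec (weightMat ρ a) k (nuMap u q) X)) := by
  obtain ⟨D, hDer, hω⟩ := h.hasFDerivAt_PhiV hD hX hne
  exact isGradSO3_of_hasFDerivAt hX hDer hω

end Observers

end AttitudeObserver

open AttitudeObserver in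
theorem theorem3 {n : ℕ} (a : Fin n → Vec3) (ρ : Fin n → ℝ) (hρ : ∀ i, 0 < ρ i)
    (hmeas : ∃ s : Fin 3 → Fin n, LinearIndependent ℝ (fun m => a (s m)))
    (lam : Fin 3 → ℝ) (v : Fin 3 → Vec3) (u : Vec3) (k : ℝ)
    (hD : IsDesign (weightMat ρ a) lam v u k)
    (γP γI : ℝ) (hγP : 0 < γP) (hγI : 0 < γI) :
    (∀ δ : ℝ, 0 < δ → δ < DeltaIII (weightMat ρ a) lam k →
      (∀ R ∈ SO3, ∀ Rhat ∈ SO3, ∀ q ∈ indexSet,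
        PhiU (weightMat ρ a) k (nuMap u) (R * Rhatᵀ) q
            = PhiBar ρ a k (nuMap u) (bodyMeas a R) Rhat q ∧
          DiffAtSO3 (fun Y => PhiU (weightMat ρ a) k (nuMap u) Y q) (R * Rhatᵀ) ∧
          beta (PhiU (weightMat ρ a) k (nuMap u)) Rhat (R * Rhatᵀ) q
            = betaBar ρ a k (nuMap u) (bodyMeas a R) Rhat q) ∧
      EnsuresExpStability (observerIII ρ a k u δ γP γI) (bodyMeas a)) ∧
    (∀ δ : ℝ, 0 < δ → δ < DeltaIV (weightMat ρ a) lam k →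
      (∀ R ∈ SO3, ∀ Rhat ∈ SO3, ∀ q ∈ indexSet,
        PhiV (weightMat ρ a) k (nuMap u) (R * Rhatᵀ) q
            = 2 * (1 - √(1 - PhiBar ρ a k (nuMap u) (bodyMeas a R) Rhat q)) ∧
          (PhiU (weightMat ρ a) k (nuMap u) (R * Rhatᵀ) q ≠ 1 →
            PhiBar ρ a k (nuMap u) (bodyMeas a R) Rhat q < 1 ∧
            DiffAtSO3 (fun Y => PhiV (weightMat ρ a) k (nuMap u) Y q) (R * Rhatᵀ) ∧
            beta (PhiV (weightMat ρ a) k (nuMap u)) Rhat (R * Rhatᵀ) q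
              = (1 / √(1 - PhiBar ρ a k (nuMap u) (bodyMeas a R) Rhat q)) •
                betaBar ρ a k (nuMap u) (bodyMeas a R) Rhat q)) ∧
      (∀ z ∈ flowSet (PhiV (weightMat ρ a) k (nuMap u)) indexSet δ,
        PhiU (weightMat ρ a) k (nuMap u) z.1 z.2 ≠ 1) ∧
      EnsuresExpStability (observerIV ρ a k u δ γP γI) (bodyMeas a)) := by
  have hF := hD.spectralFrame hρ hmeas
  refine ⟨fun δ hδ hδ' => ⟨fun R hR Rhat hRh q _ => ?_, ?_⟩,
    fun δ hδ hδ' => ⟨fun R hR Rhat hRh q _ => ⟨?_, fun hne => ?_⟩, fun z hz => ?_, ?_⟩⟩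
  · have hX := SO3_mul hR (SO3_transpose hRh)
    have hν := sqNorm_nuMap hD.unit_u q
    have hg := isGradSO3_PhiU hF hD hX q
    refine ⟨(PhiBar_bodyMeas ρ a hR hRh k hν).symm, ⟨_, hg⟩, ?_⟩
    rw [betaBar_bodyMeas ρ a hR hRh k hν]
    exact beta_eq hX hg
  · obtain ⟨_, _, _, _, hO⟩ := realizes_observerIII hF hD hγP hγI hδ hδ'
    exact hO.ensuresExpStability
  · rw [PhiBar_bodyMeas ρ a hR hRh k (sqNorm_nuMap hD.unit_u q)]
    rfl
  · have hX := SO3_mul hR (SO3_transpose hRh)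
    have hν := sqNorm_nuMap hD.unit_u q
    have hg := isGradSO3_PhiV hF hD hX hne
    rw [PhiBar_bodyMeas ρ a hR hRh k hν]
    refine ⟨lt_of_le_of_ne (hF.PhiU_le_one hD hX q) hne, ⟨_, hg⟩, ?_⟩
    rw [betaBar_bodyMeas ρ a hR hRh k hν, ← Matrix.mulVec_smul]
    exact beta_eq hX hg
  · exact hF.PhiU_ne_one_of_mem_flowSet hD hδ' hz
  · obtain ⟨_, _, _, _, hO⟩ := realizes_observerIV hF hD hγP hγI hδ hδ'
    exact hO.ensuresExpStability
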